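/- Let $\mathbb T=\mathbb R/2\pi\mathbb Z$, $\langle x\rangle=(1+x^2)^{1/2}$, and write $k^{2\alpha}$ for $|k|^{2\alpha}$. For a function $u$ on $\mathbb R_t\times\mathbb T_x$ let $u_k(t)=\frac1{2\pi}\int_0^{2\pi}u(t,x)e^{-ikx}\,dx$ be its spatial Fourier coefficients, let $\widehat u(k,\tau)$ be the Fourier transform of $u_k$ in time (in the sense of tempered distributions), and put $$\|u\|_{X^{s,b}}=\big\|\langle\tau-|k|^{2\alpha}\rangle^{b}\langle k\rangle^{s}\,\widehat u(k,\tau)\big\|_{L^2_\tau\ell^2_k}.$$ For $s,b\ge 0$, $X^{s,b}$ is the space of $u\in L^2(\mathbb R\times\mathbb T)$ with finite norm. Fix a constant $c>0$ and define $NR_1(u)$, $NR_2(u)$ at each time $t$ through their spatial Fourier coefficients $$\widehat{NR_1(u)}(k)=2\sum_{\substack{k-k_1+k_2-k_3+k_4-k_5=0\\ |k_1-k||k_2-k_1|\ge c\langle k\rangle^{2-2\alpha}}}\frac{u_{k_1}\overline{u_{k_2}}u_{k_3}\overline{u_{k_4}}u_{k_5}}{k^{2\alpha}-k_1^{2\alpha}+k_2^{2\alpha}-(k-k_1+k_2)^{2\alpha}},$$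 $$\widehat{NR_2(u)}(k)=-\sum_{\substack{k-k_1+k_2-k_3+k_4-k_5=0\\ |k_1-k||k-k_3|\ge c\langle k\rangle^{2-2\alpha}}}\frac{u_{k_1}\overline{u_{k_2}}u_{k_3}\overline{u_{k_4}}u_{k_5}}{k^{2\alpha}-k_1^{2\alpha}+(k-k_1-k_3)^{2\alpha}-k_3^{2\alpha}}.$$ **Proposition.** Let $\frac12<\alpha\le1$, $\frac34-\frac\alpha2<s\le\frac12$, and $a\le\min(2\alpha-1,\,2s+\alpha-1)$, where the inequality is strict if the minimum equals $2s+\alpha-1$. Then there is $b_0<\frac12$ such that for every $b\in(b_0,\frac12)$ there is a constant $C$, depending only on $\alpha,c,s,a,b$, such that for every $u\in X^{s,b}$ the series defining $\widehat{NR_1(u)}(k)$ and $\widehat{NR_2(u)}(k)$ converge absolutely for almost every $t$ and all $k\in\mathbb Z$, and $$\|NR_j(u)\|_{X^{s+a,-b}}\le C\,\|u\|_{X^{s,b}}^5,\qquad j=1,2.$$ -/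

import Mathlib

open MeasureTheory
open scoped ENNReal NNReal

noncomputable section

namespace FracNLS

/-- The torus `𝕋 = ℝ / 2πℤ`. -/
abbrev Torus : Type := AddCircle (2 * Real.pi)

instance factTwoPiPos : Fact (0 < 2 * Real.pi) := ⟨Real.two_pi_pos⟩

/-- The Japanese bracket `⟨x⟩ = (1 + x²)^{1/2}`. -/
def jb (x : ℝ) : ℝ := Real.sqrt (1 + x ^ 2)

/-- The dispersion relation `|k|^{2α}`, written `k^{2α}` for short. -/
def disp (α : ℝ) (k : ℤ) : ℝ := |(k : ℝ)| ^ (2 * α)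

/-- The time-dependent spatial Fourier coefficients
`u_k(t) = (2π)⁻¹ ∫₀^{2π} u(t,x) e^{-ikx} dx` of a space-time function `u`
(`fourierCoeff` integrates against the normalized Haar measure of the torus). -/
def modes (u : ℝ → Torus → ℂ) (k : ℤ) (t : ℝ) : ℂ := fourierCoeff (u t) k

/-- `F` is the Fourier transform `F(τ) = ∫ f(t) e^{-iτt} dt` of `f` in the sense of tempered
distributions: both functions act on Schwartz functions by integration, and
`∫ F φ = ∫ f(t) (∫ φ(τ) e^{-iτt} dτ) dt` for every Schwartz function `φ`. -/
def IsTimeFourier (f F : ℝ → ℂ) : Prop :=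
  (∀ φ : SchwartzMap ℝ ℂ, Integrable (fun t => f t * φ t)) ∧
  (∀ φ : SchwartzMap ℝ ℂ, Integrable (fun τ => F τ * φ τ)) ∧
  ∀ φ : SchwartzMap ℝ ℂ,
    ∫ τ, F τ * φ τ =
      ∫ t, f t * ∫ τ : ℝ, φ τ * Complex.exp (-(Complex.I * (τ : ℂ) * (t : ℂ)))

/-- The quantity `‖⟨τ - |k|^{2α}⟩^b ⟨k⟩^s F(k,τ)‖_{L²_τ ℓ²_k}`. -/
def weightedL2 (α s b : ℝ) (F : ℤ → ℝ → ℂ) : ℝ≥0∞ :=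
  (∑' k : ℤ, ∫⁻ τ : ℝ,
    (ENNReal.ofReal (jb (τ - disp α k) ^ b * jb (k : ℝ) ^ s) * ‖F k τ‖ₑ) ^ 2) ^ (1 / 2 : ℝ)

/-- The `X^{s,b}` norm of the space-time distribution whose time-dependent spatial Fourier
coefficients are `c k t`. The space-time Fourier transform `F` is unique up to null sets, so
the infimum runs over a single value; it is `∞` if there is no such function `F`. -/
def xNorm (α s b : ℝ) (c : ℤ → ℝ → ℂ) : ℝ≥0∞ :=
  ⨅ (F : ℤ → ℝ → ℂ) (_ : ∀ k, IsTimeFourier (c k) (F k)), weightedL2 α s b F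

/-- Membership in `X^{s,b}` for `s, b ≥ 0`, where this is a subspace of `L²(ℝ × 𝕋)`. -/
def MemX (α s b : ℝ) (u : ℝ → Torus → ℂ) : Prop :=
  MemLp (Function.uncurry u) 2 ((volume : Measure ℝ).prod AddCircle.haarAddCircle) ∧
  xNorm α s b (modes u) < ∞

/-- Frequencies `(k₁,…,k₅)`, with `κ i` in the role of `k_{i+1}`, such that
`k - k₁ + k₂ - k₃ + k₄ - k₅ = 0` and `|k₁ - k| |k₂ - k₁| ≥ c ⟨k⟩^{2-2α}`. -/
def freq1 (α c : ℝ) (k : ℤ) : Set (Fin 5 → ℤ) :=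
  {κ | k - κ 0 + κ 1 - κ 2 + κ 3 - κ 4 = 0 ∧
    c * jb (k : ℝ) ^ (2 - 2 * α) ≤ |((κ 0 - k : ℤ) : ℝ)| * |((κ 1 - κ 0 : ℤ) : ℝ)|}

/-- Frequencies `(k₁,…,k₅)`, with `κ i` in the role of `k_{i+1}`, such that
`k - k₁ + k₂ - k₃ + k₄ - k₅ = 0` and `|k₁ - k| |k - k₃| ≥ c ⟨k⟩^{2-2α}`. -/
def freq2 (α c : ℝ) (k : ℤ) : Set (Fin 5 → ℤ) :=
  {κ | k - κ 0 + κ 1 - κ 2 + κ 3 - κ 4 = 0 ∧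
    c * jb (k : ℝ) ^ (2 - 2 * α) ≤ |((κ 0 - k : ℤ) : ℝ)| * |((k - κ 2 : ℤ) : ℝ)|}

/-- The product `a_{k₁} conj(a_{k₂}) a_{k₃} conj(a_{k₄}) a_{k₅}`. -/
def quintic (a : ℤ → ℂ) (κ : Fin 5 → ℤ) : ℂ :=
  a (κ 0) * star (a (κ 1)) * a (κ 2) * star (a (κ 3)) * a (κ 4)

/-- The summand of `NR₁` at output frequency `k`. -/
def nr1Term (α : ℝ) (a : ℤ → ℂ) (k : ℤ) (κ : Fin 5 → ℤ) : ℂ :=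
  quintic a κ /
    ((disp α k - disp α (κ 0) + disp α (κ 1) - disp α (k - κ 0 + κ 1) : ℝ) : ℂ)

/-- The summand of `NR₂` at output frequency `k`. -/
def nr2Term (α : ℝ) (a : ℤ → ℂ) (k : ℤ) (κ : Fin 5 → ℤ) : ℂ :=
  quintic a κ /
    ((disp α k - disp α (κ 0) + disp α (k - κ 0 - κ 2) - disp α (κ 2) : ℝ) : ℂ)

/-- The `k`-th Fourier coefficient of `NR₁(u)` at time `t`. -/
def NR1 (α c : ℝ) (u : ℝ → Torus → ℂ) (k : ℤ) (t : ℝ) : ℂ :=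
  2 * ∑' κ : freq1 α c k, nr1Term α (fun n => modes u n t) k κ

/-- The `k`-th Fourier coefficient of `NR₂(u)` at time `t`. -/
def NR2 (α c : ℝ) (u : ℝ → Torus → ℂ) (k : ℤ) (t : ℝ) : ℂ :=
  -∑' κ : freq2 α c k, nr2Term α (fun n => modes u n t) k κ

end FracNLS

end

open MeasureTheory
open scoped ENNReal NNReal

noncomputable section

namespace FracNLS

/-! ### The Japanese bracket -/

/-! Each denominator is a second difference of `|x|^{2α}` over a parallelogram with corners `k`,
`k+n`, `k+m`, `k+n+m`. For `NR₁` the steps are `n = k₁ - k`, `m = k₂ - k₁`; for `NR₂` they are `n =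
k₁ - k`, `m = k₃ - k`. On `[-R, R]` the function `|x|^{2α}` is at least as convex as
`α(2α-1)R^{2α-2}x²`, so such a difference is at least a constant times `R^{2α-2}|n||m|`
(`le_abs_second_difference`). This convexity is used both to bound denominators and to separate
phases.

The time Fourier transform of a quintic product is a convolution of five functions, each an `L²`
function divided by `⟨τ ∓ |k_i|^{2α}⟩^b`. Cauchy–Schwarz in each convolution bounds its square by
`⟨τ - phase⟩^{-γ}` times an integrable function, with `γ = 1 - 9(1-2b)` (`WeightBound.conv5`). A
further Cauchy–Schwarz over the frequencies (`mul_lintegral_quinticMajorant_sq_le`) reduces the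
estimate to a bound, uniform in `k`, for the sum of `⟨k⟩^{2(s+a)} D^{-2} ∏⟨k_i⟩^{-2s} ⟨|k|^{2α} -
phase⟩^{-γ}`. The remaining factor is summable over all `k` because the five frequencies determine
`k`.

That sum splits into an inner and an outer one. The three frequencies outside the denominator have a
fixed alternating sum `q`, and their sum is at most a constant times `⟨q⟩^{-2s}`
(`exists_tsum_innerTerm_le`). With one of them frozen the phases along another, `p`, are separated
by a multiple of `⟨p⟩^{-(2-2α)}`, so the sum is comparable to a convergent integral; this uses `4s >
1 + (2-2α)`, that is `s > 3/4 - α/2`. The factor `⟨q⟩^{-2s}` completes the weights on the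
parallelogram, and the outer sum over `n, m` is bounded in `k` (`exists_tsum_outerTerm_le`). If
`|n|` or `|m|` is at least of size `⟨k⟩`, this needs `a ≤ 2α-1`. Otherwise all corners have size
`⟨k⟩`, and the condition `|n||m| ≥ c⟨k⟩^{2-2α}` together with `a < 2s+α-1` suffices.

Since `b < 1/2`, a mode need not have an integrable Fourier transform, so these computations need
justification. The transform of `v³` is a triple convolution, and Plancherel gives `‖v‖₆² ≲ ‖⟨τ-ω⟩^b
F‖₂²`. Hölder with exponent 6 then makes the series converge absolutely almost everywhere once `∑
|D|^{-1} ∏ ‖u_{k_i}‖₆` is finite for each `k` (`tsum_freq1_lt_top`, `tsum_freq2_lt_top`).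
Approximation in `L⁶` carries the convolution bound over to the actual products tested against
Schwartz functions, and the Riesz representation theorem in weighted `L²` yields the Fourier
transform of the output (`exists_temperedPair`). -/

lemma one_le_jb (x : ℝ) : 1 ≤ jb x := by
  unfold jb
  rw [Real.one_le_sqrt]
  nlinarith [sq_nonneg x]

lemma jb_pos (x : ℝ) : 0 < jb x := zero_lt_one.trans_le (one_le_jb x)

lemma jb_sq (x : ℝ) : jb x ^ 2 = 1 + x ^ 2 := by
  unfold jb
  rw [Real.sq_sqrt]
  positivity

lemma abs_le_jb (x : ℝ) : |x| ≤ jb x := by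
  refine abs_le_of_sq_le_sq ?_ (jb_pos x).le
  rw [jb_sq]
  linarith

lemma jb_le_one_add_abs (x : ℝ) : jb x ≤ 1 + |x| := by
  refine le_of_sq_le_sq ?_ (by positivity)
  rw [jb_sq]
  nlinarith [abs_nonneg x, sq_abs x]

lemma jb_neg (x : ℝ) : jb (-x) = jb x := by simp [jb]

lemma jb_le_add_abs (x y : ℝ) : jb (x + y) ≤ jb x + |y| := by
  refine le_of_sq_le_sq ?_ (by have := jb_pos x; positivity)
  have h1 := jb_sq (x + y)
  have h2 := jb_sq x
  have h3 : x * y ≤ jb x * |y| := by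
    calc x * y ≤ |x * y| := le_abs_self _
      _ = |x| * |y| := abs_mul _ _
      _ ≤ _ := by gcongr; exact abs_le_jb x
  nlinarith [sq_abs y]

lemma jb_add_le (x y : ℝ) : jb (x + y) ≤ jb x + jb y :=
  (jb_le_add_abs x y).trans (by linarith [abs_le_jb y])

lemma jb_rpow_pos (x r : ℝ) : 0 < jb x ^ r := Real.rpow_pos_of_pos (jb_pos x) r

lemma continuous_jb : Continuous jb := by unfold jb; fun_prop

@[fun_prop]
lemma measurable_jb : Measurable jb := continuous_jb.measurable

/-! ### Elementary inequalities between powers -/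

lemma rpow_neg_le_of_le_mul {x y C r : ℝ} (hx : 0 < x) (hy : 0 < y) (hC : 0 < C) (hr : 0 ≤ r)
    (h : x ≤ C * y) : y ^ (-r) ≤ C ^ r * x ^ (-r) := by
  rw [Real.rpow_neg hx.le, Real.rpow_neg hy.le, ← div_eq_mul_inv, inv_eq_one_div,
    div_le_div_iff₀ (by positivity) (by positivity), one_mul, ← Real.mul_rpow hC.le hy.le]
  exact Real.rpow_le_rpow hx.le h hr

/-- The smaller of the two bases can absorb both exponents. The product becomes a sum whose terms
depend on one variable each and can be summed separately. -/
lemma rpow_neg_mul_rpow_neg_le {x y p q : ℝ} (hx : 1 ≤ x) (hy : 1 ≤ y) (hp : 0 ≤ p)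
    (hq : 0 ≤ q) : x ^ (-p) * y ^ (-q) ≤ x ^ (-(p + q)) + y ^ (-(p + q)) := by
  have hx0 : 0 < x := by linarith
  have hy0 : 0 < y := by linarith
  rcases le_total x y with h | h
  · have : y ^ (-q) ≤ x ^ (-q) := Real.rpow_le_rpow_of_nonpos hx0 h (by linarith)
    calc x ^ (-p) * y ^ (-q) ≤ x ^ (-p) * x ^ (-q) := by gcongr
      _ = x ^ (-(p + q)) := by rw [← Real.rpow_add hx0]; ring_nf
      _ ≤ _ := by have : 0 < y ^ (-(p + q)) := by positivity
                  linarith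
  · have : x ^ (-p) ≤ y ^ (-p) := Real.rpow_le_rpow_of_nonpos hy0 h (by linarith)
    calc x ^ (-p) * y ^ (-q) ≤ y ^ (-p) * y ^ (-q) := by gcongr
      _ = y ^ (-(p + q)) := by rw [← Real.rpow_add hy0]; ring_nf
      _ ≤ _ := by have : 0 < x ^ (-(p + q)) := by positivity
                  linarith

/-- Trading a small power of `P` for a better power of `X`. -/
lemma rpow_neg_mul_rpow_neg_le_add {P X θ η ε : ℝ} (hP : 1 ≤ P) (hX : 1 ≤ X) (hθ : 0 ≤ θ)
    (hε : 0 < ε) (hε' : ε ≤ 1 / 2) (hεη : 8 * ε ≤ η) :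
    P ^ (-(θ + η)) * X ^ (-(1 - ε)) ≤ P ^ (-2 : ℝ) + P ^ (-θ) * X ^ (-(1 + ε)) := by
  have hP0 : 0 < P := by linarith
  have hX0 : 0 < X := by linarith
  have e1 : X ^ (-(1 - ε)) = X ^ (-(1 + ε)) * X ^ (2 * ε) := by
    rw [← Real.rpow_add hX0]; ring_nf
  have e2 : P ^ (-(θ + η)) = P ^ (-θ) * P ^ (-η) := by
    rw [← Real.rpow_add hP0]; ring_nf
  -- In the first case the surplus `P^{-η}` pays for raising the exponent of `X` from `1 - ε` to `1
  -- + ε`. In the second, `8ε ≤ η` forces `X ≥ P⁴`, and `X^{-1/2}` alone already gives `P^{-2}`.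
  rcases le_total (X ^ (2 * ε)) (P ^ η) with h | h
  · have : P ^ (-(θ + η)) * X ^ (-(1 - ε)) ≤ P ^ (-θ) * X ^ (-(1 + ε)) := by
      rw [e1, e2]
      calc P ^ (-θ) * P ^ (-η) * (X ^ (-(1 + ε)) * X ^ (2 * ε))
          ≤ P ^ (-θ) * P ^ (-η) * (X ^ (-(1 + ε)) * P ^ η) := by gcongr
        _ = P ^ (-θ) * X ^ (-(1 + ε)) * (P ^ (-η) * P ^ η) := by ring
        _ = _ := by rw [← Real.rpow_add hP0]; simp
    have : 0 < P ^ (-2 : ℝ) := by positivity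
    linarith
  · have h2 : P ^ (4 : ℝ) ≤ X := by
      have h3 : P ^ (8 * ε) ≤ X ^ (2 * ε) :=
        (Real.rpow_le_rpow_of_exponent_le hP hεη).trans h
      have h4 : (P ^ (4 : ℝ)) ^ (2 * ε) ≤ X ^ (2 * ε) := by
        rw [← Real.rpow_mul hP0.le]
        convert h3 using 2
        ring
      exact (Real.rpow_le_rpow_iff (by positivity) hX0.le (by linarith)).1 h4
    have h5 : X ^ (-(1 - ε)) ≤ P ^ (-2 : ℝ) := by
      calc X ^ (-(1 - ε)) ≤ X ^ (-(1 / 2) : ℝ) :=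
            Real.rpow_le_rpow_of_exponent_le hX (by linarith)
        _ ≤ (P ^ (4 : ℝ)) ^ (-(1 / 2) : ℝ) :=
            Real.rpow_le_rpow_of_nonpos (by positivity) h2 (by norm_num)
        _ = P ^ (-2 : ℝ) := by rw [← Real.rpow_mul hP0.le]; norm_num
    have h6 : P ^ (-(θ + η)) ≤ 1 := Real.rpow_le_one_of_one_le_of_nonpos hP (by linarith)
    have h7 : 0 < P ^ (-θ) * X ^ (-(1 + ε)) := by positivity
    have h8 : P ^ (-(θ + η)) * X ^ (-(1 - ε)) ≤ 1 * P ^ (-2 : ℝ) := by gcongr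
    linarith

/-! ### Integrals and sums of powers of the bracket -/

lemma lintegral_jb_lt_top {r : ℝ} (hr : 1 < r) :
    ∫⁻ x : ℝ, ENNReal.ofReal (jb x ^ (-r)) < ∞ := by
  have h := integrable_rpow_neg_one_add_norm_sq (E := ℝ) (μ := volume) (r := r) (by simpa using hr)
  have h2 := h.lintegral_lt_top
  convert h2 using 4 with x
  unfold jb
  rw [Real.sqrt_eq_rpow, ← Real.rpow_mul (by positivity), Real.norm_eq_abs, sq_abs]
  ring_nf

lemma tsum_jb_lt_top {r : ℝ} (hr : 1 < r) :
    ∑' k : ℤ, ENNReal.ofReal (jb k ^ (-r)) < ∞ := by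
  have h : Summable (fun k : ℤ => |(k : ℝ)| ^ (-r)) :=
    Real.summable_abs_int_rpow hr
  have h2 : Summable (fun k : ℤ => jb k ^ (-r)) := by
    refine Summable.of_norm_bounded_eventually (g := fun k : ℤ => |(k : ℝ)| ^ (-r)) h ?_
    filter_upwards [(Set.finite_singleton (0 : ℤ)).compl_mem_cofinite] with k hk
    have hk : k ≠ 0 := by simpa using hk
    rw [Real.norm_of_nonneg (jb_rpow_pos _ _).le]
    have : 0 < |(k : ℝ)| := by positivity
    exact Real.rpow_le_rpow_of_nonpos this (abs_le_jb _) (by linarith)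
  exact h2.tsum_ofReal_lt_top

/-- The sum `∑ ⟨k⟩^{-r}` over the integers. -/
def jbSum (r : ℝ) : ℝ≥0∞ := ∑' k : ℤ, ENNReal.ofReal (jb k ^ (-r))

lemma jbSum_lt_top {r : ℝ} (hr : 1 < r) : jbSum r < ∞ := tsum_jb_lt_top hr

lemma tsum_jb_add (r : ℝ) (m : ℤ) :
    ∑' k : ℤ, ENNReal.ofReal (jb ((m + k : ℤ) : ℝ) ^ (-r)) = jbSum r :=
  (Equiv.addLeft m).tsum_eq (fun k : ℤ => ENNReal.ofReal (jb (k : ℝ) ^ (-r)))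

/-! ### Second differences of the dispersion relation -/

/-- The points `x + n` and `x + m` are convex combinations of `x` and `x + n + m` with exchanged
weights, so adding the two convexity inequalities gives the claim. -/
lemma ConvexOn.add_le_add_of_mul_nonneg {g : ℝ → ℝ} {S : Set ℝ} (hg : ConvexOn ℝ S g)
    {x n m : ℝ} (h0 : x ∈ S) (h1 : x + n + m ∈ S) (hnm : 0 ≤ n * m) :
    g (x + n) + g (x + m) ≤ g x + g (x + n + m) := by
  rcases eq_or_ne (n + m) 0 with h | h
  · have hn : n = 0 := by nlinarith
    have hm : m = 0 := by linarith
    simp [hn, hm]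
  -- Expanding the fraction by `n + m` turns the numerator into `n² + nm` and the denominator into a
  -- square.
  · have hn : 0 ≤ n / (n + m) := by
      rw [← mul_div_mul_right _ _ h]
      exact div_nonneg (by nlinarith [sq_nonneg n]) (mul_self_nonneg _)
    have hm : 0 ≤ m / (n + m) := by
      rw [← mul_div_mul_right _ _ h]
      exact div_nonneg (by nlinarith [sq_nonneg m]) (mul_self_nonneg _)
    have hs : m / (n + m) + n / (n + m) = 1 := by field_simp; ring
    have e1 := hg.2 h0 h1 hm hn hs
    have e2 := hg.2 h0 h1 hn hm (by linarith)
    simp only [smul_eq_mul] at e1 e2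
    have i1 : m / (n + m) * x + n / (n + m) * (x + n + m) = x + n := by field_simp; ring
    have i2 : n / (n + m) * x + m / (n + m) * (x + n + m) = x + m := by field_simp; ring
    rw [i1] at e1
    rw [i2] at e2
    have : g x + g (x + n + m) = (m / (n + m) + n / (n + m)) * (g x + g (x + n + m)) := by
      rw [hs, one_mul]
    nlinarith

/-- Since `2α - 2 ≤ 0`, the second derivative `2α(2α-1)|x|^{2α-2}` is at least its value at `R`, and
half of that times `x²` is what is subtracted. The second derivative may blow up at `0`, so
convexity and monotonicity are proved on `[0, R]` and transported by composing with `|x|`. -/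
lemma convexOn_abs_rpow_sub_sq {α R : ℝ} (hα : 1 / 2 < α) (hα' : α ≤ 1) (hR : 0 < R) :
    ConvexOn ℝ (Set.Icc (-R) R)
      (fun x : ℝ => |x| ^ (2 * α) - α * (2 * α - 1) * R ^ (2 * α - 2) * x ^ 2) := by
  set c := α * (2 * α - 1) * R ^ (2 * α - 2) with hc
  have hc0 : 0 ≤ c := by have : 0 ≤ 2 * α - 1 := by linarith
                         positivity
  set G : ℝ → ℝ := fun y => y ^ (2 * α) - c * y ^ 2 with hG
  have hcont : Continuous G := by
    refine Continuous.sub ?_ (by fun_prop)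
    exact Real.continuous_rpow_const (by linarith)
  have hd : ∀ y ∈ Set.Ioo 0 R, HasDerivAt G (2 * α * y ^ (2 * α - 1) - 2 * c * y) y := by
    intro y hy
    have h1 := Real.hasDerivAt_rpow_const (x := y) (p := 2 * α) (Or.inl hy.1.ne')
    have h2 := ((hasDerivAt_pow 2 y).const_mul c)
    refine (h1.sub h2).congr_deriv ?_
    simp
    ring
  have hd2 : ∀ y ∈ Set.Ioo 0 R, HasDerivAt (fun y => 2 * α * y ^ (2 * α - 1) - 2 * c * y)
      (2 * α * ((2 * α - 1) * y ^ (2 * α - 2)) - 2 * c) y := by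
    intro y hy
    have h1 := (Real.hasDerivAt_rpow_const (x := y) (p := 2 * α - 1)
      (Or.inl hy.1.ne')).const_mul (2 * α)
    have h2 := ((hasDerivAt_id y).const_mul (2 * c))
    refine (h1.sub h2).congr_deriv ?_
    rw [mul_one, show 2 * α - 1 - 1 = 2 * α - 2 by ring]
  have hnn : ∀ y ∈ Set.Ioo 0 R, 0 ≤ 2 * α * ((2 * α - 1) * y ^ (2 * α - 2)) - 2 * c := by
    intro y hy
    have : R ^ (2 * α - 2) ≤ y ^ (2 * α - 2) :=
      Real.rpow_le_rpow_of_nonpos hy.1 hy.2.le (by linarith)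
    have h2 : 0 ≤ 2 * α * (2 * α - 1) := by nlinarith
    rw [hc]
    nlinarith
  have hmono' : MonotoneOn (fun y => 2 * α * y ^ (2 * α - 1) - 2 * c * y) (Set.Icc 0 R) := by
    refine monotoneOn_of_deriv_nonneg (convex_Icc 0 R) ?_ ?_ ?_
    · refine Continuous.continuousOn ?_
      refine Continuous.sub (continuous_const.mul ?_) (by fun_prop)
      exact Real.continuous_rpow_const (by linarith)
    · rw [interior_Icc]
      exact fun y hy => (hd2 y hy).differentiableAt.differentiableWithinAt
    · rw [interior_Icc]
      intro y hy
      rw [(hd2 y hy).deriv]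
      exact hnn y hy
  have hGc : ConvexOn ℝ (Set.Icc 0 R) G := by
    refine MonotoneOn.convexOn_of_deriv (convex_Icc 0 R) hcont.continuousOn ?_ ?_
    · rw [interior_Icc]
      exact fun y hy => (hd y hy).differentiableAt.differentiableWithinAt
    · rw [interior_Icc]
      intro x hx y hy hxy
      rw [(hd x hx).deriv, (hd y hy).deriv]
      exact hmono' (Set.Ioo_subset_Icc_self hx) (Set.Ioo_subset_Icc_self hy) hxy
  have hGm : MonotoneOn G (Set.Icc 0 R) := by
    refine monotoneOn_of_deriv_nonneg (convex_Icc 0 R) hcont.continuousOn ?_ ?_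
    · rw [interior_Icc]
      exact fun y hy => (hd y hy).differentiableAt.differentiableWithinAt
    · rw [interior_Icc]
      intro y hy
      rw [(hd y hy).deriv]
      have := hmono' (Set.left_mem_Icc.2 hR.le) (Set.Ioo_subset_Icc_self hy) hy.1.le
      simpa [Real.zero_rpow (by linarith : 2 * α - 1 ≠ 0)] using this
  have himg : (fun x : ℝ => |x|) '' Set.Icc (-R) R = Set.Icc 0 R := by
    ext y
    constructor
    · rintro ⟨x, hx, rfl⟩
      exact ⟨abs_nonneg _, abs_le.2 hx⟩
    · intro hy
      exact ⟨y, ⟨by linarith [hy.1], hy.2⟩, abs_of_nonneg hy.1⟩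
  have habs : ConvexOn ℝ (Set.Icc (-R) R) (fun x : ℝ => |x|) :=
    (convexOn_univ_norm (E := ℝ)).subset (Set.subset_univ _) (convex_Icc _ _)
  have := ConvexOn.comp (by rw [himg]; exact hGc) habs (by rw [himg]; exact hGm)
  refine this.congr ?_
  intro x _
  simp [G]

/-- The second difference of `x²` is `2nm`, so convexity after subtracting a multiple of `x²` leaves
exactly the product `|n||m|`. -/
lemma le_abs_second_difference {α R x n m : ℝ} (hα : 1 / 2 < α) (hα' : α ≤ 1) (hR : 0 < R)
    (h0 : |x| ≤ R) (h1 : |x + n| ≤ R) (h2 : |x + m| ≤ R) (h3 : |x + n + m| ≤ R) :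
    2 * α * (2 * α - 1) * R ^ (2 * α - 2) * (|n| * |m|) ≤
      |(|x| ^ (2 * α) - |x + n| ^ (2 * α) - |x + m| ^ (2 * α) + |x + n + m| ^ (2 * α))| := by
  have hg := convexOn_abs_rpow_sub_sq hα hα' hR
  set c := α * (2 * α - 1) * R ^ (2 * α - 2) with hc
  have e : 2 * α * (2 * α - 1) * R ^ (2 * α - 2) = 2 * c := by rw [hc]; ring
  rw [e, ← abs_mul]
  rcases le_total 0 (n * m) with h | h
  · have := ConvexOn.add_le_add_of_mul_nonneg hg (abs_le.1 h0) (abs_le.1 h3) h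
    rw [abs_of_nonneg h]
    refine le_trans ?_ (le_abs_self _)
    nlinarith
  -- For steps of opposite signs, basing the parallelogram at `x + n` with steps `-n` and `m`
  -- restores the sign and reverses that of the second difference.
  · have := ConvexOn.add_le_add_of_mul_nonneg hg (x := x + n) (n := -n) (m := m) (abs_le.1 h1)
      (by simpa using abs_le.1 h2) (by linarith)
    rw [abs_of_nonpos h]
    refine le_trans ?_ (neg_le_abs _)
    simp only [add_neg_cancel_right] at this
    nlinarith

/-- The second difference `|k|^{2α} - |k+n|^{2α} - |k+m|^{2α} + |k+n+m|^{2α}`. -/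
def resonance (α : ℝ) (k n m : ℤ) : ℝ :=
  disp α k - disp α (k + n) - disp α (k + m) + disp α (k + n + m)

lemma le_abs_resonance {α R : ℝ} {k n m : ℤ} (hα : 1 / 2 < α) (hα' : α ≤ 1) (hR : 0 < R)
    (h : |(k : ℝ)| + |(n : ℝ)| + |(m : ℝ)| ≤ R) :
    2 * α * (2 * α - 1) * R ^ (2 * α - 2) * (|(n : ℝ)| * |(m : ℝ)|) ≤ |resonance α k n m| := by
  have a1 := abs_add_le (k : ℝ) n
  have a2 := abs_add_le (k : ℝ) m
  have a3 := abs_add_le ((k : ℝ) + n) m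
  have b1 := abs_nonneg (n : ℝ)
  have b2 := abs_nonneg (m : ℝ)
  have := le_abs_second_difference (x := (k : ℝ)) (n := n) (m := m) hα hα' hR
    (by linarith) (by linarith) (by linarith) (by linarith)
  simpa [resonance, disp] using this

lemma one_le_abs_intCast {n : ℤ} (hn : n ≠ 0) : (1 : ℝ) ≤ |(n : ℝ)| := by
  exact_mod_cast Int.one_le_abs hn

/-- A bound that depends on `k` alone, used as a separation of phases: `R = 3⟨k⟩|n||m|` is
admissible for nonzero integers, and the factor `(|n||m|)^{2α-1} ≥ 1` that it leaves is dropped. -/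
lemma jb_rpow_le_abs_resonance {α : ℝ} {k n m : ℤ} (hα : 1 / 2 < α) (hα' : α ≤ 1)
    (hn : n ≠ 0) (hm : m ≠ 0) :
    (2 * α - 1) / 3 * jb k ^ (-(2 - 2 * α)) ≤ |resonance α k n m| := by
  have h1 := one_le_abs_intCast hn
  have h2 := one_le_abs_intCast hm
  have hk := abs_le_jb (k : ℝ)
  have hj := one_le_jb (k : ℝ)
  set N := |(n : ℝ)|
  set M := |(m : ℝ)|
  set K := jb (k : ℝ)
  have hNM : 1 ≤ N * M := by nlinarith
  have hR : |(k : ℝ)| + N + M ≤ 3 * K * (N * M) := by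
    have : N ≤ K * (N * M) := by
      calc N = 1 * (N * 1) := by ring
        _ ≤ K * (N * M) := by gcongr
    have : M ≤ K * (N * M) := by
      calc M = 1 * (1 * M) := by ring
        _ ≤ K * (N * M) := by gcongr
    have : K ≤ K * (N * M) := le_mul_of_one_le_right (by linarith) hNM
    linarith
  refine le_trans ?_ (le_abs_resonance hα hα' (by positivity) hR)
  have e : (3 * K * (N * M)) ^ (2 * α - 2) * (N * M)
      = 3 ^ (2 * α - 2) * K ^ (2 * α - 2) * (N * M) ^ (2 * α - 1) := by
    rw [Real.mul_rpow (by positivity) (by positivity), Real.mul_rpow (by positivity) (by positivity),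
      mul_assoc (3 ^ (2 * α - 2) * K ^ (2 * α - 2)), ← Real.rpow_add_one (by positivity)]
    ring_nf
  have e1 : (1 : ℝ) ≤ (N * M) ^ (2 * α - 1) := Real.one_le_rpow hNM (by linarith)
  have e2 : (1 / 3 : ℝ) ≤ 3 ^ (2 * α - 2) := by
    calc (1 / 3 : ℝ) = 3 ^ (-1 : ℝ) := by rw [Real.rpow_neg_one]; norm_num
      _ ≤ _ := Real.rpow_le_rpow_of_exponent_le (by norm_num) (by linarith)
  have e3 : -(2 - 2 * α) = 2 * α - 2 := by ring
  rw [e3, mul_assoc (2 * α * (2 * α - 1)), e]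
  have p : 0 < K ^ (2 * α - 2) := by positivity
  have q : 0 ≤ 2 * α - 1 := by linarith
  calc (2 * α - 1) / 3 * K ^ (2 * α - 2)
      = 1 * (2 * α - 1) * (1 / 3 * K ^ (2 * α - 2) * 1) := by ring
    _ ≤ 2 * α * (2 * α - 1) * (3 ^ (2 * α - 2) * K ^ (2 * α - 2) * (N * M) ^ (2 * α - 1)) := by
        gcongr
        linarith

/-! ### Sums over separated points -/

/-- The intervals of length `δ p` centred at `φ p` are disjoint, and `⟨· - μ⟩` varies on each by a
factor at most 2. The sum is therefore dominated by the integral, uniformly in `φ` and `μ`. -/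
lemma tsum_separated_le {J : Set ℤ} {φ δ : ℤ → ℝ} {ε : ℝ} (μ : ℝ) (hε : 0 ≤ ε) (hε' : ε ≤ 1)
    (hδ' : ∀ p, δ p ≤ 1)
    (h : ∀ p ∈ J, ∀ p' ∈ J, p ≠ p' → δ p ≤ |φ p - φ p'|) :
    ∑' p : J, ENNReal.ofReal (δ p * jb (φ p - μ) ^ (-(1 + ε))) ≤
      4 * ∫⁻ x : ℝ, ENNReal.ofReal (jb x ^ (-(1 + ε))) := by
  have hdisj : Pairwise (Function.onFun Disjoint
      (fun p : J => Metric.ball (φ p) (δ p / 2))) := by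
    intro p p' hpp'
    refine Metric.ball_disjoint_ball ?_
    have hne : (p : ℤ) ≠ p' := fun e => hpp' (Subtype.ext e)
    have h1 := h p p.2 p' p'.2 hne
    have h2 := h p' p'.2 p p.2 hne.symm
    rw [abs_sub_comm] at h2
    rw [Real.dist_eq]
    linarith
  have hpt : ∀ p : J, ENNReal.ofReal (δ p * jb (φ p - μ) ^ (-(1 + ε))) ≤
      ∫⁻ x in Metric.ball (φ p) (δ p / 2), 4 * ENNReal.ofReal (jb (x - μ) ^ (-(1 + ε))) := by
    intro p
    have hvol : volume (Metric.ball (φ p) (δ p / 2)) = ENNReal.ofReal (δ p) := by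
      rw [Real.volume_ball]; ring_nf
    calc ENNReal.ofReal (δ p * jb (φ p - μ) ^ (-(1 + ε)))
        = ∫⁻ x in Metric.ball (φ p) (δ p / 2), ENNReal.ofReal (jb (φ p - μ) ^ (-(1 + ε))) := by
          rw [setLIntegral_const, hvol, mul_comm, ENNReal.ofReal_mul (jb_rpow_pos _ _).le]
      _ ≤ _ := by
          refine setLIntegral_mono (by fun_prop) ?_
          intro x hx
          have hx' : |x - φ p| < δ p / 2 := by simpa [Real.dist_eq] using hx
          have e : jb (x - μ) ≤ 2 * jb (φ p - μ) := by
            have := jb_le_add_abs (φ p - μ) (x - φ p)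
            rw [show φ p - μ + (x - φ p) = x - μ by ring] at this
            linarith [hδ' p, one_le_jb (φ p - μ)]
          have := rpow_neg_le_of_le_mul (jb_pos (x - μ)) (jb_pos (φ p - μ)) two_pos
            (by linarith : 0 ≤ 1 + ε) e
          have h4 : (2 : ℝ) ^ (1 + ε) ≤ 4 := by
            calc (2 : ℝ) ^ (1 + ε) ≤ 2 ^ (2 : ℝ) :=
                  Real.rpow_le_rpow_of_exponent_le (by norm_num) (by linarith)
              _ = 4 := by norm_num
          have h5 : jb (φ p - μ) ^ (-(1 + ε)) ≤ 4 * jb (x - μ) ^ (-(1 + ε)) :=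
            this.trans (mul_le_mul_of_nonneg_right h4 (jb_rpow_pos _ _).le)
          calc _ ≤ ENNReal.ofReal (4 * jb (x - μ) ^ (-(1 + ε))) := ENNReal.ofReal_le_ofReal h5
            _ = _ := by rw [ENNReal.ofReal_mul (by norm_num)]; norm_num
  calc _ ≤ ∑' p : J, ∫⁻ x in Metric.ball (φ p) (δ p / 2),
          4 * ENNReal.ofReal (jb (x - μ) ^ (-(1 + ε))) := ENNReal.tsum_le_tsum hpt
    _ = ∫⁻ x in ⋃ p : J, Metric.ball (φ p) (δ p / 2),
          4 * ENNReal.ofReal (jb (x - μ) ^ (-(1 + ε))) :=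
        (lintegral_iUnion (fun p => Metric.isOpen_ball.measurableSet) hdisj _).symm
    _ ≤ ∫⁻ x, 4 * ENNReal.ofReal (jb (x - μ) ^ (-(1 + ε))) := setLIntegral_le_lintegral _ _
    _ = 4 * ∫⁻ x, ENNReal.ofReal (jb (x - μ) ^ (-(1 + ε))) := by
        rw [lintegral_const_mul _ (by fun_prop)]
    _ = _ := by
        rw [lintegral_sub_right_eq_self (fun x => ENNReal.ofReal (jb x ^ (-(1 + ε)))) μ]

/-- The constant in `tsum_phase_le`. -/
def phaseConst (α ε : ℝ) : ℝ≥0∞ :=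
  jbSum 2 + ENNReal.ofReal (((2 * α - 1) / 3)⁻¹) *
    (4 * ∫⁻ x : ℝ, ENNReal.ofReal (jb x ^ (-(1 + ε))))

lemma phaseConst_lt_top {α ε : ℝ} (hε : 0 < ε) : phaseConst α ε < ∞ := by
  have h1 : jbSum 2 < ∞ := jbSum_lt_top (by norm_num)
  have h2 := lintegral_jb_lt_top (r := 1 + ε) (by linarith)
  unfold phaseConst
  exact ENNReal.add_lt_top.2 ⟨h1, ENNReal.mul_lt_top ENNReal.ofReal_lt_top
    (ENNReal.mul_lt_top (by norm_num) h2)⟩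

/-- The extra decay `η` converts the non-integrable exponent `1 - ε` into `1 + ε` at the price of a
summable term `⟨p⟩^{-2}`. What remains is a separated sum with gaps proportional to `⟨p⟩^{-(2-2α)}`.
-/
lemma tsum_phase_le {α ε η : ℝ} {J : Set ℤ} {φ : ℤ → ℝ} (μ : ℝ) (hα : 1 / 2 < α) (hα' : α ≤ 1)
    (hε : 0 < ε) (hε' : ε ≤ 1 / 2) (hεη : 8 * ε ≤ η)
    (h : ∀ p ∈ J, ∀ p' ∈ J, p ≠ p' →
      (2 * α - 1) / 3 * jb p ^ (-(2 - 2 * α)) ≤ |φ p - φ p'|) :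
    ∑' p : J, ENNReal.ofReal (jb (p : ℤ) ^ (-(2 - 2 * α + η)) * jb (φ p - μ) ^ (-(1 - ε))) ≤
      phaseConst α ε := by
  set c := (2 * α - 1) / 3
  have hc : 0 < c := by simp only [c]; linarith
  have hc1 : c ≤ 1 := by simp only [c]; linarith
  have hsep := tsum_separated_le (J := J) (φ := φ)
    (δ := fun p => c * jb (p : ℝ) ^ (-(2 - 2 * α))) (ε := ε) μ hε.le (by linarith)
    (fun p => by
      have : jb (p : ℝ) ^ (-(2 - 2 * α)) ≤ 1 :=
        Real.rpow_le_one_of_one_le_of_nonpos (one_le_jb _) (by linarith)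
      have h0 := jb_rpow_pos (p : ℝ) (-(2 - 2 * α))
      nlinarith) h
  have hpt : ∀ p : J,
      ENNReal.ofReal (jb (p : ℤ) ^ (-(2 - 2 * α + η)) * jb (φ p - μ) ^ (-(1 - ε))) ≤
      ENNReal.ofReal (jb (p : ℤ) ^ (-2 : ℝ)) + ENNReal.ofReal c⁻¹ * ENNReal.ofReal
        (c * jb (p : ℤ) ^ (-(2 - 2 * α)) * jb (φ p - μ) ^ (-(1 + ε))) := by
    intro p
    have := rpow_neg_mul_rpow_neg_le_add (one_le_jb ((p : ℤ) : ℝ)) (one_le_jb (φ p - μ))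
      (by linarith : 0 ≤ 2 - 2 * α) hε hε' hεη
    rw [← ENNReal.ofReal_mul (by positivity), ← ENNReal.ofReal_add (jb_rpow_pos _ _).le
      (by have := jb_rpow_pos (p : ℤ) (-(2 - 2 * α))
          have := jb_rpow_pos (φ p - μ) (-(1 + ε))
          positivity)]
    refine ENNReal.ofReal_le_ofReal (this.trans_eq ?_)
    field_simp
  calc _ ≤ ∑' p : J, (ENNReal.ofReal (jb (p : ℤ) ^ (-2 : ℝ)) + ENNReal.ofReal c⁻¹ *
        ENNReal.ofReal (c * jb (p : ℤ) ^ (-(2 - 2 * α)) * jb (φ p - μ) ^ (-(1 + ε)))) :=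
        ENNReal.tsum_le_tsum hpt
    _ = ∑' p : J, ENNReal.ofReal (jb (p : ℤ) ^ (-2 : ℝ)) + ENNReal.ofReal c⁻¹ *
        ∑' p : J, ENNReal.ofReal
          (c * jb (p : ℤ) ^ (-(2 - 2 * α)) * jb (φ p - μ) ^ (-(1 + ε))) := by
        rw [ENNReal.tsum_add, ENNReal.tsum_mul_left]
    _ ≤ phaseConst α ε := by
        unfold phaseConst
        gcongr
        exact ENNReal.tsum_comp_le_tsum_of_injective Subtype.val_injective
          (fun p : ℤ => ENNReal.ofReal (jb (p : ℝ) ^ (-2 : ℝ)))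

/-- The values of the phase at `p` and `p'` differ by a second difference with the nonzero steps `p'
- p` and `d`. -/
lemma tsum_difference_phase_le {α ε η : ℝ} (μ ν : ℝ) (d : ℤ) (hd : d ≠ 0) (hα : 1 / 2 < α)
    (hα' : α ≤ 1) (hε : 0 < ε) (hε' : ε ≤ 1 / 2) (hεη : 8 * ε ≤ η) {σ : ℝ} (hσ : |σ| = 1) :
    ∑' p : ℤ, ENNReal.ofReal (jb p ^ (-(2 - 2 * α + η)) *
      jb (ν + σ * (disp α p - disp α (p + d)) - μ) ^ (-(1 - ε))) ≤ phaseConst α ε := by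
  have := tsum_phase_le (J := Set.univ) (φ := fun p => ν + σ * (disp α p - disp α (p + d))) μ
    hα hα' hε hε' hεη ?_
  · rwa [tsum_univ (fun p : ℤ => ENNReal.ofReal (jb p ^ (-(2 - 2 * α + η)) *
      jb (ν + σ * (disp α p - disp α (p + d)) - μ) ^ (-(1 - ε))))] at this
  · intro p _ p' _ hpp'
    have h := jb_rpow_le_abs_resonance (k := p) (n := p' - p) (m := d) hα hα'
      (sub_ne_zero.2 hpp'.symm) hd
    have e : ν + σ * (disp α p - disp α (p + d)) - (ν + σ * (disp α p' - disp α (p' + d)))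
        = σ * resonance α p (p' - p) d := by
      simp only [resonance]
      rw [show p + (p' - p) = p' by ring]
      ring
    rw [e, abs_mul, hσ, one_mul]
    exact h

/-- Here the steps are `p' - p` and `e - p - p'`. The second vanishes when `p' = e - p`, reflecting
the symmetry of the phase, so the integers are cut in two halves on each of which this cannot occur
for distinct points; hence the factor 2. -/
lemma tsum_sum_phase_le {α ε η : ℝ} (μ ν : ℝ) (e : ℤ) (hα : 1 / 2 < α)
    (hα' : α ≤ 1) (hε : 0 < ε) (hε' : ε ≤ 1 / 2) (hεη : 8 * ε ≤ η) :
    ∑' p : ℤ, ENNReal.ofReal (jb p ^ (-(2 - 2 * α + η)) *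
      jb (disp α p + disp α (e - p) + ν - μ) ^ (-(1 - ε))) ≤ 2 * phaseConst α ε := by
  have key : ∀ J : Set ℤ, (∀ p ∈ J, ∀ p' ∈ J, p ≠ p' → p + p' ≠ e) →
      ∑' p : J, ENNReal.ofReal (jb (p : ℤ) ^ (-(2 - 2 * α + η)) *
        jb (disp α p + disp α (e - p) + ν - μ) ^ (-(1 - ε))) ≤ phaseConst α ε := by
    intro J hJ
    refine tsum_phase_le (J := J) (φ := fun p => disp α p + disp α (e - p) + ν) μ
      hα hα' hε hε' hεη ?_
    intro p hp p' hp' hpp'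
    have h := jb_rpow_le_abs_resonance (k := p) (n := p' - p) (m := e - p - p') hα hα'
      (sub_ne_zero.2 hpp'.symm) (fun h0 => hJ p hp p' hp' hpp' (by linarith))
    have e : disp α p + disp α (e - p) + ν - (disp α p' + disp α (e - p') + ν)
        = resonance α p (p' - p) (e - p - p') := by
      simp only [resonance]
      rw [show p + (p' - p) = p' by ring, show p + (e - p - p') = e - p' by ring,
        show p' + (e - p - p') = e - p by ring]
      ring
    rw [e]
    exact h
  have h1 := key {p | 2 * p ≤ e} (by
    intro p hp p' hp' h1 h2
    simp only [Set.mem_ofPred_eq] at hp hp'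
    omega)
  have h2 := key {p | 2 * p ≤ e}ᶜ (by
    intro p hp p' hp' h1 h2
    simp only [Set.mem_compl_iff, Set.mem_ofPred_eq] at hp hp'
    omega)
  rw [two_mul (phaseConst α ε)]
  refine le_trans (le_of_eq ?_) (add_le_add h1 h2)
  exact (ENNReal.summable.tsum_add_tsum_compl (s := {p : ℤ | 2 * p ≤ e}) ENNReal.summable).symm

/-! ### The inner trilinear sum -/

/-- Powers of the larger variable are traded so that the smaller one gets the summable exponent `1 +
η`. The larger keeps `θ + η`, which with `θ = 2 - 2α` is what `tsum_phase_le` requires. -/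
lemma rpow_pair_le {X Y s θ η : ℝ} (hX : 1 ≤ X) (hXY : X ≤ Y) (hs : s ≤ 1 / 2) (hη : 0 ≤ η)
    (h : 4 * s = 1 + θ + 2 * η) :
    X ^ (-(2 * s)) * Y ^ (-(2 * s)) ≤ X ^ (-(1 + η)) * Y ^ (-(θ + η)) := by
  have hX0 : 0 < X := by linarith
  have hY0 : 0 < Y := by linarith
  calc X ^ (-(2 * s)) * Y ^ (-(2 * s))
      = X ^ (-(1 + η)) * X ^ (1 + η - 2 * s) * Y ^ (-(2 * s)) := by
        rw [← Real.rpow_add hX0]; ring_nf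
    _ ≤ X ^ (-(1 + η)) * Y ^ (1 + η - 2 * s) * Y ^ (-(2 * s)) := by
        gcongr
        linarith
    _ = X ^ (-(1 + η)) * Y ^ (-(θ + η)) := by
        rw [mul_assoc, ← Real.rpow_add hY0]
        congr 2
        linarith

/-- The largest of the three is at least `Q/3` and supplies the decay in `Q`; the other two are
handled by `rpow_pair_le`. -/
lemma rpow_triple_le {X Y Z Q s θ η : ℝ} (hX : 1 ≤ X) (hY : 1 ≤ Y) (hQ : 0 < Q)
    (hXZ : X ≤ Z) (hYZ : Y ≤ Z) (hQ' : Q ≤ X + Y + Z) (hs : s ≤ 1 / 2) (hs0 : 0 ≤ s)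
    (hη : 0 ≤ η) (h : 4 * s = 1 + θ + 2 * η) :
    X ^ (-(2 * s)) * Y ^ (-(2 * s)) * Z ^ (-(2 * s)) ≤ 3 * Q ^ (-(2 * s)) *
      (X ^ (-(1 + η)) * Y ^ (-(θ + η)) + Y ^ (-(1 + η)) * X ^ (-(θ + η))) := by
  have h0 : X ^ (-(2 * s)) * Y ^ (-(2 * s)) ≤
      X ^ (-(1 + η)) * Y ^ (-(θ + η)) + Y ^ (-(1 + η)) * X ^ (-(θ + η)) := by
    rcases le_total X Y with hh | hh
    · have := rpow_pair_le hX hh hs hη h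
      have : 0 < Y ^ (-(1 + η)) * X ^ (-(θ + η)) := by positivity
      linarith
    · have := rpow_pair_le hY hh hs hη h
      have : 0 < X ^ (-(1 + η)) * Y ^ (-(θ + η)) := by positivity
      linarith
  have h1 : Z ^ (-(2 * s)) ≤ 3 * Q ^ (-(2 * s)) := by
    have := rpow_neg_le_of_le_mul hQ (by linarith : 0 < Z) (by norm_num : (0 : ℝ) < 3)
      (by linarith : 0 ≤ 2 * s) (by linarith)
    refine this.trans ?_
    gcongr
    calc (3 : ℝ) ^ (2 * s) ≤ 3 ^ (1 : ℝ) :=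
          Real.rpow_le_rpow_of_exponent_le (by norm_num) (by linarith)
      _ = 3 := by norm_num
  have hp : 0 ≤ X ^ (-(1 + η)) * Y ^ (-(θ + η)) + Y ^ (-(1 + η)) * X ^ (-(θ + η)) := by positivity
  calc _ ≤ (X ^ (-(1 + η)) * Y ^ (-(θ + η)) + Y ^ (-(1 + η)) * X ^ (-(θ + η))) *
        (3 * Q ^ (-(2 * s))) :=
        mul_le_mul h0 h1 (Real.rpow_nonneg (by linarith) _) hp
    _ = _ := by ring

lemma rpow_triple_le' {X Y Z Q s θ η : ℝ} (hX : 1 ≤ X) (hY : 1 ≤ Y) (hZ : 1 ≤ Z) (hQ : 0 < Q)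
    (hQ' : Q ≤ X + Y + Z) (hs : s ≤ 1 / 2) (hs0 : 0 ≤ s) (hη : 0 ≤ η)
    (h : 4 * s = 1 + θ + 2 * η) :
    X ^ (-(2 * s)) * Y ^ (-(2 * s)) * Z ^ (-(2 * s)) ≤ 3 * Q ^ (-(2 * s)) *
      ((X ^ (-(1 + η)) * Z ^ (-(θ + η)) + X ^ (-(1 + η)) * Y ^ (-(θ + η)) +
        Y ^ (-(1 + η)) * X ^ (-(θ + η))) +
      (Z ^ (-(1 + η)) * X ^ (-(θ + η)) + Z ^ (-(1 + η)) * Y ^ (-(θ + η)) +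
        Y ^ (-(1 + η)) * Z ^ (-(θ + η)))) := by
  have hX0 : 0 < X := by linarith
  have hY0 : 0 < Y := by linarith
  have hZ0 : 0 < Z := by linarith
  have mono : ∀ {A B : ℝ}, A ≤ B → 3 * Q ^ (-(2 * s)) * A ≤ 3 * Q ^ (-(2 * s)) * B := by
    intro A B hAB
    gcongr
  have p1 : 0 < X ^ (-(1 + η)) := by positivity
  have p2 : 0 < Y ^ (-(1 + η)) := by positivity
  have p3 : 0 < Z ^ (-(1 + η)) := by positivity
  have q1 : 0 < X ^ (-(θ + η)) := by positivity
  have q2 : 0 < Y ^ (-(θ + η)) := by positivity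
  have q3 : 0 < Z ^ (-(θ + η)) := by positivity
  have r1 := mul_pos p1 q2
  have r2 := mul_pos p1 q3
  have r3 := mul_pos p2 q1
  have r4 := mul_pos p2 q3
  have r5 := mul_pos p3 q1
  have r6 := mul_pos p3 q2
  by_cases h1 : X ≤ Z ∧ Y ≤ Z
  · refine (rpow_triple_le hX hY hQ h1.1 h1.2 hQ' hs hs0 hη h).trans (mono ?_)
    linarith
  by_cases h2 : X ≤ Y ∧ Z ≤ Y
  · have := rpow_triple_le hX hZ hQ h2.1 h2.2 (by linarith) hs hs0 hη h
    rw [mul_right_comm]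
    refine this.trans (mono ?_)
    linarith
  · have hYX : Y ≤ X := by
      by_contra hc
      push Not at hc h1 h2
      have h3 := h2 hc.le
      exact absurd (h1 (hc.trans h3).le) (by linarith)
    have hZX : Z ≤ X := by
      by_contra hc
      push Not at hc h1
      exact absurd (h1 hc.le) (by linarith)
    have := rpow_triple_le hY hZ hQ hYX hZX (by linarith) hs hs0 hη h
    rw [mul_assoc, mul_comm (X ^ _)]
    refine this.trans (mono ?_)
    linarith

/-- The summand of the inner trilinear sum at the frequencies `x - (x + z - q) + z = q`. -/
def innerTerm (α s γ μ : ℝ) (q x z : ℤ) : ℝ :=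
  jb x ^ (-(2 * s)) * jb ((x + z - q : ℤ) : ℝ) ^ (-(2 * s)) * jb z ^ (-(2 * s)) *
    jb (disp α x + disp α z - disp α (x + z - q) - μ) ^ (-γ)

/-- Half of the majorant of `innerTerm`; the other half exchanges `x` and `z`. -/
def innerMajorant (α s η ε μ : ℝ) (q x z : ℤ) : ℝ≥0∞ :=
  (if x = q then ENNReal.ofReal (jb z ^ (-(4 * s))) else
    ENNReal.ofReal (jb x ^ (-(1 + η))) * ENNReal.ofReal (jb z ^ (-(2 - 2 * α + η)) *
      jb (disp α x + disp α z - disp α (x + z - q) - μ) ^ (-(1 - ε))) +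
    ENNReal.ofReal (jb x ^ (-(1 + η))) * ENNReal.ofReal (jb ((x + z - q : ℤ) : ℝ)
      ^ (-(2 - 2 * α + η)) *
      jb (disp α x + disp α z - disp α (x + z - q) - μ) ^ (-(1 - ε)))) +
  ENNReal.ofReal (jb ((x + z - q : ℤ) : ℝ) ^ (-(1 + η))) *
    ENNReal.ofReal (jb x ^ (-(2 - 2 * α + η)) *
      jb (disp α x + disp α z - disp α (x + z - q) - μ) ^ (-(1 - ε)))

/-- If `x = q` or `z = q`, the phase does not depend on the free frequency and gives no gain. Then
two of the three frequencies coincide and produce the exponent `4s > 1`, while the third equals `q`.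
In all other cases `rpow_triple_le'` applies. -/
lemma innerTerm_le {α s η ε μ : ℝ} {q x z : ℤ} (hs : s ≤ 1 / 2) (hs0 : 0 ≤ s)
    (hη : 0 ≤ η) (hε : ε ≤ 1) (h : 4 * s = 1 + (2 - 2 * α) + 2 * η) :
    ENNReal.ofReal (innerTerm α s (1 - ε) μ q x z) ≤
      ENNReal.ofReal (3 * jb q ^ (-(2 * s))) *
        (innerMajorant α s η ε μ q x z + innerMajorant α s η ε μ q z x) := by
  have hq := jb_rpow_pos (q : ℝ) (-(2 * s))
  have hdeg : ∀ x z : ℤ, x = q → ENNReal.ofReal (innerTerm α s (1 - ε) μ q x z) ≤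
      ENNReal.ofReal (3 * jb q ^ (-(2 * s))) * innerMajorant α s η ε μ q x z := by
    rintro x z rfl
    have h1 : innerMajorant α s η ε μ x x z ≥ ENNReal.ofReal (jb z ^ (-(4 * s))) := by
      simp only [innerMajorant, if_true]
      exact le_self_add
    refine le_trans ?_ (mul_le_mul_right h1 _)
    rw [← ENNReal.ofReal_mul (by positivity)]
    refine ENNReal.ofReal_le_ofReal ?_
    simp only [innerTerm, add_sub_cancel_left]
    have h2 : jb (disp α x + disp α z - disp α z - μ) ^ (-(1 - ε)) ≤ 1 :=
      Real.rpow_le_one_of_one_le_of_nonpos (one_le_jb _) (by linarith)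
    have h3 : jb (z : ℝ) ^ (-(2 * s)) * jb (z : ℝ) ^ (-(2 * s)) = jb (z : ℝ) ^ (-(4 * s)) := by
      rw [← Real.rpow_add (jb_pos _)]; ring_nf
    have h4 := jb_rpow_pos (z : ℝ) (-(4 * s))
    rw [mul_assoc (jb (x : ℝ) ^ (-(2 * s))), h3]
    calc _ ≤ jb (x : ℝ) ^ (-(2 * s)) * jb (z : ℝ) ^ (-(4 * s)) * 1 := by gcongr
      _ ≤ _ := by nlinarith [mul_pos hq h4]
  have hsymm : innerTerm α s (1 - ε) μ q x z = innerTerm α s (1 - ε) μ q z x := by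
    simp only [innerTerm]
    rw [add_comm z x, add_comm (disp α z)]
    ring
  by_cases hx : x = q
  · refine (hdeg x z hx).trans ?_
    gcongr
    exact le_self_add
  by_cases hz : z = q
  · rw [hsymm]
    refine (hdeg z x hz).trans ?_
    gcongr
    exact le_add_self
  simp only [innerMajorant, if_neg hx, if_neg hz]
  rw [add_comm z x, add_comm (disp α z)]
  have hQ : jb (q : ℝ) ≤ jb x + jb ((x + z - q : ℤ) : ℝ) + jb z := by
    have e : (q : ℝ) = x + -((x + z - q : ℤ) : ℝ) + z := by push_cast; ring
    calc jb (q : ℝ) = jb (x + -((x + z - q : ℤ) : ℝ) + z) := by rw [← e]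
      _ ≤ _ := (jb_add_le _ _).trans (by
          have := jb_add_le (x : ℝ) (-((x + z - q : ℤ) : ℝ))
          rw [jb_neg] at this
          linarith)
  have key := rpow_triple_le' (one_le_jb (x : ℝ)) (one_le_jb ((x + z - q : ℤ) : ℝ))
    (one_le_jb (z : ℝ)) (jb_pos q) hQ hs hs0 hη h
  set X := jb (x : ℝ)
  set Y := jb ((x + z - q : ℤ) : ℝ)
  set Z := jb (z : ℝ)
  set W := jb (disp α x + disp α z - disp α (x + z - q) - μ) ^ (-(1 - ε)) with hW
  have hW0 : 0 < W := jb_rpow_pos _ _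
  have hX0 : 0 < X := jb_pos _
  have hY0 : 0 < Y := jb_pos _
  have hZ0 : 0 < Z := jb_pos _
  simp only [← ENNReal.ofReal_mul, Real.rpow_nonneg, hX0.le, hY0.le, hZ0.le]
  repeat rw [← ENNReal.ofReal_add (by positivity) (by positivity)]
  rw [← ENNReal.ofReal_mul (by positivity)]
  refine ENNReal.ofReal_le_ofReal ?_
  have : innerTerm α s (1 - ε) μ q x z = X ^ (-(2 * s)) * Y ^ (-(2 * s)) * Z ^ (-(2 * s)) * W := rfl
  rw [this]
  refine (mul_le_mul_of_nonneg_right key hW0.le).trans_eq ?_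
  ring

/-- In each term the frequency carrying the exponent `1 + η` is frozen and the sum over the other is
a phase sum. Freezing `x` leaves a phase of difference type; freezing the middle frequency `y = x +
z - q` leaves one of sum type in `x` and `z`. -/
lemma tsum_innerMajorant_le {α s η ε : ℝ} (μ : ℝ) (q : ℤ) (hα : 1 / 2 < α) (hα' : α ≤ 1)
    (hε : 0 < ε) (hε' : ε ≤ 1 / 2) (hεη : 8 * ε ≤ η) :
    ∑' x : ℤ, ∑' z : ℤ, innerMajorant α s η ε μ q x z ≤
      jbSum (4 * s) + jbSum (1 + η) * (4 * phaseConst α ε) := by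
  set P := phaseConst α ε
  have h1 : ∀ x : ℤ, ∑' z : ℤ, (if x = q then ENNReal.ofReal (jb z ^ (-(4 * s))) else
    ENNReal.ofReal (jb x ^ (-(1 + η))) * ENNReal.ofReal (jb z ^ (-(2 - 2 * α + η)) *
      jb (disp α x + disp α z - disp α (x + z - q) - μ) ^ (-(1 - ε))) +
    ENNReal.ofReal (jb x ^ (-(1 + η))) * ENNReal.ofReal (jb ((x + z - q : ℤ) : ℝ)
      ^ (-(2 - 2 * α + η)) *
      jb (disp α x + disp α z - disp α (x + z - q) - μ) ^ (-(1 - ε)))) ≤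
      (if x = q then jbSum (4 * s) else 0) + ENNReal.ofReal (jb x ^ (-(1 + η))) * (2 * P) := by
    intro x
    by_cases hx : x = q
    · simp only [if_pos hx]
      exact le_self_add
    · simp only [if_neg hx, zero_add]
      rw [ENNReal.tsum_add, ENNReal.tsum_mul_left, ENNReal.tsum_mul_left, ← mul_add, two_mul P]
      gcongr
      · refine le_trans (le_of_eq ?_) (tsum_difference_phase_le μ (disp α x) (x - q)
          (sub_ne_zero.2 hx) hα hα' hε hε' hεη (σ := 1) (by simp))
        refine tsum_congr fun z => ?_
        rw [show z + (x - q) = x + z - q by ring]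
        ring_nf
      -- The weight now sits on the middle frequency, so the sum is reindexed by it; the difference
      -- of dispersions then appears with the opposite sign.
      · refine le_trans (le_of_eq ?_) (tsum_difference_phase_le μ (disp α x) (q - x)
          (sub_ne_zero.2 (Ne.symm hx)) hα hα' hε hε' hεη (σ := -1) (by simp))
        rw [← (Equiv.addRight (x - q)).tsum_eq (fun y : ℤ => ENNReal.ofReal
          (jb y ^ (-(2 - 2 * α + η)) *
            jb (disp α x + -1 * (disp α y - disp α (y + (q - x))) - μ) ^ (-(1 - ε))))]
        refine tsum_congr fun z => ?_
        simp only [Equiv.coe_addRight]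
        rw [show z + (x - q) + (q - x) = z by ring, show z + (x - q) = x + z - q by ring]
        ring_nf
  have h2 : ∑' x : ℤ, ∑' z : ℤ, ENNReal.ofReal (jb ((x + z - q : ℤ) : ℝ) ^ (-(1 + η))) *
      ENNReal.ofReal (jb x ^ (-(2 - 2 * α + η)) *
      jb (disp α x + disp α z - disp α (x + z - q) - μ) ^ (-(1 - ε))) ≤
      jbSum (1 + η) * (2 * P) := by
    have e : ∀ x : ℤ, ∑' z : ℤ, ENNReal.ofReal (jb ((x + z - q : ℤ) : ℝ) ^ (-(1 + η))) *
      ENNReal.ofReal (jb x ^ (-(2 - 2 * α + η)) *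
      jb (disp α x + disp α z - disp α (x + z - q) - μ) ^ (-(1 - ε))) =
      ∑' y : ℤ, ENNReal.ofReal (jb (y : ℝ) ^ (-(1 + η))) *
      ENNReal.ofReal (jb x ^ (-(2 - 2 * α + η)) *
      jb (disp α x + disp α (y + q - x) + -disp α y - μ) ^ (-(1 - ε))) := by
      intro x
      rw [← (Equiv.addRight (x - q)).tsum_eq (fun y : ℤ =>
        ENNReal.ofReal (jb (y : ℝ) ^ (-(1 + η))) *
        ENNReal.ofReal (jb x ^ (-(2 - 2 * α + η)) *
        jb (disp α x + disp α (y + q - x) + -disp α y - μ) ^ (-(1 - ε))))]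
      refine tsum_congr fun z => ?_
      simp only [Equiv.coe_addRight]
      rw [show z + (x - q) + q - x = z by ring, show z + (x - q) = x + z - q by ring,
        ← sub_eq_add_neg]
    simp_rw [e]
    rw [ENNReal.tsum_comm]
    simp_rw [ENNReal.tsum_mul_left]
    unfold jbSum
    rw [← ENNReal.tsum_mul_right]
    refine ENNReal.tsum_le_tsum fun y => ?_
    gcongr
    exact tsum_sum_phase_le μ (-disp α y) (y + q) hα hα' hε hε' hεη
  unfold innerMajorant
  simp_rw [ENNReal.tsum_add]
  calc _ ≤ ∑' x : ℤ, ((if x = q then jbSum (4 * s) else 0) +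
        ENNReal.ofReal (jb x ^ (-(1 + η))) * (2 * P)) + jbSum (1 + η) * (2 * P) :=
        add_le_add (ENNReal.tsum_le_tsum h1) h2
    _ = _ := by
        rw [ENNReal.tsum_add, tsum_ite_eq, ENNReal.tsum_mul_right]
        change jbSum (4 * s) + jbSum (1 + η) * (2 * P) + _ = _
        rw [add_assoc, ← mul_add, ← add_mul]
        norm_num

/-- The trilinear sum is controlled by the weight at the output frequency. -/
lemma exists_tsum_innerTerm_le {α s η ε : ℝ} (hα : 1 / 2 < α) (hα' : α ≤ 1) (hs : s ≤ 1 / 2)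
    (h : 4 * s = 1 + (2 - 2 * α) + 2 * η)
    (hε : 0 < ε) (hε' : ε ≤ 1 / 2) (hεη : 8 * ε ≤ η) :
    ∃ C : ℝ≥0, ∀ (μ : ℝ) (q : ℤ),
      ∑' x : ℤ, ∑' z : ℤ, ENNReal.ofReal (innerTerm α s (1 - ε) μ q x z) ≤
        C * ENNReal.ofReal (jb q ^ (-(2 * s))) := by
  have hη : 0 < η := by linarith
  have hs0 : 0 ≤ s := by linarith
  set D := jbSum (4 * s) + jbSum (1 + η) * (4 * phaseConst α ε) with hD
  have hDt : D < ∞ := ENNReal.add_lt_top.2 ⟨jbSum_lt_top (by linarith),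
    ENNReal.mul_lt_top (jbSum_lt_top (by linarith))
      (ENNReal.mul_lt_top (by norm_num) (phaseConst_lt_top hε))⟩
  refine ⟨(3 * (D + D)).toNNReal, fun μ q => ?_⟩
  rw [ENNReal.coe_toNNReal
    (ENNReal.mul_lt_top (by norm_num) (ENNReal.add_lt_top.2 ⟨hDt, hDt⟩)).ne]
  calc _ ≤ ∑' x : ℤ, ∑' z : ℤ, ENNReal.ofReal (3 * jb q ^ (-(2 * s))) *
        (innerMajorant α s η ε μ q x z + innerMajorant α s η ε μ q z x) :=
        ENNReal.tsum_le_tsum fun x => ENNReal.tsum_le_tsum fun z =>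
          innerTerm_le hs hs0 hη.le (by linarith) h
    _ = ENNReal.ofReal (3 * jb q ^ (-(2 * s))) *
        (∑' x : ℤ, ∑' z : ℤ, innerMajorant α s η ε μ q x z +
          ∑' x : ℤ, ∑' z : ℤ, innerMajorant α s η ε μ q z x) := by
        simp_rw [ENNReal.tsum_mul_left, ENNReal.tsum_add]
    _ ≤ ENNReal.ofReal (3 * jb q ^ (-(2 * s))) * (D + D) := by
        gcongr
        · exact tsum_innerMajorant_le μ q hα hα' hε hε' hεη
        · rw [ENNReal.tsum_comm]
          exact tsum_innerMajorant_le μ q hα hα' hε hε' hεη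
    _ = _ := by
        rw [ENNReal.ofReal_mul (by norm_num), ENNReal.ofReal_ofNat]
        ring

/-! ### The outer sum -/

lemma abs_rpow_neg_le_jb {n : ℤ} {r : ℝ} (hn : n ≠ 0) (hr : 0 ≤ r) :
    |(n : ℝ)| ^ (-r) ≤ 2 ^ r * jb n ^ (-r) := by
  have h1 := one_le_abs_intCast hn
  refine rpow_neg_le_of_le_mul (jb_pos _) (by linarith) two_pos hr ?_
  linarith [jb_le_one_add_abs (n : ℝ)]

lemma abs_resonance_inv_le {α R : ℝ} {k n m : ℤ} (hα : 1 / 2 < α) (hα' : α ≤ 1) (hR : 0 < R)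
    (hn : n ≠ 0) (hm : m ≠ 0) (h : |(k : ℝ)| + |(n : ℝ)| + |(m : ℝ)| ≤ R) :
    |resonance α k n m|⁻¹ ≤
      (2 * α * (2 * α - 1))⁻¹ * R ^ (2 - 2 * α) * (|(n : ℝ)| * |(m : ℝ)|)⁻¹ := by
  have h1 := one_le_abs_intCast hn
  have h2 := one_le_abs_intCast hm
  have hc : 0 < 2 * α * (2 * α - 1) := by
    have : 0 < 2 * α - 1 := by linarith
    positivity
  have h3 := le_abs_resonance hα hα' hR h
  have h4 : (2 * α * (2 * α - 1))⁻¹ * R ^ (2 - 2 * α) * (|(n : ℝ)| * |(m : ℝ)|)⁻¹ =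
      (2 * α * (2 * α - 1) * R ^ (2 * α - 2) * (|(n : ℝ)| * |(m : ℝ)|))⁻¹ := by
    rw [mul_inv _ (|(n : ℝ)| * |(m : ℝ)|), mul_inv _ (R ^ (2 * α - 2)), ← Real.rpow_neg hR.le,
      neg_sub]
  rw [h4]
  exact inv_anti₀ (by positivity) h3

/-- When `m` dominates, `R = B|m|` is admissible, and the inverse second difference is at most of
order `|m|^{-(2α-1)}|n|^{-1}`. -/
lemma resonance_inv_sq_le_of_large {α B : ℝ} {k n m : ℤ} (hα : 1 / 2 < α) (hα' : α ≤ 1)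
    (hB : 1 ≤ B) (hn : n ≠ 0) (hm : m ≠ 0)
    (h : |(k : ℝ)| + |(n : ℝ)| + |(m : ℝ)| ≤ B * |(m : ℝ)|) :
    (resonance α k n m)⁻¹ ^ 2 ≤ 16 * (2 * α * (2 * α - 1))⁻¹ ^ 2 * B ^ 2 *
      (jb m ^ (-(4 * α - 2)) * jb n ^ (-2 : ℝ)) := by
  have h1 := one_le_abs_intCast hn
  have h2 := one_le_abs_intCast hm
  have hc : 0 < 2 * α * (2 * α - 1) := by
    have : 0 < 2 * α - 1 := by linarith
    positivity
  have hM : 0 < |(m : ℝ)| := by linarith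
  have hN : 0 < |(n : ℝ)| := by linarith
  have h3 := abs_resonance_inv_le hα hα' (by positivity) hn hm h
  have e : (B * |(m : ℝ)|) ^ (2 - 2 * α) * (|(n : ℝ)| * |(m : ℝ)|)⁻¹ ≤
      B * |(m : ℝ)| ^ (-(2 * α - 1)) * |(n : ℝ)| ^ (-1 : ℝ) := by
    have e1 : |(m : ℝ)| ^ (2 - 2 * α) * |(m : ℝ)|⁻¹ = |(m : ℝ)| ^ (-(2 * α - 1)) := by
      rw [← Real.rpow_neg_one, ← Real.rpow_add hM]; ring_nf
    have e2 : B ^ (2 - 2 * α) ≤ B := by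
      calc B ^ (2 - 2 * α) ≤ B ^ (1 : ℝ) := Real.rpow_le_rpow_of_exponent_le hB (by linarith)
        _ = B := Real.rpow_one B
    rw [Real.mul_rpow (by linarith) hM.le, mul_inv, Real.rpow_neg_one, ← e1]
    calc _ = B ^ (2 - 2 * α) * (|(m : ℝ)| ^ (2 - 2 * α) * |(m : ℝ)|⁻¹) * |(n : ℝ)|⁻¹ := by ring
      _ ≤ _ := by gcongr
  have e3 : |(m : ℝ)| ^ (-(2 * α - 1)) ≤ 2 * jb m ^ (-(2 * α - 1)) := by
    refine (abs_rpow_neg_le_jb hm (by linarith)).trans ?_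
    gcongr
    · exact (jb_rpow_pos _ _).le
    · calc (2 : ℝ) ^ (2 * α - 1) ≤ 2 ^ (1 : ℝ) :=
          Real.rpow_le_rpow_of_exponent_le (by norm_num) (by linarith)
        _ = 2 := by norm_num
  have e4 : |(n : ℝ)| ^ (-1 : ℝ) ≤ 2 * jb n ^ (-1 : ℝ) := by
    simpa using abs_rpow_neg_le_jb hn (r := 1) (by norm_num)
  have pm := jb_rpow_pos (m : ℝ) (-(2 * α - 1))
  have pn := jb_rpow_pos (n : ℝ) (-1)
  have h5 : |resonance α k n m|⁻¹ ≤ 4 * (2 * α * (2 * α - 1))⁻¹ * B *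
      (jb m ^ (-(2 * α - 1)) * jb n ^ (-1 : ℝ)) := by
    calc _ ≤ _ := h3
      _ = (2 * α * (2 * α - 1))⁻¹ * ((B * |(m : ℝ)|) ^ (2 - 2 * α) *
          (|(n : ℝ)| * |(m : ℝ)|)⁻¹) := by ring
      _ ≤ (2 * α * (2 * α - 1))⁻¹ *
          (B * (2 * jb m ^ (-(2 * α - 1))) * (2 * jb n ^ (-1 : ℝ))) := by
          refine mul_le_mul_of_nonneg_left (e.trans ?_) (by positivity)
          gcongr
      _ = _ := by ring
  have h6 : (resonance α k n m)⁻¹ ^ 2 = |resonance α k n m|⁻¹ ^ 2 := by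
    rw [inv_pow, inv_pow, sq_abs]
  rw [h6]
  calc |resonance α k n m|⁻¹ ^ 2 ≤ (4 * (2 * α * (2 * α - 1))⁻¹ * B *
      (jb m ^ (-(2 * α - 1)) * jb n ^ (-1 : ℝ))) ^ 2 := by gcongr
    _ = 16 * (2 * α * (2 * α - 1))⁻¹ ^ 2 * B ^ 2 *
      ((jb m ^ (-(2 * α - 1))) ^ 2 * (jb n ^ (-1 : ℝ)) ^ 2) := by ring
    _ = _ := by
        rw [← Real.rpow_natCast (jb m ^ (-(2 * α - 1))) 2, ← Real.rpow_natCast (jb n ^ (-1 : ℝ)) 2,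
          ← Real.rpow_mul (jb_pos _).le, ← Real.rpow_mul (jb_pos _).le]
        congr 3
        · push_cast
          ring
        · norm_num

/-- The summand of the outer sum. -/
def outerTerm (α s a : ℝ) (k n m : ℤ) : ℝ :=
  jb k ^ (2 * (s + a)) * (resonance α k n m)⁻¹ ^ 2 *
    (jb ((k + n : ℤ) : ℝ) ^ (-(2 * s)) * jb ((k + m : ℤ) : ℝ) ^ (-(2 * s)) *
      jb ((k + n + m : ℤ) : ℝ) ^ (-(2 * s)))

lemma outerTerm_symm (α s a : ℝ) (k n m : ℤ) : outerTerm α s a k n m = outerTerm α s a k m n := by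
  unfold outerTerm resonance
  rw [add_right_comm k n m]
  ring_nf

/-- Majorant of `outerTerm` where `|m|` is at least of the size of `k` and of `n`. -/
def outerMajorant (s : ℝ) (k n m : ℤ) : ℝ :=
  (8 * jb n ^ (-2 : ℝ) + jb ((k + n : ℤ) : ℝ) ^ (-2 : ℝ)) *
    (jb ((k + m : ℤ) : ℝ) ^ (-(4 * s)) + jb ((k + n + m : ℤ) : ℝ) ^ (-(4 * s)))

/-- The output weight satisfies `⟨k⟩^{2s} ≲ ⟨k+n⟩^{2s} + ⟨n⟩^{2s}`. The first part cancels the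
weight at `k + n`; the second leaves exponents of total `2` on `⟨n⟩` and `⟨k+n⟩`. -/
lemma jb_weight_transfer {s : ℝ} {k n : ℤ} (hs0 : 0 ≤ s) (hs : s ≤ 1 / 2) :
    jb k ^ (2 * s) * (jb n ^ (-2 : ℝ) * jb ((k + n : ℤ) : ℝ) ^ (-(2 * s))) ≤
      2 * (8 * jb n ^ (-2 : ℝ) + jb ((k + n : ℤ) : ℝ) ^ (-2 : ℝ)) := by
  have hK : jb (k : ℝ) ≤ jb ((k + n : ℤ) : ℝ) + jb n := by
    have := jb_add_le ((k + n : ℤ) : ℝ) (-(n : ℝ))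
    rw [jb_neg] at this
    simpa using this
  set K := jb (k : ℝ)
  set Y := jb ((k + n : ℤ) : ℝ)
  set N := jb (n : ℝ)
  have hK0 : 0 < K := jb_pos _
  have hY0 : 1 ≤ Y := one_le_jb _
  have hN0 : 1 ≤ N := one_le_jb _
  have h2 : K ^ (2 * s) ≤ 2 * (Y ^ (2 * s) + N ^ (2 * s)) := by
    have e : (2 : ℝ) ^ (2 * s) ≤ 2 := by
      calc (2 : ℝ) ^ (2 * s) ≤ 2 ^ (1 : ℝ) :=
            Real.rpow_le_rpow_of_exponent_le (by norm_num) (by linarith)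
        _ = 2 := by norm_num
    have pY : 0 < Y ^ (2 * s) := by positivity
    have pN : 0 < N ^ (2 * s) := by positivity
    rcases le_total Y N with h | h
    · calc K ^ (2 * s) ≤ (2 * N) ^ (2 * s) := by gcongr; linarith
        _ = 2 ^ (2 * s) * N ^ (2 * s) := Real.mul_rpow (by norm_num) (by linarith)
        _ ≤ 2 * N ^ (2 * s) := by gcongr
        _ ≤ _ := by linarith
    · calc K ^ (2 * s) ≤ (2 * Y) ^ (2 * s) := by gcongr; linarith
        _ = 2 ^ (2 * s) * Y ^ (2 * s) := Real.mul_rpow (by norm_num) (by linarith)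
        _ ≤ 2 * Y ^ (2 * s) := by gcongr
        _ ≤ _ := by linarith
  have hY1 : 0 < Y := by linarith
  have hN1 : 0 < N := by linarith
  have e1 : Y ^ (2 * s) * Y ^ (-(2 * s)) = 1 := by rw [← Real.rpow_add hY1]; simp
  have e2 : N ^ (2 * s) * N ^ (-2 : ℝ) = N ^ (-(2 - 2 * s)) := by
    rw [← Real.rpow_add hN1]; ring_nf
  have e3 := rpow_neg_mul_rpow_neg_le hN0 hY0 (by linarith : 0 ≤ 2 - 2 * s)
    (by linarith : 0 ≤ 2 * s)
  rw [show -(2 - 2 * s + 2 * s) = -2 by ring] at e3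
  have pN2 : 0 < N ^ (-2 : ℝ) := by positivity
  calc K ^ (2 * s) * (N ^ (-2 : ℝ) * Y ^ (-(2 * s)))
      ≤ 2 * (Y ^ (2 * s) + N ^ (2 * s)) * (N ^ (-2 : ℝ) * Y ^ (-(2 * s))) := by gcongr
    _ = 2 * (N ^ (-2 : ℝ) * (Y ^ (2 * s) * Y ^ (-(2 * s))) +
        (N ^ (2 * s) * N ^ (-2 : ℝ)) * Y ^ (-(2 * s))) := by ring
    _ = 2 * (N ^ (-2 : ℝ) + N ^ (-(2 - 2 * s)) * Y ^ (-(2 * s))) := by rw [e1, e2, mul_one]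
    _ ≤ _ := by linarith

/-- Here `⟨k⟩ ≲ |m|`, so `⟨k⟩^{2a}⟨m⟩^{-(4α-2)}` stays bounded precisely because `a ≤ 2α - 1`,
endpoint included. The remaining `⟨k⟩^{2s}` is absorbed by `jb_weight_transfer`, and the two weights
containing `m` have total exponent `4s > 1` in the application. -/
lemma outerTerm_le_of_large {α s a : ℝ} {k n m : ℤ} (hα : 1 / 2 < α) (hα' : α ≤ 1)
    (hs0 : 0 ≤ s) (hs : s ≤ 1 / 2) (ha : a ≤ 2 * α - 1) (hn : n ≠ 0) (hm : m ≠ 0)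
    (hnm : |(n : ℝ)| ≤ |(m : ℝ)|) (hkm : jb k ≤ 4 * |(m : ℝ)|) :
    outerTerm α s a k n m ≤
      16 * (2 * α * (2 * α - 1))⁻¹ ^ 2 * 6 ^ 2 * 32 * outerMajorant s k n m := by
  -- The constant is `6 = 4 + 1 + 1`, from `|k| ≤ 4|m|` and `|n| ≤ |m|`.
  have h1 := resonance_inv_sq_le_of_large (α := α) (B := 6) (k := k) hα hα' (by norm_num) hn hm
    (by linarith [abs_le_jb (k : ℝ)])
  set C := 16 * (2 * α * (2 * α - 1))⁻¹ ^ 2 * (6 : ℝ) ^ 2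
  have hC : 0 ≤ C := by positivity
  have hK := one_le_jb (k : ℝ)
  have e1 : jb k ^ (2 * a) * jb m ^ (-(4 * α - 2)) ≤ 16 := by
    have := rpow_neg_le_of_le_mul (jb_pos k) (jb_pos m) (by norm_num : (0 : ℝ) < 4)
      (by linarith : 0 ≤ 4 * α - 2) (hkm.trans (by gcongr; exact abs_le_jb _))
    have h4 : (4 : ℝ) ^ (4 * α - 2) ≤ 16 := by
      calc (4 : ℝ) ^ (4 * α - 2) ≤ 4 ^ (2 : ℝ) :=
            Real.rpow_le_rpow_of_exponent_le (by norm_num) (by linarith)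
        _ = 16 := by norm_num
    have p1 := jb_rpow_pos (k : ℝ) (2 * a)
    have p2 := jb_rpow_pos (k : ℝ) (-(4 * α - 2))
    calc jb k ^ (2 * a) * jb m ^ (-(4 * α - 2))
        ≤ jb k ^ (2 * a) * (16 * jb k ^ (-(4 * α - 2))) := by
          gcongr
          exact this.trans (by gcongr)
      _ = 16 * jb k ^ (2 * a - (4 * α - 2)) := by
          rw [sub_eq_add_neg (2 * a), Real.rpow_add (jb_pos _)]; ring
      _ ≤ 16 * 1 := by
          gcongr
          exact Real.rpow_le_one_of_one_le_of_nonpos hK (by linarith)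
      _ = 16 := by norm_num
  have e2 := rpow_neg_mul_rpow_neg_le (one_le_jb ((k + m : ℤ) : ℝ))
    (one_le_jb ((k + n + m : ℤ) : ℝ)) (by linarith : 0 ≤ 2 * s) (by linarith : 0 ≤ 2 * s)
  rw [show -(2 * s + 2 * s) = -(4 * s) by ring] at e2
  have e3 := jb_weight_transfer (k := k) (n := n) hs0 hs
  have esplit : jb (k : ℝ) ^ (2 * (s + a)) = jb (k : ℝ) ^ (2 * s) * jb (k : ℝ) ^ (2 * a) := by
    rw [← Real.rpow_add (jb_pos _)]; ring_nf
  unfold outerTerm outerMajorant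
  have q0 := (jb_rpow_pos (k : ℝ) (2 * s)).le
  have q1 := (jb_rpow_pos (k : ℝ) (2 * a)).le
  have q2 := (jb_rpow_pos ((k + n : ℤ) : ℝ) (-(2 * s))).le
  have q3 := (jb_rpow_pos ((k + m : ℤ) : ℝ) (-(2 * s))).le
  have q4 := (jb_rpow_pos ((k + n + m : ℤ) : ℝ) (-(2 * s))).le
  have q5 := (jb_rpow_pos (n : ℝ) (-2)).le
  have q6 := (jb_rpow_pos ((k + n : ℤ) : ℝ) (-2)).le
  rw [esplit]
  generalize jb (k : ℝ) ^ (2 * s) = K1 at *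
  generalize jb (k : ℝ) ^ (2 * a) = K2 at *
  generalize jb ((k + n : ℤ) : ℝ) ^ (-(2 * s)) = W1 at *
  generalize jb ((k + m : ℤ) : ℝ) ^ (-(2 * s)) = W2 at *
  generalize jb ((k + n + m : ℤ) : ℝ) ^ (-(2 * s)) = W3 at *
  generalize jb ((k + m : ℤ) : ℝ) ^ (-(4 * s)) = V2 at *
  generalize jb ((k + n + m : ℤ) : ℝ) ^ (-(4 * s)) = V3 at *
  calc _ ≤ K1 * K2 * (C * (jb m ^ (-(4 * α - 2)) * jb n ^ (-2 : ℝ))) * (W1 * W2 * W3) := by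
        gcongr
    _ = C * (K2 * jb m ^ (-(4 * α - 2))) * (K1 * (jb n ^ (-2 : ℝ) * W1)) * (W2 * W3) := by ring
    _ ≤ C * 16 * (2 * (8 * jb n ^ (-2 : ℝ) + jb ((k + n : ℤ) : ℝ) ^ (-2 : ℝ))) * (V2 + V3) := by
        gcongr
    _ = _ := by ring

/-- All corners have size `⟨k⟩`. Of the factor `(|n||m|)^{-2}` coming from the denominators, the
power `1 + δ` is kept for summation in `n` and `m`, and the power `1 - δ` is converted into decay in
`⟨k⟩` by the nonresonance condition. Only here does the size `c⟨k⟩^{2-2α}` of the threshold matter.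
-/
lemma outerTerm_le_of_small {α s a c δ : ℝ} {k n m : ℤ} (hα : 1 / 2 < α) (hα' : α ≤ 1)
    (hc : 0 < c) (hs0 : 0 ≤ s) (hs : s ≤ 1 / 2) (hδ0 : 0 ≤ δ) (hδ1 : δ ≤ 1)
    (hδ : a + δ ≤ 2 * s + α - 1) (hn : n ≠ 0) (hm : m ≠ 0)
    (hnm : c * jb k ^ (2 - 2 * α) ≤ |(n : ℝ)| * |(m : ℝ)|)
    (hkn : 4 * |(n : ℝ)| ≤ jb k) (hkm : 4 * |(m : ℝ)| ≤ jb k) :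
    outerTerm α s a k n m ≤
      (2 * α * (2 * α - 1))⁻¹ ^ 2 * 4 * 8 * 16 * c ^ (-(1 - δ)) *
        (jb n ^ (-(1 + δ)) * jb m ^ (-(1 + δ))) := by
  have hα0 : 0 < 2 * α - 1 := by linarith
  have h1 := one_le_abs_intCast hn
  have h2 := one_le_abs_intCast hm
  have hK := one_le_jb (k : ℝ)
  have hk := abs_le_jb (k : ℝ)
  have hres := abs_resonance_inv_le hα hα' (by positivity : 0 < 2 * jb (k : ℝ)) hn hm
    (by linarith)
  have hw : ∀ l : ℤ, jb (k : ℝ) ≤ 2 * jb ((k + l : ℤ) : ℝ) →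
      jb ((k + l : ℤ) : ℝ) ^ (-(2 * s)) ≤ 2 * jb k ^ (-(2 * s)) := by
    intro l hl
    refine (rpow_neg_le_of_le_mul (jb_pos _) (jb_pos _) two_pos (by linarith) hl).trans ?_
    have := (jb_rpow_pos (k : ℝ) (-(2 * s))).le
    gcongr
    calc (2 : ℝ) ^ (2 * s) ≤ 2 ^ (1 : ℝ) :=
          Real.rpow_le_rpow_of_exponent_le (by norm_num) (by linarith)
      _ = 2 := by norm_num
  have hl : ∀ l : ℤ, 2 * |(l : ℝ)| ≤ jb k → jb (k : ℝ) ≤ 2 * jb ((k + l : ℤ) : ℝ) := by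
    intro l hl
    have := jb_le_add_abs ((k + l : ℤ) : ℝ) (-(l : ℝ))
    rw [abs_neg] at this
    push_cast at this ⊢
    rw [add_neg_cancel_right] at this
    linarith
  have w1 := hw n (hl n (by linarith))
  have w2 := hw m (hl m (by linarith))
  have w3 := hw (n + m) (hl (n + m) (by
    push_cast
    linarith [abs_add_le (n : ℝ) m]))
  rw [← add_assoc] at w3
  set K := jb (k : ℝ)
  have hK0 : 0 < K := jb_pos _
  set X := |(n : ℝ)| * |(m : ℝ)| with hX
  have hX0 : 0 < X := by positivity
  -- `X⁻² ≤ X^{-1-δ} (c K^{2-2α})^{-(1-δ)}`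
  have hXsq : X⁻¹ ^ 2 ≤ X ^ (-(1 + δ)) * (c ^ (-(1 - δ)) * K ^ (-((2 - 2 * α) * (1 - δ)))) := by
    have e1 : X⁻¹ ^ 2 = X ^ (-(1 + δ)) * X ^ (-(1 - δ)) := by
      rw [← Real.rpow_add hX0, inv_pow, ← Real.rpow_natCast, ← Real.rpow_neg hX0.le]
      congr 1
      push_cast
      ring
    have e2 : X ^ (-(1 - δ)) ≤ (c * K ^ (2 - 2 * α)) ^ (-(1 - δ)) :=
      Real.rpow_le_rpow_of_nonpos (by positivity) hnm (by linarith)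
    rw [Real.mul_rpow hc.le (by positivity), ← Real.rpow_mul hK0.le] at e2
    rw [e1]
    gcongr
    refine e2.trans_eq ?_
    ring_nf
  have hXjb : X ^ (-(1 + δ)) ≤ 16 * (jb n ^ (-(1 + δ)) * jb m ^ (-(1 + δ))) := by
    have b1 := abs_rpow_neg_le_jb hn (by linarith : 0 ≤ 1 + δ)
    have b2 := abs_rpow_neg_le_jb hm (by linarith : 0 ≤ 1 + δ)
    have b3 : (2 : ℝ) ^ (1 + δ) ≤ 4 := by
      calc (2 : ℝ) ^ (1 + δ) ≤ 2 ^ (2 : ℝ) :=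
            Real.rpow_le_rpow_of_exponent_le (by norm_num) (by linarith)
        _ = 4 := by norm_num
    have p1 := (jb_rpow_pos (n : ℝ) (-(1 + δ))).le
    have p2 := (jb_rpow_pos (m : ℝ) (-(1 + δ))).le
    rw [hX, Real.mul_rpow (abs_nonneg _) (abs_nonneg _)]
    calc _ ≤ (2 ^ (1 + δ) * jb n ^ (-(1 + δ))) * (2 ^ (1 + δ) * jb m ^ (-(1 + δ))) := by gcongr
      _ ≤ (4 * jb n ^ (-(1 + δ))) * (4 * jb m ^ (-(1 + δ))) := by gcongr
      _ = _ := by ring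
  have hres2 : (resonance α k n m)⁻¹ ^ 2 ≤
      (2 * α * (2 * α - 1))⁻¹ ^ 2 * (4 * K ^ (4 - 4 * α)) * X⁻¹ ^ 2 := by
    have h6 : (resonance α k n m)⁻¹ ^ 2 = |resonance α k n m|⁻¹ ^ 2 := by
      rw [inv_pow, inv_pow, sq_abs]
    have h7 : (2 * K) ^ (2 - 2 * α) ≤ 2 * K ^ (2 - 2 * α) := by
      rw [Real.mul_rpow (by norm_num) hK0.le]
      gcongr
      calc (2 : ℝ) ^ (2 - 2 * α) ≤ 2 ^ (1 : ℝ) :=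
            Real.rpow_le_rpow_of_exponent_le (by norm_num) (by linarith)
        _ = 2 := by norm_num
    have h8 : K ^ (4 - 4 * α) = (K ^ (2 - 2 * α)) ^ 2 := by
      rw [← Real.rpow_natCast, ← Real.rpow_mul hK0.le]
      norm_num
      ring_nf
    rw [h6, h8]
    calc |resonance α k n m|⁻¹ ^ 2
        ≤ ((2 * α * (2 * α - 1))⁻¹ * (2 * K) ^ (2 - 2 * α) * X⁻¹) ^ 2 := by gcongr
      _ ≤ ((2 * α * (2 * α - 1))⁻¹ * (2 * K ^ (2 - 2 * α)) * X⁻¹) ^ 2 := by gcongr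
      _ = _ := by ring
  have q2 := (jb_rpow_pos ((k + n : ℤ) : ℝ) (-(2 * s))).le
  have q3 := (jb_rpow_pos ((k + m : ℤ) : ℝ) (-(2 * s))).le
  have q4 := (jb_rpow_pos ((k + n + m : ℤ) : ℝ) (-(2 * s))).le
  have qn := (jb_rpow_pos (n : ℝ) (-(1 + δ))).le
  have qm := (jb_rpow_pos (m : ℝ) (-(1 + δ))).le
  have hpow : K ^ (2 * (s + a)) * K ^ (4 - 4 * α) * K ^ (-((2 - 2 * α) * (1 - δ))) *
      (K ^ (-(2 * s)) * K ^ (-(2 * s)) * K ^ (-(2 * s))) ≤ 1 := by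
    rw [← Real.rpow_add hK0, ← Real.rpow_add hK0, ← Real.rpow_add hK0, ← Real.rpow_add hK0,
      ← Real.rpow_add hK0]
    refine Real.rpow_le_one_of_one_le_of_nonpos hK ?_
    -- The total exponent of `⟨k⟩` is `2a - 4s + (2-2α)(1+δ)`, which is at most `-2αδ` because `a +
    -- δ ≤ 2s + α - 1`.
    nlinarith
  unfold outerTerm
  calc _ ≤ K ^ (2 * (s + a)) * ((2 * α * (2 * α - 1))⁻¹ ^ 2 * (4 * K ^ (4 - 4 * α)) *
        ((16 * (jb n ^ (-(1 + δ)) * jb m ^ (-(1 + δ)))) *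
          (c ^ (-(1 - δ)) * K ^ (-((2 - 2 * α) * (1 - δ)))))) *
        ((2 * K ^ (-(2 * s))) * (2 * K ^ (-(2 * s))) * (2 * K ^ (-(2 * s)))) := by
        gcongr
        refine hres2.trans ?_
        gcongr
        refine hXsq.trans ?_
        gcongr
    _ = (2 * α * (2 * α - 1))⁻¹ ^ 2 * 4 * 8 * 16 * c ^ (-(1 - δ)) *
        (jb n ^ (-(1 + δ)) * jb m ^ (-(1 + δ))) *
        (K ^ (2 * (s + a)) * K ^ (4 - 4 * α) * K ^ (-((2 - 2 * α) * (1 - δ))) *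
      (K ^ (-(2 * s)) * K ^ (-(2 * s)) * K ^ (-(2 * s)))) := by ring
    _ ≤ _ := mul_le_of_le_one_right (by positivity) hpow

lemma tsum_outerMajorant_le (s : ℝ) (k : ℤ) :
    ∑' n : ℤ, ∑' m : ℤ, ENNReal.ofReal (outerMajorant s k n m) ≤
      (9 * jbSum 2) * (2 * jbSum (4 * s)) := by
  have h : ∀ n m : ℤ, ENNReal.ofReal (outerMajorant s k n m) =
      (8 * ENNReal.ofReal (jb n ^ (-2 : ℝ)) + ENNReal.ofReal (jb ((k + n : ℤ) : ℝ) ^ (-2 : ℝ))) *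
      (ENNReal.ofReal (jb ((k + m : ℤ) : ℝ) ^ (-(4 * s))) +
        ENNReal.ofReal (jb ((k + n + m : ℤ) : ℝ) ^ (-(4 * s)))) := by
    intro n m
    have h := fun x r => (jb_rpow_pos x r).le
    unfold outerMajorant
    rw [ENNReal.ofReal_mul (add_nonneg (mul_nonneg (by norm_num) (h _ _)) (h _ _)),
      ENNReal.ofReal_add (mul_nonneg (by norm_num) (h _ _)) (h _ _),
      ENNReal.ofReal_add (h _ _) (h _ _), ENNReal.ofReal_mul (by norm_num), ENNReal.ofReal_ofNat]
  simp_rw [h, ENNReal.tsum_mul_left, ENNReal.tsum_add, tsum_jb_add, ENNReal.tsum_mul_right,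
    ENNReal.tsum_add, ENNReal.tsum_mul_left, tsum_jb_add]
  refine le_of_eq ?_
  change (8 * jbSum 2 + jbSum 2) * _ = _
  ring

lemma ne_zero_of_admissible {c x : ℝ} {k n m : ℤ} (hc : 0 < c)
    (h : c * jb k ^ x ≤ |(n : ℝ)| * |(m : ℝ)|) : n ≠ 0 ∧ m ≠ 0 := by
  have : 0 < |(n : ℝ)| * |(m : ℝ)| := (mul_pos hc (jb_rpow_pos _ _)).trans_le h
  constructor <;> rintro rfl <;> simp at this

/-- The outer sum is bounded uniformly in the output frequency. -/
lemma exists_tsum_outerTerm_le {α s a c : ℝ} (hα : 1 / 2 < α) (hα' : α ≤ 1) (hc : 0 < c)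
    (hs0 : 1 / 4 < s) (hs : s ≤ 1 / 2) (ha : a ≤ 2 * α - 1) (ha' : a < 2 * s + α - 1) :
    ∃ C : ℝ≥0, ∀ k : ℤ, ∑' n : ℤ, ∑' m : ℤ,
      (if c * jb k ^ (2 - 2 * α) ≤ |(n : ℝ)| * |(m : ℝ)| then
        ENNReal.ofReal (outerTerm α s a k n m) else 0) ≤ C := by
  -- The room in the strict inequality for `a` becomes the summability margin; the cap at 1 keeps `1
  -- - δ` nonnegative.
  set δ := min 1 (2 * s + α - 1 - a) with hδ
  have hδ0 : 0 < δ := lt_min one_pos (by linarith)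
  have hδ1 : δ ≤ 1 := min_le_left _ _
  have hδ2 : a + δ ≤ 2 * s + α - 1 := by linarith [min_le_right 1 (2 * s + α - 1 - a)]
  set A := (2 * α * (2 * α - 1))⁻¹ ^ 2 * 4 * 8 * 16 * c ^ (-(1 - δ)) with hA
  have hA0 : 0 ≤ A := by positivity
  set B := 16 * (2 * α * (2 * α - 1))⁻¹ ^ 2 * (6 : ℝ) ^ 2 * 32 with hB
  have hB0 : 0 ≤ B := by positivity
  have hpt : ∀ k n m : ℤ, (if c * jb k ^ (2 - 2 * α) ≤ |(n : ℝ)| * |(m : ℝ)| then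
        ENNReal.ofReal (outerTerm α s a k n m) else 0) ≤
      ENNReal.ofReal A * (ENNReal.ofReal (jb n ^ (-(1 + δ))) *
        ENNReal.ofReal (jb m ^ (-(1 + δ)))) +
      ENNReal.ofReal B * (ENNReal.ofReal (outerMajorant s k n m) +
        ENNReal.ofReal (outerMajorant s k m n)) := by
    intro k n m
    split_ifs with h
    swap
    · exact zero_le
    obtain ⟨hn, hm⟩ := ne_zero_of_admissible hc h
    by_cases hsm : 4 * |(n : ℝ)| ≤ jb k ∧ 4 * |(m : ℝ)| ≤ jb k
    · refine le_trans ?_ le_self_add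
      rw [← ENNReal.ofReal_mul (jb_rpow_pos _ _).le, ← ENNReal.ofReal_mul hA0]
      exact ENNReal.ofReal_le_ofReal (outerTerm_le_of_small hα hα' hc (by linarith) hs hδ0.le
        hδ1 hδ2 hn hm h hsm.1 hsm.2)
    · refine le_trans ?_ le_add_self
      rw [mul_add, ← ENNReal.ofReal_mul hB0, ← ENNReal.ofReal_mul hB0]
      rcases le_total |(n : ℝ)| |(m : ℝ)| with hl | hl
      · refine le_trans (ENNReal.ofReal_le_ofReal ?_) le_self_add
        refine outerTerm_le_of_large hα hα' (by linarith) hs ha hn hm hl ?_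
        by_contra hcon
        exact hsm ⟨by linarith, by linarith⟩
      · refine le_trans (ENNReal.ofReal_le_ofReal ?_) le_add_self
        rw [outerTerm_symm]
        refine outerTerm_le_of_large hα hα' (by linarith) hs ha hm hn hl ?_
        by_contra hcon
        exact hsm ⟨by linarith, by linarith⟩
  set T := ENNReal.ofReal A * (jbSum (1 + δ) * jbSum (1 + δ)) + ENNReal.ofReal B *
    ((9 * jbSum 2) * (2 * jbSum (4 * s)) + (9 * jbSum 2) * (2 * jbSum (4 * s))) with hT
  have j1 : jbSum (1 + δ) ≠ ∞ := (jbSum_lt_top (by linarith)).ne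
  have j2 : jbSum 2 ≠ ∞ := (jbSum_lt_top (by norm_num)).ne
  have j3 : jbSum (4 * s) ≠ ∞ := (jbSum_lt_top (by linarith)).ne
  have hTt : T ≠ ∞ := by
    rw [hT]
    finiteness
  refine ⟨T.toNNReal, fun k => ?_⟩
  rw [ENNReal.coe_toNNReal hTt]
  calc _ ≤ ∑' n : ℤ, ∑' m : ℤ, (ENNReal.ofReal A * (ENNReal.ofReal (jb n ^ (-(1 + δ))) *
        ENNReal.ofReal (jb m ^ (-(1 + δ)))) +
      ENNReal.ofReal B * (ENNReal.ofReal (outerMajorant s k n m) +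
        ENNReal.ofReal (outerMajorant s k m n))) :=
        ENNReal.tsum_le_tsum fun n => ENNReal.tsum_le_tsum fun m => hpt k n m
    _ = ENNReal.ofReal A * (jbSum (1 + δ) * jbSum (1 + δ)) + ENNReal.ofReal B *
        (∑' n : ℤ, ∑' m : ℤ, ENNReal.ofReal (outerMajorant s k n m) +
          ∑' n : ℤ, ∑' m : ℤ, ENNReal.ofReal (outerMajorant s k m n)) := by
        simp_rw [ENNReal.tsum_add, ENNReal.tsum_mul_left, ENNReal.tsum_add,
          ENNReal.tsum_mul_right]
        rfl
    _ ≤ T := by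
        rw [hT]
        gcongr
        · exact tsum_outerMajorant_le s k
        · rw [ENNReal.tsum_comm]
          exact tsum_outerMajorant_le s k

/-! ### Sums over the frequency sets -/

/-- The time frequency `|k₁|^{2α} - |k₂|^{2α} + |k₃|^{2α} - |k₄|^{2α} + |k₅|^{2α}`. -/
def phase (α : ℝ) (κ : Fin 5 → ℤ) : ℝ :=
  disp α (κ 0) - disp α (κ 1) + disp α (κ 2) - disp α (κ 3) + disp α (κ 4)

/-- The denominator of `NR₁`. -/
def den1 (α : ℝ) (k : ℤ) (κ : Fin 5 → ℤ) : ℝ :=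
  disp α k - disp α (κ 0) + disp α (κ 1) - disp α (k - κ 0 + κ 1)

/-- The denominator of `NR₂`. -/
def den2 (α : ℝ) (k : ℤ) (κ : Fin 5 → ℤ) : ℝ :=
  disp α k - disp α (κ 0) + disp α (k - κ 0 - κ 2) - disp α (κ 2)

lemma disp_neg (α : ℝ) (k : ℤ) : disp α (-k) = disp α k := by simp [disp]

lemma den1_eq (α : ℝ) (k : ℤ) (κ : Fin 5 → ℤ) :
    den1 α k κ = resonance α k (κ 0 - k) (κ 1 - κ 0) := by
  unfold den1 resonance
  rw [show k + (κ 0 - k) = κ 0 by ring, show k + (κ 1 - κ 0) = k - κ 0 + κ 1 by ring,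
    show κ 0 + (κ 1 - κ 0) = κ 1 by ring]
  ring

/-- Evenness of the dispersion replaces `k - k₁ - k₃` by the corner `k₁ + k₃ - k`, so this
denominator is a second difference as well. -/
lemma den2_eq (α : ℝ) (k : ℤ) (κ : Fin 5 → ℤ) :
    den2 α k κ = resonance α k (κ 0 - k) (κ 2 - k) := by
  unfold den2 resonance
  rw [show k + (κ 0 - k) = κ 0 by ring, show k + (κ 2 - k) = κ 2 by ring,
    ← disp_neg α (k - κ 0 - κ 2), show -(k - κ 0 - κ 2) = κ 0 + (κ 2 - k) by ring]
  ring

/-- The summand that the Cauchy–Schwarz inequality produces. -/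
def weightTerm (α s a γ : ℝ) (D : ℤ → (Fin 5 → ℤ) → ℝ) (k : ℤ) (κ : Fin 5 → ℤ) : ℝ :=
  jb k ^ (2 * (s + a)) * (D k κ)⁻¹ ^ 2 * (∏ i, jb (κ i) ^ (-(2 * s))) *
    jb (disp α k - phase α κ) ^ (-γ)

lemma tsum_le_tsum_quadruple {ι : Type*} {g : ι → ℝ≥0∞} {A : ℤ → ℤ → ℝ≥0∞}
    {B : ℤ → ℤ → ℤ → ℤ → ℝ≥0∞} (e : ι → ℤ × ℤ × ℤ × ℤ) (he : Function.Injective e)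
    (h : ∀ i, g i ≤ A (e i).1 (e i).2.1 * B (e i).1 (e i).2.1 (e i).2.2.1 (e i).2.2.2) :
    ∑' i, g i ≤ ∑' n, ∑' m, A n m * ∑' x, ∑' z, B n m x z := by
  calc ∑' i, g i ≤ ∑' i, (fun q : ℤ × ℤ × ℤ × ℤ => A q.1 q.2.1 * B q.1 q.2.1 q.2.2.1 q.2.2.2)
        (e i) := ENNReal.tsum_le_tsum h
    _ ≤ ∑' q : ℤ × ℤ × ℤ × ℤ, A q.1 q.2.1 * B q.1 q.2.1 q.2.2.1 q.2.2.2 :=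
        ENNReal.tsum_comp_le_tsum_of_injective he _
    _ = _ := by simp_rw [ENNReal.tsum_prod', ENNReal.tsum_mul_left]

lemma mem_freq1 {α c : ℝ} {k : ℤ} {κ : Fin 5 → ℤ} : κ ∈ freq1 α c k ↔
    k - κ 0 + κ 1 - κ 2 + κ 3 - κ 4 = 0 ∧
      c * jb (k : ℝ) ^ (2 - 2 * α) ≤ |((κ 0 - k : ℤ) : ℝ)| * |((κ 1 - κ 0 : ℤ) : ℝ)| := Iff.rfl

lemma mem_freq2 {α c : ℝ} {k : ℤ} {κ : Fin 5 → ℤ} : κ ∈ freq2 α c k ↔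
    k - κ 0 + κ 1 - κ 2 + κ 3 - κ 4 = 0 ∧
      c * jb (k : ℝ) ^ (2 - 2 * α) ≤ |((κ 0 - k : ℤ) : ℝ)| * |((k - κ 2 : ℤ) : ℝ)| := Iff.rfl

/-- Coordinates on `freq1 α c k`. -/
def coord1 (k : ℤ) (κ : Fin 5 → ℤ) : ℤ × ℤ × ℤ × ℤ := (κ 0 - k, κ 1 - κ 0, κ 2, κ 4)

/-- Coordinates on `freq2 α c k`. -/
def coord2 (k : ℤ) (κ : Fin 5 → ℤ) : ℤ × ℤ × ℤ × ℤ := (κ 0 - k, κ 2 - k, κ 1, κ 3)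

lemma coord1_injective (α c : ℝ) (k : ℤ) :
    Function.Injective (fun κ : freq1 α c k => coord1 k κ) := by
  rintro ⟨κ, hm⟩ ⟨κ', hm'⟩ h
  have hκ := (mem_freq1.1 hm).1
  have hκ' := (mem_freq1.1 hm').1
  simp only [coord1, Prod.mk.injEq] at h
  obtain ⟨h0, h1, h2, h4⟩ := h
  refine Subtype.ext (funext fun i => ?_)
  fin_cases i <;> simp <;> omega

lemma coord2_injective (α c : ℝ) (k : ℤ) :
    Function.Injective (fun κ : freq2 α c k => coord2 k κ) := by
  rintro ⟨κ, hm⟩ ⟨κ', hm'⟩ h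
  have hκ := (mem_freq2.1 hm).1
  have hκ' := (mem_freq2.1 hm').1
  simp only [coord2, Prod.mk.injEq] at h
  obtain ⟨h0, h1, h2, h4⟩ := h
  refine Subtype.ext (funext fun i => ?_)
  fin_cases i <;> simp <;> omega

/-- The part of `weightTerm` that depends on the outer frequencies, here `k + n` and `p`. -/
def outerPart (α s a c : ℝ) (k n m p : ℤ) : ℝ≥0∞ :=
  if c * jb k ^ (2 - 2 * α) ≤ |(n : ℝ)| * |(m : ℝ)| then
    ENNReal.ofReal (jb k ^ (2 * (s + a)) * (resonance α k n m)⁻¹ ^ 2 *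
      (jb ((k + n : ℤ) : ℝ) ^ (-(2 * s)) * jb (p : ℝ) ^ (-(2 * s)))) else 0

lemma outerPart_mul_le {α s a c : ℝ} {C : ℝ≥0} {k n m p q : ℤ}
    (hpq : (p = k + n + m ∧ q = k + m) ∨ (p = k + m ∧ q = k + n + m)) :
    outerPart α s a c k n m p * (C * ENNReal.ofReal (jb q ^ (-(2 * s)))) ≤
      C * (if c * jb k ^ (2 - 2 * α) ≤ |(n : ℝ)| * |(m : ℝ)| then
        ENNReal.ofReal (outerTerm α s a k n m) else 0) := by
  unfold outerPart
  split_ifs with h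
  swap
  · simp
  rw [mul_left_comm]
  gcongr
  have h := fun x r => (jb_rpow_pos x r).le
  rw [← ENNReal.ofReal_mul (mul_nonneg (mul_nonneg (h _ _) (sq_nonneg _))
    (mul_nonneg (h _ _) (h _ _)))]
  refine ENNReal.ofReal_le_ofReal (le_of_eq ?_)
  unfold outerTerm
  rcases hpq with ⟨rfl, rfl⟩ | ⟨rfl, rfl⟩ <;> ring

/-- With `n = k₁ - k` and `m = k₂ - k₁`, the frequencies `k₁ = k + n` and `k₂ = k + n + m` are outer
ones, and the constraint reads `k₃ - k₄ + k₅ = k + m`. The inner sum thus returns the weight at the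
one corner that is still missing. -/
lemma tsum_weightTerm_freq1_le {α s a c γ : ℝ} {C C' : ℝ≥0}
    (hC : ∀ (μ : ℝ) (q : ℤ), ∑' x : ℤ, ∑' z : ℤ, ENNReal.ofReal (innerTerm α s γ μ q x z) ≤
        C * ENNReal.ofReal (jb q ^ (-(2 * s))))
    (hC' : ∀ k : ℤ, ∑' n : ℤ, ∑' m : ℤ,
      (if c * jb k ^ (2 - 2 * α) ≤ |(n : ℝ)| * |(m : ℝ)| then
        ENNReal.ofReal (outerTerm α s a k n m) else 0) ≤ C') (k : ℤ) :
    ∑' κ : freq1 α c k, ENNReal.ofReal (weightTerm α s a γ (den1 α) k κ) ≤ C * C' := by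
  have h := fun x r => (jb_rpow_pos x r).le
  calc _ ≤ ∑' n : ℤ, ∑' m : ℤ, outerPart α s a c k n m (k + n + m) *
        ∑' x : ℤ, ∑' z : ℤ, ENNReal.ofReal (innerTerm α s γ
          (disp α k - disp α (k + n) + disp α (k + n + m)) (k + m) x z) := by
        refine tsum_le_tsum_quadruple (fun κ : freq1 α c k => coord1 k κ) (coord1_injective α c k)
          (B := fun n m x z => ENNReal.ofReal (innerTerm α s γ
          (disp α k - disp α (k + n) + disp α (k + n + m)) (k + m) x z)) ?_
        rintro ⟨κ, hmem⟩
        obtain ⟨hκ, hadm⟩ := mem_freq1.1 hmem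
        have hif : c * jb k ^ (2 - 2 * α) ≤
            |((coord1 k κ).1 : ℝ)| * |((coord1 k κ).2.1 : ℝ)| := hadm
        unfold outerPart
        rw [if_pos hif]
        simp only [coord1]
        rw [← ENNReal.ofReal_mul (mul_nonneg (mul_nonneg (h _ _) (sq_nonneg _))
          (mul_nonneg (h _ _) (h _ _)))]
        refine ENNReal.ofReal_le_ofReal (le_of_eq ?_)
        unfold weightTerm innerTerm phase
        rw [den1_eq, Fin.prod_univ_five, show k + (κ 0 - k) = κ 0 by ring,
          show κ 0 + (κ 1 - κ 0) = κ 1 by ring,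
          show κ 2 + κ 4 - (k + (κ 1 - κ 0)) = κ 3 by linarith, ← jb_neg
            (disp α k - (disp α (κ 0) - disp α (κ 1) + disp α (κ 2) - disp α (κ 3) + disp α (κ 4)))]
        ring_nf
    _ ≤ ∑' n : ℤ, ∑' m : ℤ, C * (if c * jb k ^ (2 - 2 * α) ≤ |(n : ℝ)| * |(m : ℝ)| then
        ENNReal.ofReal (outerTerm α s a k n m) else 0) := by
        refine ENNReal.tsum_le_tsum fun n => ENNReal.tsum_le_tsum fun m => ?_
        exact (mul_le_mul_right (hC _ _) _).trans (outerPart_mul_le (Or.inl ⟨rfl, rfl⟩))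
    _ = C * ∑' n : ℤ, ∑' m : ℤ, (if c * jb k ^ (2 - 2 * α) ≤ |(n : ℝ)| * |(m : ℝ)| then
        ENNReal.ofReal (outerTerm α s a k n m) else 0) := by simp_rw [ENNReal.tsum_mul_left]
    _ ≤ C * C' := mul_le_mul_right (hC' k) _

/-- Here `k₁ = k + n` and `k₃ = k + m` are the outer frequencies, and the constraint becomes `k₂ +
k₄ - k₅ = k + n + m`, the missing corner. -/
lemma tsum_weightTerm_freq2_le {α s a c γ : ℝ} {C C' : ℝ≥0}
    (hC : ∀ (μ : ℝ) (q : ℤ), ∑' x : ℤ, ∑' z : ℤ, ENNReal.ofReal (innerTerm α s γ μ q x z) ≤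
        C * ENNReal.ofReal (jb q ^ (-(2 * s))))
    (hC' : ∀ k : ℤ, ∑' n : ℤ, ∑' m : ℤ,
      (if c * jb k ^ (2 - 2 * α) ≤ |(n : ℝ)| * |(m : ℝ)| then
        ENNReal.ofReal (outerTerm α s a k n m) else 0) ≤ C') (k : ℤ) :
    ∑' κ : freq2 α c k, ENNReal.ofReal (weightTerm α s a γ (den2 α) k κ) ≤ C * C' := by
  have h := fun x r => (jb_rpow_pos x r).le
  calc _ ≤ ∑' n : ℤ, ∑' m : ℤ, outerPart α s a c k n m (k + m) *
        ∑' x : ℤ, ∑' z : ℤ, ENNReal.ofReal (innerTerm α s γ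
          (disp α (k + n) + disp α (k + m) - disp α k) (k + n + m) x z) := by
        refine tsum_le_tsum_quadruple (fun κ : freq2 α c k => coord2 k κ) (coord2_injective α c k)
          (B := fun n m x z => ENNReal.ofReal (innerTerm α s γ
          (disp α (k + n) + disp α (k + m) - disp α k) (k + n + m) x z)) ?_
        rintro ⟨κ, hmem⟩
        obtain ⟨hκ, hadm⟩ := mem_freq2.1 hmem
        have hadm' : c * jb k ^ (2 - 2 * α) ≤
            |((κ 0 - k : ℤ) : ℝ)| * |((κ 2 - k : ℤ) : ℝ)| := by
          rw [← abs_neg ((κ 2 - k : ℤ) : ℝ), ← Int.cast_neg, neg_sub]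
          exact hadm
        have hif : c * jb k ^ (2 - 2 * α) ≤
            |((coord2 k κ).1 : ℝ)| * |((coord2 k κ).2.1 : ℝ)| := hadm'
        unfold outerPart
        rw [if_pos hif]
        simp only [coord2]
        rw [← ENNReal.ofReal_mul (mul_nonneg (mul_nonneg (h _ _) (sq_nonneg _))
          (mul_nonneg (h _ _) (h _ _)))]
        refine ENNReal.ofReal_le_ofReal (le_of_eq ?_)
        unfold weightTerm innerTerm phase
        rw [den2_eq, Fin.prod_univ_five, show k + (κ 0 - k) = κ 0 by ring,
          show k + (κ 2 - k) = κ 2 by ring,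
          show κ 1 + κ 3 - (κ 0 + (κ 2 - k)) = κ 4 by linarith]
        ring_nf
    _ ≤ ∑' n : ℤ, ∑' m : ℤ, C * (if c * jb k ^ (2 - 2 * α) ≤ |(n : ℝ)| * |(m : ℝ)| then
        ENNReal.ofReal (outerTerm α s a k n m) else 0) := by
        refine ENNReal.tsum_le_tsum fun n => ENNReal.tsum_le_tsum fun m => ?_
        exact (mul_le_mul_right (hC _ _) _).trans (outerPart_mul_le (Or.inr ⟨rfl, rfl⟩))
    _ = C * ∑' n : ℤ, ∑' m : ℤ, (if c * jb k ^ (2 - 2 * α) ≤ |(n : ℝ)| * |(m : ℝ)| then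
        ENNReal.ofReal (outerTerm α s a k n m) else 0) := by simp_rw [ENNReal.tsum_mul_left]
    _ ≤ C * C' := mul_le_mul_right (hC' k) _

/-! ### Absolute convergence at a fixed output frequency -/

/-- The smallest of the three numbers is at most the geometric mean of the other two. -/
lemma mul_mul_le_rpow_add {a b c : ℝ} (ha : 0 ≤ a) (hb : 0 ≤ b) (hc : 0 ≤ c) :
    a * b * c ≤ a ^ (3 / 2 : ℝ) * b ^ (3 / 2 : ℝ) + b ^ (3 / 2 : ℝ) * c ^ (3 / 2 : ℝ) +
      a ^ (3 / 2 : ℝ) * c ^ (3 / 2 : ℝ) := by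
  have key : ∀ {x y z : ℝ}, 0 ≤ x → 0 ≤ y → 0 ≤ z → z ≤ x → z ≤ y →
      x * y * z ≤ x ^ (3 / 2 : ℝ) * y ^ (3 / 2 : ℝ) := by
    intro x y z hx hy hz hzx hzy
    have h32 : ∀ {t : ℝ}, 0 ≤ t → t ^ (3 / 2 : ℝ) = t * Real.sqrt t := by
      intro t ht
      rw [Real.sqrt_eq_rpow, show (3 / 2 : ℝ) = 1 + 1 / 2 by norm_num,
        Real.rpow_add_of_nonneg ht (by norm_num) (by norm_num), Real.rpow_one]
    rw [h32 hx, h32 hy]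
    have : z ≤ Real.sqrt x * Real.sqrt y := by
      calc z = Real.sqrt z * Real.sqrt z := (Real.mul_self_sqrt hz).symm
        _ ≤ _ := by gcongr
    calc x * y * z ≤ x * y * (Real.sqrt x * Real.sqrt y) := by gcongr
      _ = _ := by ring
  have pa : 0 ≤ a ^ (3 / 2 : ℝ) := by positivity
  have pb : 0 ≤ b ^ (3 / 2 : ℝ) := by positivity
  have pc : 0 ≤ c ^ (3 / 2 : ℝ) := by positivity
  have h1 := mul_nonneg pa pb
  have h2 := mul_nonneg pb pc
  have h3 := mul_nonneg pa pc
  rcases le_total a b with hab | hab <;> rcases le_total b c with hbc | hbc <;>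
    rcases le_total a c with hac | hac
  all_goals first
    | (have := key ha hb hc (by linarith) (by linarith); linarith)
    | (have := key hb hc ha (by linarith) (by linarith); linarith)
    | (have := key ha hc hb (by linarith) (by linarith); linarith)

/-- The two terms on the right are equal at the threshold `b = w^{-4s}`; each dominates on its side
of it. -/
lemma rpow_three_halves_le {b w : ℝ} {s : ℝ} (hb : 0 ≤ b) (hw : 0 < w) :
    b ^ (3 / 2 : ℝ) ≤ w ^ (2 * s) * b ^ 2 + w ^ (-(6 * s)) := by
  have p1 : 0 < w ^ (2 * s) := by positivity
  have p2 : 0 < w ^ (-(6 * s)) := by positivity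
  rcases le_total b (w ^ (-(4 * s))) with h | h
  · have : b ^ (3 / 2 : ℝ) ≤ w ^ (-(6 * s)) := by
      calc b ^ (3 / 2 : ℝ) ≤ (w ^ (-(4 * s))) ^ (3 / 2 : ℝ) := by gcongr
        _ = w ^ (-(6 * s)) := by rw [← Real.rpow_mul hw.le]; ring_nf
    nlinarith [sq_nonneg b]
  · have h1 : w ^ (-(2 * s)) ≤ b ^ (1 / 2 : ℝ) := by
      calc w ^ (-(2 * s)) = (w ^ (-(4 * s))) ^ (1 / 2 : ℝ) := by
            rw [← Real.rpow_mul hw.le]; ring_nf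
        _ ≤ _ := by gcongr
    have h2 : b ^ 2 = b ^ (3 / 2 : ℝ) * b ^ (1 / 2 : ℝ) := by
      rw [← Real.rpow_add_of_nonneg hb (by norm_num) (by norm_num), ← Real.rpow_natCast]
      norm_num
    have h3 : b ^ (3 / 2 : ℝ) = w ^ (2 * s) * (b ^ (3 / 2 : ℝ) * w ^ (-(2 * s))) := by
      rw [mul_left_comm, ← Real.rpow_add hw]; simp
    have p3 : 0 ≤ b ^ (3 / 2 : ℝ) := by positivity
    calc b ^ (3 / 2 : ℝ) = w ^ (2 * s) * (b ^ (3 / 2 : ℝ) * w ^ (-(2 * s))) := h3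
      _ ≤ w ^ (2 * s) * (b ^ (3 / 2 : ℝ) * b ^ (1 / 2 : ℝ)) := by gcongr
      _ = w ^ (2 * s) * b ^ 2 := by rw [h2]
      _ ≤ _ := by linarith

/-- After passing to norms in time the phases are gone, so this crude bound replaces the inner phase
sum. Any two of the three frequencies are independent variables, so it suffices that `∑ b^{3/2}`
converges, which follows from weighted `ℓ²` summability once `6s > 1`. -/
lemma tsum_trilinear_le {s : ℝ} (b : ℤ → ℝ≥0) (q : ℤ) :
    ∑' x : ℤ, ∑' z : ℤ, ENNReal.ofReal (b x * b (x + z - q) * b z) ≤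
      3 * (∑' k : ℤ, ENNReal.ofReal (jb k ^ (2 * s) * (b k : ℝ) ^ 2) + jbSum (6 * s)) ^ 2 := by
  set g : ℤ → ℝ≥0∞ := fun k => ENNReal.ofReal ((b k : ℝ) ^ (3 / 2 : ℝ)) with hg
  have hsum : ∑' k, g k ≤
      ∑' k : ℤ, ENNReal.ofReal (jb k ^ (2 * s) * (b k : ℝ) ^ 2) + jbSum (6 * s) := by
    unfold jbSum
    rw [← ENNReal.tsum_add]
    refine ENNReal.tsum_le_tsum fun k => ?_
    rw [← ENNReal.ofReal_add (mul_nonneg (jb_rpow_pos _ _).le (sq_nonneg _)) (jb_rpow_pos _ _).le]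
    exact ENNReal.ofReal_le_ofReal (rpow_three_halves_le (b k).2 (jb_pos _))
  have hpt : ∀ x z : ℤ, ENNReal.ofReal (b x * b (x + z - q) * b z) ≤
      g x * g (x + z - q) + g (x + z - q) * g z + g x * g z := by
    intro x z
    have p : ∀ l : ℤ, 0 ≤ (b l : ℝ) ^ (3 / 2 : ℝ) := fun l => by positivity
    simp only [hg, ← ENNReal.ofReal_mul (p _)]
    rw [← ENNReal.ofReal_add (mul_nonneg (p _) (p _)) (mul_nonneg (p _) (p _)),
      ← ENNReal.ofReal_add (add_nonneg (mul_nonneg (p _) (p _)) (mul_nonneg (p _) (p _)))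
        (mul_nonneg (p _) (p _))]
    exact ENNReal.ofReal_le_ofReal (mul_mul_le_rpow_add (b _).2 (b _).2 (b _).2)
  have e1 : ∀ x : ℤ, ∑' z : ℤ, g (x + z - q) = ∑' z, g z := by
    intro x
    rw [← (Equiv.addLeft (x - q)).tsum_eq g]
    refine tsum_congr fun z => ?_
    rw [Equiv.coe_addLeft]
    ring_nf
  have e2 : ∀ z : ℤ, ∑' x : ℤ, g (x + z - q) = ∑' z, g z := by
    intro z
    simp_rw [add_comm _ z]
    exact e1 z
  calc _ ≤ ∑' x : ℤ, ∑' z : ℤ, (g x * g (x + z - q) + g (x + z - q) * g z + g x * g z) :=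
        ENNReal.tsum_le_tsum fun x => ENNReal.tsum_le_tsum fun z => hpt x z
    _ = 3 * (∑' k, g k) ^ 2 := by
        simp_rw [ENNReal.tsum_add]
        rw [ENNReal.tsum_comm (f := fun x z => g (x + z - q) * g z)]
        simp_rw [ENNReal.tsum_mul_left, ENNReal.tsum_mul_right, e1, e2]
        rw [ENNReal.tsum_mul_right, ENNReal.tsum_mul_left]
        ring
    _ ≤ _ := by gcongr

/-- Majorant of the outer sum at fixed output frequency. -/
def fixedMajorant (r : ℝ) (k n m p : ℤ) : ℝ :=
  jb n ^ (-2 : ℝ) * (jb m ^ (-r) + jb p ^ (-r)) +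
    jb m ^ (-2 : ℝ) * (jb n ^ (-r) + jb ((k + n : ℤ) : ℝ) ^ (-r))

/-- For fixed `k` the constant may depend on `k`, and `|k| + |n| + |m| ≤ (|k| + 2) max(|n|, |m|)`
always holds. Only the large case occurs and no nonresonance threshold is needed. -/
lemma resonance_mul_weight_le {α s : ℝ} {k n m p : ℤ} (hα : 1 / 2 < α) (hα' : α ≤ 1)
    (hs0 : 0 ≤ s) (hn : n ≠ 0) (hm : m ≠ 0) :
    (resonance α k n m)⁻¹ ^ 2 * (jb ((k + n : ℤ) : ℝ) ^ (-(2 * s)) * jb p ^ (-(2 * s))) ≤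
      16 * (2 * α * (2 * α - 1))⁻¹ ^ 2 * (|(k : ℝ)| + 2) ^ 2 *
        fixedMajorant (4 * α - 2 + 2 * s) k n m p := by
  have h := fun x r => (jb_rpow_pos x r).le
  have h1 := one_le_abs_intCast hn
  have h2 := one_le_abs_intCast hm
  have hk := abs_nonneg (k : ℝ)
  set C := 16 * (2 * α * (2 * α - 1))⁻¹ ^ 2 * (|(k : ℝ)| + 2) ^ 2
  have hC : 0 ≤ C := by positivity
  have hone : ∀ x : ℝ, jb x ^ (-(2 * s)) ≤ 1 := fun x =>
    Real.rpow_le_one_of_one_le_of_nonpos (one_le_jb _) (by linarith)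
  unfold fixedMajorant
  rcases le_total |(n : ℝ)| |(m : ℝ)| with hnm | hnm
  · have hr := resonance_inv_sq_le_of_large (α := α) (B := |(k : ℝ)| + 2) (k := k) hα hα'
      (by linarith) hn hm (by nlinarith)
    have hy := rpow_neg_mul_rpow_neg_le (one_le_jb (m : ℝ)) (one_le_jb (p : ℝ))
      (by linarith : 0 ≤ 4 * α - 2) (by linarith : 0 ≤ 2 * s)
    calc _ ≤ (C * (jb m ^ (-(4 * α - 2)) * jb n ^ (-2 : ℝ))) * (1 * jb p ^ (-(2 * s))) := by
          refine mul_le_mul hr (mul_le_mul_of_nonneg_right (hone _) (h _ _))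
            (mul_nonneg (h _ _) (h _ _)) (mul_nonneg hC (mul_nonneg (h _ _) (h _ _)))
      _ = C * (jb n ^ (-2 : ℝ) * (jb m ^ (-(4 * α - 2)) * jb p ^ (-(2 * s)))) := by ring
      _ ≤ C * (jb n ^ (-2 : ℝ) *
          (jb m ^ (-(4 * α - 2 + 2 * s)) + jb p ^ (-(4 * α - 2 + 2 * s)))) :=
          mul_le_mul_of_nonneg_left (mul_le_mul_of_nonneg_left hy (h _ _)) hC
      _ ≤ _ := mul_le_mul_of_nonneg_left (le_add_of_nonneg_right
          (mul_nonneg (h _ _) (add_nonneg (h _ _) (h _ _)))) hC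
  · have hr := resonance_inv_sq_le_of_large (α := α) (B := |(k : ℝ)| + 2) (k := k) hα hα'
      (by linarith) hm hn (by nlinarith)
    have hsym : resonance α k n m = resonance α k m n := by
      unfold resonance
      rw [add_right_comm k n m]
      ring
    have hy := rpow_neg_mul_rpow_neg_le (one_le_jb (n : ℝ)) (one_le_jb ((k + n : ℤ) : ℝ))
      (by linarith : 0 ≤ 4 * α - 2) (by linarith : 0 ≤ 2 * s)
    rw [hsym]
    calc _ ≤ (C * (jb n ^ (-(4 * α - 2)) * jb m ^ (-2 : ℝ))) *
          (jb ((k + n : ℤ) : ℝ) ^ (-(2 * s)) * 1) := by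
          refine mul_le_mul hr (mul_le_mul_of_nonneg_left (hone _) (h _ _))
            (mul_nonneg (h _ _) (h _ _)) (mul_nonneg hC (mul_nonneg (h _ _) (h _ _)))
      _ = C * (jb m ^ (-2 : ℝ) *
          (jb n ^ (-(4 * α - 2)) * jb ((k + n : ℤ) : ℝ) ^ (-(2 * s)))) := by ring
      _ ≤ C * (jb m ^ (-2 : ℝ) *
          (jb n ^ (-(4 * α - 2 + 2 * s)) + jb ((k + n : ℤ) : ℝ) ^ (-(4 * α - 2 + 2 * s)))) :=
          mul_le_mul_of_nonneg_left (mul_le_mul_of_nonneg_left hy (h _ _)) hC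
      _ ≤ _ := mul_le_mul_of_nonneg_left (le_add_of_nonneg_left
          (mul_nonneg (h _ _) (add_nonneg (h _ _) (h _ _)))) hC

/-- The bilinear outer sum converges for every fixed output frequency `k`. -/
lemma tsum_bilinear_lt_top {α s c : ℝ} (hα : 1 / 2 < α) (hα' : α ≤ 1) (hc : 0 < c)
    (hs0 : 0 ≤ s) (hr : 1 < 4 * α - 2 + 2 * s) (b : ℤ → ℝ≥0)
    (hb : ∑' k : ℤ, ENNReal.ofReal (jb k ^ (2 * s) * (b k : ℝ) ^ 2) < ∞) (k : ℤ)
    (e : ℤ → ℤ) :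
    ∑' n : ℤ, ∑' m : ℤ, (if c * jb k ^ (2 - 2 * α) ≤ |(n : ℝ)| * |(m : ℝ)| then
        ENNReal.ofReal (|resonance α k n m|⁻¹ * (b (k + n) * b (e n + m))) else 0) < ∞ := by
  set r := 4 * α - 2 + 2 * s
  set C := 16 * (2 * α * (2 * α - 1))⁻¹ ^ 2 * (|(k : ℝ)| + 2) ^ 2 with hC
  have hC0 : 0 ≤ C := by positivity
  set E := ∑' k : ℤ, ENNReal.ofReal (jb k ^ (2 * s) * (b k : ℝ) ^ 2) with hE
  have h := fun x r => (jb_rpow_pos x r).le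
  set g : ℤ → ℝ≥0∞ := fun l => ENNReal.ofReal (jb l ^ (2 * s) * (b l : ℝ) ^ 2) with hg
  have hpt : ∀ n m : ℤ, (if c * jb k ^ (2 - 2 * α) ≤ |(n : ℝ)| * |(m : ℝ)| then
        ENNReal.ofReal (|resonance α k n m|⁻¹ * (b (k + n) * b (e n + m))) else 0) ≤
      ENNReal.ofReal C * (ENNReal.ofReal (jb n ^ (-2 : ℝ)) * (ENNReal.ofReal (jb m ^ (-r)) +
          ENNReal.ofReal (jb ((e n + m : ℤ) : ℝ) ^ (-r))) +
        ENNReal.ofReal (jb m ^ (-2 : ℝ)) * (ENNReal.ofReal (jb n ^ (-r)) +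
          ENNReal.ofReal (jb ((k + n : ℤ) : ℝ) ^ (-r)))) +
      g (k + n) * g (e n + m) := by
    intro n m
    split_ifs with hadm
    swap
    · exact zero_le
    obtain ⟨hn, hm⟩ := ne_zero_of_admissible hc hadm
    have h1 := resonance_mul_weight_le (k := k) (p := e n + m) hα hα' hs0 hn hm
    rw [← ENNReal.ofReal_add (h _ _) (h _ _), ← ENNReal.ofReal_add (h _ _) (h _ _),
      ← ENNReal.ofReal_mul (h _ _), ← ENNReal.ofReal_mul (h _ _),
      ← ENNReal.ofReal_add (mul_nonneg (h _ _) (add_nonneg (h _ _) (h _ _)))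
        (mul_nonneg (h _ _) (add_nonneg (h _ _) (h _ _))), ← ENNReal.ofReal_mul hC0, hg,
      ← ENNReal.ofReal_mul (mul_nonneg (h _ _) (sq_nonneg _)),
      ← ENNReal.ofReal_add (mul_nonneg hC0 (add_nonneg
        (mul_nonneg (h _ _) (add_nonneg (h _ _) (h _ _)))
        (mul_nonneg (h _ _) (add_nonneg (h _ _) (h _ _)))))
        (mul_nonneg (mul_nonneg (h _ _) (sq_nonneg _)) (mul_nonneg (h _ _) (sq_nonneg _)))]
    refine ENNReal.ofReal_le_ofReal ?_
    refine le_trans ?_ (add_le_add_left h1 _)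
    set u := jb ((k + n : ℤ) : ℝ)
    set v := jb ((e n + m : ℤ) : ℝ)
    have hu : 0 < u := jb_pos _
    have hv : 0 < v := jb_pos _
    have eu : u ^ (2 * s) * u ^ (-(2 * s)) = 1 := by rw [← Real.rpow_add hu]; simp
    have ev : v ^ (2 * s) * v ^ (-(2 * s)) = 1 := by rw [← Real.rpow_add hv]; simp
    have h6 : (resonance α k n m)⁻¹ ^ 2 = |resonance α k n m|⁻¹ ^ 2 := by
      rw [inv_pow, inv_pow, sq_abs]
    rw [h6]
    set ρ := |resonance α k n m|⁻¹
    set x := (b (k + n) : ℝ)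
    set y := (b (e n + m) : ℝ)
    have hx : 0 ≤ x := (b (k + n)).2
    have hy : 0 ≤ y := (b (e n + m)).2
    set U := u ^ (s) with hU
    set V := v ^ (s) with hV
    have hU0 : 0 < U := by positivity
    have hV0 : 0 < V := by positivity
    have e1 : u ^ (2 * s) = U ^ 2 := by
      rw [hU, ← Real.rpow_natCast, ← Real.rpow_mul hu.le]; push_cast; ring_nf
    have e2 : v ^ (2 * s) = V ^ 2 := by
      rw [hV, ← Real.rpow_natCast, ← Real.rpow_mul hv.le]; push_cast; ring_nf
    have e3 : u ^ (-(2 * s)) = U⁻¹ ^ 2 := by rw [Real.rpow_neg hu.le, e1, inv_pow]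
    have e4 : v ^ (-(2 * s)) = V⁻¹ ^ 2 := by rw [Real.rpow_neg hv.le, e2, inv_pow]
    rw [e1, e2, e3, e4]
    -- The weights are distributed so that the inequality of arithmetic and geometric means
    -- separates the denominator from the functions.
    have e5 : ρ * (x * y) = (ρ * U⁻¹ * V⁻¹) * (U * x * (V * y)) := by field_simp
    rw [e5]
    nlinarith [sq_nonneg (ρ * U⁻¹ * V⁻¹ - U * x * (V * y)), sq_nonneg (ρ * U⁻¹ * V⁻¹),
      sq_nonneg (U * x * (V * y))]
  have e1 : ∀ n : ℤ, ∑' m : ℤ, g (e n + m) = E := fun n => (Equiv.addLeft (e n)).tsum_eq g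
  have e2 : ∑' n : ℤ, g (k + n) = E := (Equiv.addLeft k).tsum_eq g
  calc _ ≤ _ := ENNReal.tsum_le_tsum fun n => ENNReal.tsum_le_tsum fun m => hpt n m
    _ = ENNReal.ofReal C * (jbSum 2 * (jbSum r + jbSum r) + jbSum 2 * (jbSum r + jbSum r)) +
        E * E := by
        simp_rw [ENNReal.tsum_add, ENNReal.tsum_mul_left, ENNReal.tsum_add,
          ENNReal.tsum_mul_left, ENNReal.tsum_mul_right, ENNReal.tsum_add, tsum_jb_add, e1,
          ENNReal.tsum_mul_right, e2, ENNReal.tsum_mul_left, ENNReal.tsum_add, tsum_jb_add]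
        rfl
    _ < ∞ := by
        have j1 : jbSum r ≠ ∞ := (jbSum_lt_top hr).ne
        have j2 : jbSum 2 ≠ ∞ := (jbSum_lt_top (by norm_num)).ne
        have j3 := hb.ne
        finiteness

lemma tsum_freq1_lt_top {α s c : ℝ} (hα : 1 / 2 < α) (hα' : α ≤ 1) (hc : 0 < c)
    (hs0 : 1 / 4 < s) (hr : 1 < 4 * α - 2 + 2 * s) (b : ℤ → ℝ≥0)
    (hb : ∑' k : ℤ, ENNReal.ofReal (jb k ^ (2 * s) * (b k : ℝ) ^ 2) < ∞) (k : ℤ) :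
    ∑' κ : freq1 α c k, ENNReal.ofReal (|den1 α k κ|⁻¹ * ∏ i, (b ((κ : Fin 5 → ℤ) i) : ℝ)) < ∞ := by
  set M := 3 * (∑' k : ℤ, ENNReal.ofReal (jb k ^ (2 * s) * (b k : ℝ) ^ 2) + jbSum (6 * s)) ^ 2
  have hM : M < ∞ := by
    have j1 : jbSum (6 * s) ≠ ∞ := (jbSum_lt_top (by linarith)).ne
    have j2 := hb.ne
    simp only [M]
    finiteness
  calc _ ≤ ∑' n : ℤ, ∑' m : ℤ, (if c * jb k ^ (2 - 2 * α) ≤ |(n : ℝ)| * |(m : ℝ)| then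
        ENNReal.ofReal (|resonance α k n m|⁻¹ * (b (k + n) * b (k + n + m))) else 0) *
        ∑' x : ℤ, ∑' z : ℤ, ENNReal.ofReal (b x * b (x + z - (k + m)) * b z) := by
        refine tsum_le_tsum_quadruple (fun κ : freq1 α c k => coord1 k κ) (coord1_injective α c k)
          (A := fun n m => if c * jb k ^ (2 - 2 * α) ≤ |(n : ℝ)| * |(m : ℝ)| then
            ENNReal.ofReal (|resonance α k n m|⁻¹ * (b (k + n) * b (k + n + m))) else 0)
          (B := fun n m x z => ENNReal.ofReal (b x * b (x + z - (k + m)) * b z)) ?_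
        rintro ⟨κ, hmem⟩
        obtain ⟨hκ, hadm⟩ := mem_freq1.1 hmem
        have hif : c * jb k ^ (2 - 2 * α) ≤
            |((coord1 k κ).1 : ℝ)| * |((coord1 k κ).2.1 : ℝ)| := hadm
        rw [if_pos hif]
        simp only [coord1]
        rw [← ENNReal.ofReal_mul (by positivity)]
        refine ENNReal.ofReal_le_ofReal (le_of_eq ?_)
        rw [den1_eq, Fin.prod_univ_five, show k + (κ 0 - k) = κ 0 by ring,
          show κ 0 + (κ 1 - κ 0) = κ 1 by ring,
          show κ 2 + κ 4 - (k + (κ 1 - κ 0)) = κ 3 by linarith]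
        ring
    _ ≤ ∑' n : ℤ, ∑' m : ℤ, (if c * jb k ^ (2 - 2 * α) ≤ |(n : ℝ)| * |(m : ℝ)| then
        ENNReal.ofReal (|resonance α k n m|⁻¹ * (b (k + n) * b (k + n + m))) else 0) * M := by
        refine ENNReal.tsum_le_tsum fun n => ENNReal.tsum_le_tsum fun m => ?_
        exact mul_le_mul_right (tsum_trilinear_le b _) _
    _ < ∞ := by
        simp_rw [ENNReal.tsum_mul_right]
        exact ENNReal.mul_lt_top (tsum_bilinear_lt_top hα hα' hc (by linarith) hr b hb k
          (fun n => k + n)) hM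

lemma tsum_freq2_lt_top {α s c : ℝ} (hα : 1 / 2 < α) (hα' : α ≤ 1) (hc : 0 < c)
    (hs0 : 1 / 4 < s) (hr : 1 < 4 * α - 2 + 2 * s) (b : ℤ → ℝ≥0)
    (hb : ∑' k : ℤ, ENNReal.ofReal (jb k ^ (2 * s) * (b k : ℝ) ^ 2) < ∞) (k : ℤ) :
    ∑' κ : freq2 α c k, ENNReal.ofReal (|den2 α k κ|⁻¹ * ∏ i, (b ((κ : Fin 5 → ℤ) i) : ℝ)) < ∞ := by
  set M := 3 * (∑' k : ℤ, ENNReal.ofReal (jb k ^ (2 * s) * (b k : ℝ) ^ 2) + jbSum (6 * s)) ^ 2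
  have hM : M < ∞ := by
    have j1 : jbSum (6 * s) ≠ ∞ := (jbSum_lt_top (by linarith)).ne
    have j2 := hb.ne
    simp only [M]
    finiteness
  calc _ ≤ ∑' n : ℤ, ∑' m : ℤ, (if c * jb k ^ (2 - 2 * α) ≤ |(n : ℝ)| * |(m : ℝ)| then
        ENNReal.ofReal (|resonance α k n m|⁻¹ * (b (k + n) * b (k + m))) else 0) *
        ∑' x : ℤ, ∑' z : ℤ, ENNReal.ofReal (b x * b (x + z - (k + n + m)) * b z) := by
        refine tsum_le_tsum_quadruple (fun κ : freq2 α c k => coord2 k κ) (coord2_injective α c k)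
          (A := fun n m => if c * jb k ^ (2 - 2 * α) ≤ |(n : ℝ)| * |(m : ℝ)| then
            ENNReal.ofReal (|resonance α k n m|⁻¹ * (b (k + n) * b (k + m))) else 0)
          (B := fun n m x z => ENNReal.ofReal (b x * b (x + z - (k + n + m)) * b z)) ?_
        rintro ⟨κ, hmem⟩
        obtain ⟨hκ, hadm⟩ := mem_freq2.1 hmem
        have hadm' : c * jb k ^ (2 - 2 * α) ≤
            |((κ 0 - k : ℤ) : ℝ)| * |((κ 2 - k : ℤ) : ℝ)| := by
          rw [← abs_neg ((κ 2 - k : ℤ) : ℝ), ← Int.cast_neg, neg_sub]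
          exact hadm
        have hif : c * jb k ^ (2 - 2 * α) ≤
            |((coord2 k κ).1 : ℝ)| * |((coord2 k κ).2.1 : ℝ)| := hadm'
        rw [if_pos hif]
        simp only [coord2]
        rw [← ENNReal.ofReal_mul (by positivity)]
        refine ENNReal.ofReal_le_ofReal (le_of_eq ?_)
        rw [den2_eq, Fin.prod_univ_five, show k + (κ 0 - k) = κ 0 by ring,
          show k + (κ 2 - k) = κ 2 by ring,
          show κ 1 + κ 3 - (κ 0 + (κ 2 - k)) = κ 4 by linarith]
        ring
    _ ≤ ∑' n : ℤ, ∑' m : ℤ, (if c * jb k ^ (2 - 2 * α) ≤ |(n : ℝ)| * |(m : ℝ)| then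
        ENNReal.ofReal (|resonance α k n m|⁻¹ * (b (k + n) * b (k + m))) else 0) * M := by
        refine ENNReal.tsum_le_tsum fun n => ENNReal.tsum_le_tsum fun m => ?_
        exact mul_le_mul_right (tsum_trilinear_le b _) _
    _ < ∞ := by
        simp_rw [ENNReal.tsum_mul_right]
        exact ENNReal.mul_lt_top (tsum_bilinear_lt_top hα hα' hc (by linarith) hr b hb k
          (fun _ => k)) hM

/-! ### Cauchy–Schwarz and convolutions of weighted functions -/

lemma lintegral_sq_le_mul {X : Type*} [MeasurableSpace X] {μ : Measure X} {h u v : X → ℝ≥0∞}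
    (hu : AEMeasurable u μ) (hv : AEMeasurable v μ) (hh : ∀ x, h x ^ 2 ≤ u x * v x) :
    (∫⁻ x, h x ∂μ) ^ 2 ≤ (∫⁻ x, u x ∂μ) * ∫⁻ x, v x ∂μ := by
  have hsq : ∀ t : ℝ≥0∞, (t ^ (1 / 2 : ℝ)) ^ (2 : ℝ) = t := fun t => by
    rw [← ENNReal.rpow_mul]; norm_num
  have hpt : ∀ x, h x ≤ u x ^ (1 / 2 : ℝ) * v x ^ (1 / 2 : ℝ) := by
    intro x
    rw [← ENNReal.mul_rpow_of_nonneg _ _ (by norm_num)]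
    calc h x = (h x ^ 2) ^ (1 / 2 : ℝ) := by
          rw [← ENNReal.rpow_natCast, ← ENNReal.rpow_mul]; norm_num
      _ ≤ _ := ENNReal.rpow_le_rpow (hh x) (by norm_num)
  have hcs := ENNReal.lintegral_mul_le_Lp_mul_Lq μ Real.HolderConjugate.two_two
    (hu.pow_const (1 / 2 : ℝ)) (hv.pow_const (1 / 2 : ℝ))
  simp only [hsq] at hcs
  calc (∫⁻ x, h x ∂μ) ^ 2
      ≤ ((∫⁻ x, u x ∂μ) ^ (1 / 2 : ℝ) * (∫⁻ x, v x ∂μ) ^ (1 / 2 : ℝ)) ^ 2 := by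
        gcongr
        exact (lintegral_mono hpt).trans hcs
    _ = _ := by
        rw [mul_pow, ← ENNReal.rpow_natCast, ← ENNReal.rpow_natCast]
        norm_num [hsq]

lemma tsum_sq_le_mul {ι : Type*} {h u v : ι → ℝ≥0∞} (hh : ∀ i, h i ^ 2 ≤ u i * v i) :
    (∑' i, h i) ^ 2 ≤ (∑' i, u i) * ∑' i, v i := by
  let _ : MeasurableSpace ι := ⊤
  have := lintegral_sq_le_mul (μ := Measure.count) (measurable_from_top (f := u)).aemeasurable
    (measurable_from_top (f := v)).aemeasurable hh
  simpa only [lintegral_count] using this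

/-- The integral of `⟨x⟩^{-r}` over the real line. -/
def jbInt (r : ℝ) : ℝ≥0∞ := ∫⁻ x : ℝ, ENNReal.ofReal (jb x ^ (-r))

lemma jbInt_lt_top {r : ℝ} (hr : 1 < r) : jbInt r < ∞ := lintegral_jb_lt_top hr

/-- The larger of `⟨x⟩`, `⟨z⟩` is at least `⟨x+z⟩/2` and pays for the exponent `r`; what is left of
its exponent is moved to the smaller one. -/
lemma jb_rpow_mul_le {x z p q r : ℝ} (hr : 0 ≤ r) (hr1 : r ≤ 1) (hrp : r ≤ p) (hrq : r ≤ q) :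
    jb x ^ (-p) * jb z ^ (-q) ≤
      2 * jb (x + z) ^ (-r) * (jb x ^ (-(p + q - r)) + jb z ^ (-(p + q - r))) := by
  have h2 : (2 : ℝ) ^ r ≤ 2 := by
    calc (2 : ℝ) ^ r ≤ 2 ^ (1 : ℝ) := Real.rpow_le_rpow_of_exponent_le (by norm_num) hr1
      _ = 2 := by norm_num
  have key : ∀ {x z p q : ℝ}, r ≤ p → r ≤ q → jb z ≤ jb x → jb x ^ (-p) * jb z ^ (-q) ≤
      2 * jb (x + z) ^ (-r) * jb z ^ (-(p + q - r)) := by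
    intro x z p q hrp hrq hzx
    have p1 := jb_rpow_pos (x + z) (-r)
    have p2 := jb_rpow_pos z (-q)
    have h1 : jb x ^ (-r) ≤ 2 * jb (x + z) ^ (-r) := by
      refine (rpow_neg_le_of_le_mul (jb_pos (x + z)) (jb_pos x) two_pos hr ?_).trans (by gcongr)
      linarith [jb_add_le x z]
    have h3 : jb x ^ (-(p - r)) ≤ jb z ^ (-(p - r)) :=
      Real.rpow_le_rpow_of_nonpos (jb_pos z) hzx (by linarith)
    have p3 := jb_rpow_pos x (-(p - r))
    calc jb x ^ (-p) * jb z ^ (-q) = jb x ^ (-r) * jb x ^ (-(p - r)) * jb z ^ (-q) := by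
          rw [← Real.rpow_add (jb_pos _)]; ring_nf
      _ ≤ (2 * jb (x + z) ^ (-r)) * jb z ^ (-(p - r)) * jb z ^ (-q) := by gcongr
      _ = _ := by rw [mul_assoc, ← Real.rpow_add (jb_pos _)]; ring_nf
  have p1 := jb_rpow_pos (x + z) (-r)
  have p4 := jb_rpow_pos x (-(p + q - r))
  have p5 := jb_rpow_pos z (-(p + q - r))
  rcases le_total (jb z) (jb x) with h | h
  · refine (key hrp hrq h).trans ?_
    gcongr
    linarith
  · rw [mul_comm, add_comm x z]
    refine (key hrq hrp h).trans ?_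
    rw [add_comm q p, add_comm z x]
    gcongr
    linarith

lemma lintegral_jb_mul_jb_le {p q r : ℝ} (ω ω' τ : ℝ) (hr : 0 ≤ r) (hr1 : r ≤ 1) (hrp : r ≤ p)
    (hrq : r ≤ q) :
    ∫⁻ y : ℝ, ENNReal.ofReal (jb (y - ω) ^ (-p)) * ENNReal.ofReal (jb (-y + τ - ω') ^ (-q)) ≤
      4 * jbInt (p + q - r) * ENNReal.ofReal (jb (τ - (ω + ω')) ^ (-r)) := by
  have hpt : ∀ y : ℝ, ENNReal.ofReal (jb (y - ω) ^ (-p)) *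
      ENNReal.ofReal (jb (-y + τ - ω') ^ (-q)) ≤
      ENNReal.ofReal (2 * jb (τ - (ω + ω')) ^ (-r)) *
        (ENNReal.ofReal (jb (y - ω) ^ (-(p + q - r))) +
          ENNReal.ofReal (jb (y - (τ - ω')) ^ (-(p + q - r)))) := by
    intro y
    have h := fun x r => (jb_rpow_pos x r).le
    rw [← ENNReal.ofReal_mul (h _ _), ← ENNReal.ofReal_add (h _ _) (h _ _),
      ← ENNReal.ofReal_mul (mul_nonneg (by norm_num) (h _ _))]
    refine ENNReal.ofReal_le_ofReal ?_
    have := jb_rpow_mul_le (x := y - ω) (z := -y + τ - ω') hr hr1 hrp hrq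
    rw [show y - ω + (-y + τ - ω') = τ - (ω + ω') by ring] at this
    rw [show y - (τ - ω') = -(-y + τ - ω') by ring, jb_neg]
    exact this
  refine (lintegral_mono hpt).trans (le_of_eq ?_)
  rw [lintegral_const_mul _ (by fun_prop), lintegral_add_left (by fun_prop),
    lintegral_sub_right_eq_self (fun y => ENNReal.ofReal (jb y ^ (-(p + q - r)))),
    lintegral_sub_right_eq_self (fun y => ENNReal.ofReal (jb y ^ (-(p + q - r)))),
    ENNReal.ofReal_mul (by norm_num), ENNReal.ofReal_ofNat, ← two_mul]
  change _ * (2 * jbInt _) = _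
  ring

/-- `f` is dominated by the square root of `⟨τ - ω⟩^{-γ}` times a function of integral at
most `A`. -/
def WeightBound (f : ℝ → ℝ≥0∞) (ω γ : ℝ) (A : ℝ≥0∞) : Prop :=
  ∃ P : ℝ → ℝ≥0∞, Measurable P ∧ ∫⁻ τ, P τ ≤ A ∧
    ∀ τ, f τ ^ 2 ≤ ENNReal.ofReal (jb (τ - ω) ^ (-γ)) * P τ

lemma lintegral_lconvolution {f g : ℝ → ℝ≥0∞} (hf : Measurable f) (hg : Measurable g) :
    ∫⁻ τ, (f ⋆ₗ g) τ = (∫⁻ τ, f τ) * ∫⁻ τ, g τ := by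
  simp only [lconvolution_def]
  rw [lintegral_lintegral_swap (by fun_prop)]
  have : ∀ y : ℝ, ∫⁻ τ, f y * g (-y + τ) = f y * ∫⁻ τ, g τ := by
    intro y
    rw [lintegral_const_mul _ (by fun_prop), lintegral_add_left_eq_self g (-y)]
  simp_rw [this]
  rw [lintegral_mul_const _ hf]

/-- Cauchy–Schwarz in the convolution integral: the two weights integrate to a weight centred at `ω
+ ω'`, and the integral of `P ⋆ₗ Q` is the product of the integrals. The constant is finite when `p
+ q - r > 1`. -/
lemma WeightBound.lconvolution {f g : ℝ → ℝ≥0∞} {ω ω' p q r : ℝ} {A A' : ℝ≥0∞}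
    (hf : WeightBound f ω p A) (hg : WeightBound g ω' q A') (hr : 0 ≤ r) (hr1 : r ≤ 1)
    (hrp : r ≤ p) (hrq : r ≤ q) :
    WeightBound (f ⋆ₗ g) (ω + ω') r (4 * jbInt (p + q - r) * (A * A')) := by
  obtain ⟨P, hPm, hPA, hP⟩ := hf
  obtain ⟨Q, hQm, hQA, hQ⟩ := hg
  refine ⟨fun τ => 4 * jbInt (p + q - r) * (P ⋆ₗ Q) τ, by fun_prop, ?_, fun τ => ?_⟩
  · rw [lintegral_const_mul _ (by fun_prop), lintegral_lconvolution hPm hQm]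
    gcongr
  · have h1 := lintegral_sq_le_mul (μ := (volume : Measure ℝ))
      (h := fun y => f y * g (-y + τ))
      (u := fun y => ENNReal.ofReal (jb (y - ω) ^ (-p)) *
        ENNReal.ofReal (jb (-y + τ - ω') ^ (-q)))
      (v := fun y => P y * Q (-y + τ)) (by fun_prop) (by fun_prop) (by
        intro y
        rw [mul_pow, mul_mul_mul_comm]
        exact mul_le_mul' (hP y) (hQ (-y + τ)))
    rw [lconvolution_def]
    refine h1.trans ?_
    calc _ ≤ (4 * jbInt (p + q - r) * ENNReal.ofReal (jb (τ - (ω + ω')) ^ (-r))) *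
          (P ⋆ₗ Q) τ := by
          gcongr
          · exact lintegral_jb_mul_jb_le ω ω' τ hr hr1 hrp hrq
          · rfl
      _ = _ := by ring

lemma weightBound_of_measurable {f : ℝ → ℝ≥0∞} (hf : Measurable f) (ω b : ℝ) :
    WeightBound f ω (2 * b)
      (∫⁻ τ, (ENNReal.ofReal (jb (τ - ω) ^ b) * f τ) ^ 2) := by
  refine ⟨_, by fun_prop, le_rfl, fun τ => ?_⟩
  rw [mul_pow, ← mul_assoc, ← ENNReal.ofReal_pow (jb_rpow_pos _ _).le,
    ← ENNReal.ofReal_mul (jb_rpow_pos _ _).le, ← Real.rpow_natCast, ← Real.rpow_mul (jb_pos _).le,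
    ← Real.rpow_add (jb_pos _)]
  have : -(2 * b) + b * ((2 : ℕ) : ℝ) = 0 := by push_cast; ring
  rw [this]
  simp

/-- The convolution of five functions. -/
def conv5 (f : Fin 5 → ℝ → ℝ≥0∞) : ℝ → ℝ≥0∞ :=
  (((f 0 ⋆ₗ f 1) ⋆ₗ f 2) ⋆ₗ f 3) ⋆ₗ f 4

lemma lconvolution_mono {f f' g g' : ℝ → ℝ≥0∞} (hf : ∀ τ, f τ ≤ f' τ) (hg : ∀ τ, g τ ≤ g' τ)
    (τ : ℝ) : (f ⋆ₗ g) τ ≤ (f' ⋆ₗ g') τ :=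
  lintegral_mono fun _ => mul_le_mul' (hf _) (hg _)

lemma measurable_conv5 {f : Fin 5 → ℝ → ℝ≥0∞} (h : ∀ i, Measurable (f i)) :
    Measurable (conv5 f) := by
  unfold conv5
  fun_prop

/-- Each convolution lowers the exponent by `2ε`, chosen so that the exponent left for the integral
is `1 + ε` every time. -/
lemma WeightBound.conv3 {f g h : ℝ → ℝ≥0∞} {ω₁ ω₂ ω₃ ε : ℝ} {A₁ A₂ A₃ : ℝ≥0∞} (hε : 0 ≤ ε)
    (hε' : 5 * ε ≤ 1) (hf : WeightBound f ω₁ (1 - ε) A₁) (hg : WeightBound g ω₂ (1 - ε) A₂)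
    (hh : WeightBound h ω₃ (1 - ε) A₃) :
    WeightBound ((f ⋆ₗ g) ⋆ₗ h) (ω₁ + ω₂ + ω₃) (1 - 5 * ε)
      ((4 * jbInt (1 + ε)) ^ 2 * (A₁ * A₂ * A₃)) := by
  have h1 := hf.lconvolution hg (r := 1 - 3 * ε) (by linarith) (by linarith) (by linarith)
    (by linarith)
  have h2 := h1.lconvolution hh (r := 1 - 5 * ε) (by linarith) (by linarith) (by linarith)
    (by linarith)
  convert h2 using 1
  ring_nf

lemma WeightBound.conv5 {f : Fin 5 → ℝ → ℝ≥0∞} {ω : Fin 5 → ℝ} {A : Fin 5 → ℝ≥0∞} {ε : ℝ}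
    (hε : 0 ≤ ε) (hε' : 9 * ε ≤ 1) (hf : ∀ i, WeightBound (f i) (ω i) (1 - ε) (A i)) :
    WeightBound (conv5 f) (∑ i, ω i) (1 - 9 * ε) ((4 * jbInt (1 + ε)) ^ 4 * ∏ i, A i) := by
  have h2 := (hf 0).conv3 hε (by linarith) (hf 1) (hf 2)
  have h3 := h2.lconvolution (hf 3) (r := 1 - 7 * ε) (by linarith) (by linarith) (by linarith)
    (by linarith)
  have h4 := h3.lconvolution (hf 4) (r := 1 - 9 * ε) (by linarith) (by linarith) (by linarith)
    (by linarith)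
  convert h4 using 1
  · rfl
  · rw [Fin.sum_univ_five]
  · rw [Fin.prod_univ_five]
    ring_nf

section Tempered

open Filter Topology
open scoped FourierTransform SchwartzMap Convolution ContDiff

/-! ### Functions acting on Schwartz functions -/

/-- `F` is the Fourier transform of `v` in the sense of tempered distributions, in the
normalization `𝓕 φ ξ = ∫ φ x e^{-2πixξ} dx`. -/
structure TemperedPair (v F : ℝ → ℂ) : Prop where
  integrable_left : ∀ φ : 𝓢(ℝ, ℂ), Integrable (fun t => v t * φ t)
  integrable_right : ∀ φ : 𝓢(ℝ, ℂ), Integrable (fun τ => F τ * φ τ)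
  integral_eq : ∀ φ : 𝓢(ℝ, ℂ), ∫ τ, F τ * φ τ = ∫ t, v t * 𝓕 φ t

/-- A Schwartz function equal to one on the ball of radius `n + 1`. -/
lemma exists_schwartz_eq_one (n : ℕ) :
    ∃ φ : 𝓢(ℝ, ℂ), ∀ t : ℝ, |t| ≤ n + 1 → φ t = 1 := by
  let f : ContDiffBump (0 : ℝ) := ⟨n + 1, n + 2, by positivity, by linarith⟩
  have h1 : HasCompactSupport (fun t => (f t : ℂ)) :=
    f.hasCompactSupport.comp_left (g := fun x : ℝ => (x : ℂ)) (by simp)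
  have h2 : ContDiff ℝ ∞ (fun t => (f t : ℂ)) :=
    Complex.ofRealCLM.contDiff.comp f.contDiff
  refine ⟨h1.toSchwartzMap h2, fun t ht => ?_⟩
  have : f t = 1 := f.one_of_mem_closedBall (by simpa [f] using ht)
  simp [this]

/-- Testing against a Schwartz function equal to one on a large ball recovers local integrability,
and with it the almost everywhere measurability that `IsTimeFourier` does not state separately. -/
lemma locallyIntegrable_of_forall_schwartz {v : ℝ → ℂ}
    (hv : ∀ φ : 𝓢(ℝ, ℂ), Integrable (fun t => v t * φ t)) : LocallyIntegrable v := by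
  rw [locallyIntegrable_iff]
  intro K hK
  obtain ⟨R, hR⟩ := hK.isBounded.subset_closedBall (0 : ℝ)
  obtain ⟨n, hn⟩ := exists_nat_ge R
  obtain ⟨φ, hφ⟩ := exists_schwartz_eq_one n
  refine ((hv φ).integrableOn (s := K)).congr_fun ?_ hK.measurableSet
  intro t ht
  have := hR ht
  simp only [Metric.mem_closedBall, dist_zero_right, Real.norm_eq_abs] at this
  simp only [hφ t (by linarith), mul_one]

lemma TemperedPair.aestronglyMeasurable_left {v F : ℝ → ℂ} (h : TemperedPair v F) :
    AEStronglyMeasurable v :=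
  (locallyIntegrable_of_forall_schwartz h.integrable_left).aestronglyMeasurable

lemma TemperedPair.aestronglyMeasurable_right {v F : ℝ → ℂ} (h : TemperedPair v F) :
    AEStronglyMeasurable F :=
  (locallyIntegrable_of_forall_schwartz h.integrable_right).aestronglyMeasurable

lemma ae_eq_of_forall_schwartz {v w : ℝ → ℂ}
    (hv : ∀ φ : 𝓢(ℝ, ℂ), Integrable (fun t => v t * φ t))
    (hw : ∀ φ : 𝓢(ℝ, ℂ), Integrable (fun t => w t * φ t))
    (h : ∀ φ : 𝓢(ℝ, ℂ), ∫ t, v t * φ t = ∫ t, w t * φ t) : v =ᵐ[volume] w := by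
  refine ae_eq_of_integral_contDiff_smul_eq (locallyIntegrable_of_forall_schwartz hv)
    (locallyIntegrable_of_forall_schwartz hw) ?_
  intro g hg hg'
  have h1 : HasCompactSupport (fun t => (g t : ℂ)) :=
    hg'.comp_left (g := fun x : ℝ => (x : ℂ)) (by simp)
  have h2 : ContDiff ℝ ∞ (fun t => (g t : ℂ)) := Complex.ofRealCLM.contDiff.comp hg
  have := h (h1.toSchwartzMap h2)
  simpa [mul_comm] using this

lemma TemperedPair.congr_right {v F G : ℝ → ℂ} (h : TemperedPair v F) (hFG : F =ᵐ[volume] G) :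
    TemperedPair v G := by
  have e : ∀ φ : 𝓢(ℝ, ℂ), (fun τ => F τ * φ τ) =ᵐ[volume] fun τ => G τ * φ τ := by
    intro φ
    filter_upwards [hFG] with τ hτ
    rw [hτ]
  refine ⟨h.integrable_left, fun φ => (h.integrable_right φ).congr (e φ), fun φ => ?_⟩
  rw [← integral_congr_ae (e φ), h.integral_eq]

lemma TemperedPair.sub {v w F G : ℝ → ℂ} (h : TemperedPair v F) (h' : TemperedPair w G) :
    TemperedPair (fun t => v t - w t) (fun τ => F τ - G τ) := by
  refine ⟨fun φ => ?_, fun φ => ?_, fun φ => ?_⟩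
  · simpa only [sub_mul, Pi.sub_def] using (h.integrable_left φ).sub (h'.integrable_left φ)
  · simpa only [sub_mul, Pi.sub_def] using (h.integrable_right φ).sub (h'.integrable_right φ)
  · simp only [sub_mul]
    rw [integral_sub (h.integrable_right φ) (h'.integrable_right φ),
      integral_sub (h.integrable_left (𝓕 φ)) (h'.integrable_left (𝓕 φ)), h.integral_eq,
      h'.integral_eq]

lemma norm_fourierInv_le (F : ℝ → ℂ) (t : ℝ) : ‖𝓕⁻ F t‖ ≤ ∫ τ, ‖F τ‖ := by
  rw [Real.fourierInv_eq_fourier_neg]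
  exact VectorFourier.norm_fourierIntegral_le_integral_norm _ _ _ _ _

lemma continuous_fourierInv {F : ℝ → ℂ} (hF : Integrable F) : Continuous (𝓕⁻ F) := by
  have h : Continuous (𝓕 F) :=
    VectorFourier.fourierIntegral_continuous Real.continuous_fourierChar
      (by exact continuous_inner) hF
  have e : 𝓕⁻ F = fun t => 𝓕 F (-t) := funext fun t => Real.fourierInv_eq_fourier_neg F t
  rw [e]
  exact h.comp continuous_neg

lemma temperedPair_of_integrable {F : ℝ → ℂ} (hF : Integrable F) : TemperedPair (𝓕⁻ F) F := by
  refine ⟨fun φ => ?_, fun φ => ?_, fun φ => ?_⟩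
  · exact φ.integrable.bdd_mul (continuous_fourierInv hF).aestronglyMeasurable
      (Eventually.of_forall (norm_fourierInv_le F))
  · have hb : ∃ C, ∀ τ, ‖φ τ‖ ≤ C := by
      obtain ⟨C, -, hC⟩ := φ.decay 0 0
      exact ⟨C, fun τ => by simpa using hC τ⟩
    obtain ⟨C, hC⟩ := hb
    exact hF.mul_bdd φ.continuous.aestronglyMeasurable (Eventually.of_forall hC)
  -- The multiplication formula is applied to `F` and `𝓕⁻ φ`; the reflection `t ↦ -t` then exchanges
  -- direct and inverse transforms.
  · have key := VectorFourier.integral_fourierIntegral_smul_eq_flip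
      (L := innerₗ ℝ) (e := Real.fourierChar) (μ := volume) (ν := volume) (f := F)
      (g := fun t => 𝓕⁻ φ t) Real.continuous_fourierChar (by exact continuous_inner) hF
      (𝓕⁻ φ).integrable
    have e1 : ∀ t, 𝓕⁻ F t * 𝓕 φ t = (fun x => 𝓕 F x • (𝓕⁻ φ) x) (-t) := by
      intro t
      have : (𝓕⁻ φ) (-t) = 𝓕 φ t := by
        rw [SchwartzMap.fourierInv_coe, SchwartzMap.fourier_coe,
          Real.fourierInv_eq_fourier_neg, neg_neg]
      simp only [smul_eq_mul]
      rw [Real.fourierInv_eq_fourier_neg, this]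
    refine Eq.trans ?_ ((integral_congr_ae (Eventually.of_forall e1)).trans
      (integral_neg_eq_self (fun x => 𝓕 F x • (𝓕⁻ φ) x) volume)).symm
    refine Eq.trans ?_ key.symm
    refine integral_congr_ae (Eventually.of_forall fun τ => ?_)
    simp only [smul_eq_mul]
    congr 1
    rw [flip_innerₗ]
    change φ τ = (𝓕 (⇑(𝓕⁻ φ : 𝓢(ℝ, ℂ))) : ℝ → ℂ) τ
    have : 𝓕 (𝓕⁻ φ) τ = φ τ := by rw [FourierTransform.fourier_fourierInv_eq]
    rw [← this]
    rfl

/-- Plancherel: `v` and the `L²` inverse transform of `F` define the same tempered distribution,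
hence agree almost everywhere. -/
lemma TemperedPair.eLpNorm_eq {v F : ℝ → ℂ} (h : TemperedPair v F) (hF : MemLp F 2) :
    MemLp v 2 ∧ eLpNorm v 2 = eLpNorm F 2 := by
  set f : Lp ℂ 2 (volume : Measure ℝ) := hF.toLp F with hf
  set g : Lp ℂ 2 (volume : Measure ℝ) := 𝓕⁻ f with hg
  have hgS : ∀ φ : 𝓢(ℝ, ℂ), Integrable (fun t => g t * φ t) := fun φ =>
    (Lp.memLp g).integrable_mul (φ.memLp 2 volume)
  have hvg : v =ᵐ[volume] g := by
    refine ae_eq_of_forall_schwartz h.integrable_left hgS fun ψ => ?_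
    have h1 := h.integral_eq (𝓕⁻ ψ)
    rw [FourierTransform.fourier_fourierInv_eq] at h1
    rw [← h1]
    have h2 := congrArg (fun T : 𝓢'(ℝ, ℂ) => T ψ) (Lp.fourierInv_toTemperedDistribution_eq f)
    simp only [TemperedDistribution.fourierInv_apply, Lp.toTemperedDistribution_apply,
      smul_eq_mul] at h2
    have e1 : ∫ τ, F τ * (𝓕⁻ ψ) τ = ∫ τ, (𝓕⁻ ψ) τ * f τ := by
      refine integral_congr_ae ?_
      filter_upwards [hF.coeFn_toLp] with τ hτ
      rw [hf, hτ, mul_comm]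
    rw [e1, h2]
    simp_rw [mul_comm]
    rfl
  have hv : MemLp v 2 := (Lp.memLp g).ae_eq hvg.symm
  refine ⟨hv, ?_⟩
  rw [eLpNorm_congr_ae hvg]
  have e : ‖g‖ = ‖f‖ := by
    have := Lp.norm_fourier_eq g
    rw [hg, FourierTransform.fourier_fourierInv_eq] at this
    exact this.symm
  have e2 : eLpNorm f 2 volume = eLpNorm F 2 volume := eLpNorm_congr_ae hF.coeFn_toLp
  rw [← e2, ← Lp.enorm_def, ← Lp.enorm_def, enorm_eq_nnnorm, enorm_eq_nnnorm]
  congr 1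
  exact NNReal.eq e

lemma lintegral_enorm_sq_eq {v : ℝ → ℂ} : ∫⁻ t, ‖v t‖ₑ ^ 2 = eLpNorm v 2 ^ 2 := by
  have := eLpNorm_nnreal_pow_eq_lintegral (μ := (volume : Measure ℝ)) (f := v) (p := 2)
    (by norm_num)
  simp only [NNReal.coe_ofNat, ENNReal.coe_ofNat, ENNReal.rpow_ofNat] at this
  exact this.symm

lemma lintegral_enorm_pow_six_eq {v : ℝ → ℂ} : ∫⁻ t, ‖v t‖ₑ ^ 6 = eLpNorm v 6 ^ 6 := by
  have := eLpNorm_nnreal_pow_eq_lintegral (μ := (volume : Measure ℝ)) (f := v) (p := 6)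
    (by norm_num)
  simp only [NNReal.coe_ofNat, ENNReal.coe_ofNat, ENNReal.rpow_ofNat] at this
  exact this.symm

lemma memLp_two_of_lintegral_lt_top {F : ℝ → ℂ} (hF : AEStronglyMeasurable F)
    (h : ∫⁻ τ, ‖F τ‖ₑ ^ 2 < (∞ : ℝ≥0∞)) : MemLp F 2 := by
  refine ⟨hF, ?_⟩
  rw [lintegral_enorm_sq_eq] at h
  exact (ENNReal.pow_lt_top_iff (n := 2)).1 h |>.resolve_right (by norm_num)

/-! ### Products and convolutions -/

/-- Complex convolution on the line. -/
def cconv (F G : ℝ → ℂ) : ℝ → ℂ := F ⋆[ContinuousLinearMap.mul ℂ ℂ] G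

lemma integrable_cconv {F G : ℝ → ℂ} (hF : Integrable F) (hG : Integrable G) :
    Integrable (cconv F G) := hF.integrable_convolution _ hG

lemma fourierInv_cconv {F G : ℝ → ℂ} (hF : Integrable F) (hG : Integrable G) (t : ℝ) :
    𝓕⁻ (cconv F G) t = 𝓕⁻ F t * 𝓕⁻ G t := by
  simp only [Real.fourierInv_eq_fourier_neg]
  exact Real.fourier_mul_convolution_eq hF hG (-t)

lemma enorm_cconv_le (F G : ℝ → ℂ) (τ : ℝ) :
    ‖cconv F G τ‖ₑ ≤ ((fun τ => ‖F τ‖ₑ) ⋆ₗ (fun τ => ‖G τ‖ₑ)) τ := by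
  unfold cconv convolution
  refine (enorm_integral_le_lintegral_enorm _).trans (le_of_eq ?_)
  rw [lconvolution_def]
  refine lintegral_congr fun y => ?_
  simp only [ContinuousLinearMap.mul_apply', enorm_mul]
  rw [sub_eq_neg_add]

end Tempered

section Strichartz

open Filter Topology
open scoped FourierTransform SchwartzMap

/-! ### The `L⁶` bound in time -/

/-- The squared norm of `⟨τ - ω⟩^b F` in `L²`. -/
def wNorm (b ω : ℝ) (F : ℝ → ℂ) : ℝ≥0∞ :=
  ∫⁻ τ, (ENNReal.ofReal (jb (τ - ω) ^ b) * ‖F τ‖ₑ) ^ 2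

/-- The constant in the `L⁶` bound. -/
def sixConst (b : ℝ) : ℝ≥0∞ := (4 * jbInt (1 + (1 - 2 * b))) ^ 2

lemma sixConst_lt_top {b : ℝ} (hb : b < 1 / 2) : sixConst b < ∞ :=
  ENNReal.pow_lt_top (ENNReal.mul_lt_top (by norm_num) (jbInt_lt_top (by linarith)))

lemma one_le_jb_rpow (x : ℝ) {b : ℝ} (hb : 0 ≤ b) : 1 ≤ ENNReal.ofReal (jb x ^ b) := by
  rw [ENNReal.one_le_ofReal]
  exact Real.one_le_rpow (one_le_jb x) hb

lemma lintegral_enorm_sq_le_wNorm {b : ℝ} (hb : 0 ≤ b) (ω : ℝ) (F : ℝ → ℂ) :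
    ∫⁻ τ, ‖F τ‖ₑ ^ 2 ≤ wNorm b ω F := by
  refine lintegral_mono fun τ => ?_
  gcongr
  exact le_mul_of_one_le_left' (one_le_jb_rpow _ hb)

lemma wNorm_mono {b ω : ℝ} {F G : ℝ → ℂ} (h : ∀ τ, ‖F τ‖ₑ ≤ ‖G τ‖ₑ) :
    wNorm b ω F ≤ wNorm b ω G := by
  refine lintegral_mono fun τ => ?_
  gcongr
  exact h τ

/-- The sixth power of the `L⁶` norm of `g = 𝓕⁻ F` is the squared `L²` norm of `g³`, whose transform
is `F * F * F`. The triple convolution carries a weight of exponent `1 - 5(1-2b)`, which is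
nonnegative since `b ≥ 2/5`, so the weight is at most 1. -/
lemma eLpNorm_fourierInv_pow_six_le {F : ℝ → ℂ} (hFm : Measurable F) (hF : Integrable F)
    {b ω : ℝ} (hb : 2 / 5 ≤ b) (hb' : b < 1 / 2) (hA : wNorm b ω F < ∞) :
    eLpNorm (𝓕⁻ F) 6 ^ 6 ≤ sixConst b * wNorm b ω F ^ 3 := by
  set H := cconv (cconv F F) F with hH
  have hFF := integrable_cconv hF hF
  have hHi : Integrable H := integrable_cconv hFF hF
  set f : ℝ → ℝ≥0∞ := fun τ => ‖F τ‖ₑ with hf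
  have hwb : WeightBound f ω (1 - (1 - 2 * b)) (wNorm b ω F) := by
    have := weightBound_of_measurable (f := f) hFm.enorm ω b
    rwa [show 1 - (1 - 2 * b) = 2 * b by ring]
  obtain ⟨P, hPm, hPA, hP⟩ := hwb.conv3 (by linarith) (by linarith) hwb hwb
  have hHle : ∀ τ, ‖H τ‖ₑ ≤ ((f ⋆ₗ f) ⋆ₗ f) τ := fun τ =>
    (enorm_cconv_le _ _ τ).trans
      (lconvolution_mono (fun τ => enorm_cconv_le F F τ) (fun _ => le_rfl) τ)
  have hbd : ∫⁻ τ, ‖H τ‖ₑ ^ 2 ≤ sixConst b * wNorm b ω F ^ 3 := by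
    refine le_trans (lintegral_mono fun τ => ?_) (hPA.trans (le_of_eq ?_))
    · refine (pow_le_pow_left' (hHle τ) 2).trans ((hP τ).trans ?_)
      refine mul_le_of_le_one_left' ?_
      rw [ENNReal.ofReal_le_one]
      exact Real.rpow_le_one_of_one_le_of_nonpos (one_le_jb _) (by linarith)
    · rw [sixConst]; ring
  have hH2 : MemLp H 2 := memLp_two_of_lintegral_lt_top hHi.aestronglyMeasurable
    (hbd.trans_lt (ENNReal.mul_lt_top (sixConst_lt_top hb') (ENNReal.pow_lt_top hA)))
  have hpl := ((temperedPair_of_integrable hHi).eLpNorm_eq hH2).2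
  have e : ∫⁻ t, ‖𝓕⁻ F t‖ₑ ^ 6 = ∫⁻ t, ‖𝓕⁻ H t‖ₑ ^ 2 := by
    refine lintegral_congr fun t => ?_
    rw [hH, fourierInv_cconv hFF hF, fourierInv_cconv hF hF, enorm_mul, enorm_mul]
    ring
  rw [← lintegral_enorm_pow_six_eq, e, lintegral_enorm_sq_eq, hpl, ← lintegral_enorm_sq_eq]
  exact hbd

/-- Truncation to `|τ| ≤ n`. -/
def trunc (F : ℝ → ℂ) (n : ℕ) : ℝ → ℂ := (Metric.closedBall (0 : ℝ) n).indicator F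

lemma measurable_trunc {F : ℝ → ℂ} (hF : Measurable F) (n : ℕ) : Measurable (trunc F n) :=
  hF.indicator Metric.isClosed_closedBall.measurableSet

lemma TemperedPair.integrable_trunc {v F : ℝ → ℂ} (h : TemperedPair v F) (n : ℕ) :
    Integrable (trunc F n) := by
  refine (integrable_indicator_iff Metric.isClosed_closedBall.measurableSet).2 ?_
  exact (locallyIntegrable_of_forall_schwartz h.integrable_right).integrableOn_isCompact
    (isCompact_closedBall _ _)

lemma enorm_trunc_le (F : ℝ → ℂ) (n : ℕ) (τ : ℝ) : ‖trunc F n τ‖ₑ ≤ ‖F τ‖ₑ := by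
  unfold trunc
  exact enorm_indicator_le_enorm_self _ _

lemma enorm_sub_trunc_le (F : ℝ → ℂ) (n : ℕ) (τ : ℝ) : ‖F τ - trunc F n τ‖ₑ ≤ ‖F τ‖ₑ := by
  unfold trunc
  by_cases h : τ ∈ Metric.closedBall (0 : ℝ) n <;> simp [h]

lemma tendsto_wNorm_sub_trunc {F : ℝ → ℂ} (hF : Measurable F) {b ω : ℝ}
    (hA : wNorm b ω F < ∞) :
    Tendsto (fun n => wNorm b ω (fun τ => F τ - trunc F n τ)) atTop (𝓝 0) := by
  have h := tendsto_lintegral_of_dominated_convergence (μ := (volume : Measure ℝ))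
    (F := fun n τ => (ENNReal.ofReal (jb (τ - ω) ^ b) * ‖F τ - trunc F n τ‖ₑ) ^ 2)
    (f := fun _ => 0)
    (fun τ => (ENNReal.ofReal (jb (τ - ω) ^ b) * ‖F τ‖ₑ) ^ 2) (fun n => by
      have := measurable_trunc hF n
      fun_prop) (fun n => Eventually.of_forall fun τ => by
        dsimp only
        gcongr
        exact enorm_sub_trunc_le F n τ) hA.ne (Eventually.of_forall fun τ => by
        refine tendsto_const_nhds.congr' ?_
        obtain ⟨N, hN⟩ := exists_nat_ge |τ|
        filter_upwards [eventually_ge_atTop N] with n hn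
        have : τ ∈ Metric.closedBall (0 : ℝ) n := by
          simpa using hN.trans (by exact_mod_cast hn)
        simp [trunc, this])
  rw [lintegral_zero] at h
  exact h

lemma TemperedPair.sub_trunc {v F : ℝ → ℂ} (h : TemperedPair v F) (n : ℕ) :
    TemperedPair (fun t => v t - 𝓕⁻ (trunc F n) t) (fun τ => F τ - trunc F n τ) :=
  h.sub (temperedPair_of_integrable (h.integrable_trunc n))

/-- For `b < 1/2` the function `F` need not be integrable, so it is truncated. The truncated inverse
transforms converge to `v` in `L²`, hence almost everywhere along a subsequence, and Fatou's lemma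
passes the uniform `L⁶` bound to the limit. -/
lemma TemperedPair.eLpNorm_pow_six_le {v F : ℝ → ℂ} (h : TemperedPair v F) (hF : Measurable F)
    {b ω : ℝ} (hb : 2 / 5 ≤ b) (hb' : b < 1 / 2) (hA : wNorm b ω F < ∞) :
    eLpNorm v 6 ^ 6 ≤ sixConst b * wNorm b ω F ^ 3 := by
  have hb0 : 0 ≤ b := by linarith
  set g : ℕ → ℝ → ℂ := fun n => 𝓕⁻ (trunc F n) with hg
  have hgm : ∀ n, AEStronglyMeasurable (g n) := fun n =>
    (continuous_fourierInv (h.integrable_trunc n)).aestronglyMeasurable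
  have hL2 : Tendsto (fun n => eLpNorm (g n - v) 2) atTop (𝓝 0) := by
    have hsq : ∀ n, eLpNorm (g n - v) 2 ^ 2 ≤ wNorm b ω (fun τ => F τ - trunc F n τ) := by
      intro n
      have hle := lintegral_enorm_sq_le_wNorm hb0 ω (fun τ => F τ - trunc F n τ)
      have hm : MemLp (fun τ => F τ - trunc F n τ) 2 := by
        refine memLp_two_of_lintegral_lt_top
          (hF.sub (measurable_trunc hF n)).aestronglyMeasurable ?_
        exact hle.trans_lt ((wNorm_mono (enorm_sub_trunc_le F n)).trans_lt hA)
      rw [eLpNorm_sub_comm]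
      refine le_trans (le_of_eq ?_) hle
      rw [lintegral_enorm_sq_eq]
      exact congrArg (· ^ 2) ((h.sub_trunc n).eLpNorm_eq hm).2
    have h0 : Tendsto (fun n => eLpNorm (g n - v) 2 ^ 2) atTop (𝓝 0) :=
      tendsto_of_tendsto_of_tendsto_of_le_of_le tendsto_const_nhds
        (tendsto_wNorm_sub_trunc hF hA) (fun _ => zero_le) hsq
    have h1 := (ENNReal.continuous_rpow_const (y := (1 / 2 : ℝ))).tendsto 0 |>.comp h0
    simp only [Function.comp_def, ENNReal.zero_rpow_of_pos (by norm_num : (0 : ℝ) < 1 / 2)] at h1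
    refine h1.congr fun n => ?_
    rw [← ENNReal.rpow_natCast, ← ENNReal.rpow_mul]
    norm_num
  obtain ⟨ns, -, hns⟩ := (tendstoInMeasure_of_tendsto_eLpNorm (by norm_num) hgm
    h.aestronglyMeasurable_left hL2).exists_seq_tendsto_ae
  have hlim := Lp.eLpNorm_lim_le_liminf_eLpNorm (p := 6) (fun n => hgm (ns n)) v hns
  have hgb : ∀ n, eLpNorm (g n) 6 ≤ (sixConst b * wNorm b ω F ^ 3) ^ (6⁻¹ : ℝ) := by
    intro n
    have hw := wNorm_mono (b := b) (ω := ω) (enorm_trunc_le F n)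
    have h1 := eLpNorm_fourierInv_pow_six_le (measurable_trunc hF n) (h.integrable_trunc n)
      hb hb' (hw.trans_lt hA)
    refine (ENNReal.le_rpow_inv_iff (by norm_num)).2 ?_
    rw [ENNReal.rpow_ofNat]
    exact h1.trans (mul_le_mul_right (pow_le_pow_left' hw 3) _)
  have hv : eLpNorm v 6 ≤ (sixConst b * wNorm b ω F ^ 3) ^ (6⁻¹ : ℝ) :=
    hlim.trans (liminf_le_of_le (by isBoundedDefault) fun c hc =>
      (hc.exists.choose_spec).trans (hgb _))
  rwa [ENNReal.le_rpow_inv_iff (by norm_num), ENNReal.rpow_ofNat] at hv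

/-- `v` is a limit in `L⁶` of functions whose Fourier transforms are integrable and dominated
by `E`. -/
structure SixApprox (v : ℝ → ℂ) (E : ℝ → ℝ≥0∞) : Prop where
  memLp : MemLp v 6
  approx : ∀ δ : ℝ≥0∞, δ ≠ 0 → ∃ H : ℝ → ℂ, Integrable H ∧ (∀ τ, ‖H τ‖ₑ ≤ E τ) ∧
    MemLp (𝓕⁻ H) 6 ∧ eLpNorm (fun t => v t - 𝓕⁻ H t) 6 ≤ δ

lemma TemperedPair.sixApprox {v F : ℝ → ℂ} (h : TemperedPair v F) (hF : Measurable F)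
    {b ω : ℝ} (hb : 2 / 5 ≤ b) (hb' : b < 1 / 2) (hA : wNorm b ω F < ∞) :
    SixApprox v (fun τ => ‖F τ‖ₑ) := by
  have hfin : ∀ {w G : ℝ → ℂ}, TemperedPair w G → Measurable G → wNorm b ω G < ∞ →
      MemLp w 6 := by
    intro w G hw hG hGA
    refine ⟨hw.aestronglyMeasurable_left, ?_⟩
    have := (hw.eLpNorm_pow_six_le hG hb hb' hGA).trans_lt
      (ENNReal.mul_lt_top (sixConst_lt_top hb') (ENNReal.pow_lt_top hGA))
    exact (ENNReal.pow_lt_top_iff (n := 6)).1 this |>.resolve_right (by norm_num)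
  refine ⟨hfin h hF hA, fun δ hδ => ?_⟩
  have h0 : Tendsto (fun n => sixConst b * wNorm b ω (fun τ => F τ - trunc F n τ) ^ 3)
      atTop (𝓝 0) := by
    have h1 := ENNReal.Tendsto.const_mul (a := sixConst b)
      ((ENNReal.continuous_pow 3).tendsto 0 |>.comp (tendsto_wNorm_sub_trunc hF hA))
      (Or.inr (sixConst_lt_top hb').ne)
    simpa using h1
  have hδ6 : 0 < δ ^ 6 := by positivity
  obtain ⟨n, hn⟩ := (h0.eventually_lt_const hδ6).exists
  refine ⟨trunc F n, h.integrable_trunc n, enorm_trunc_le F n, ?_, ?_⟩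
  · exact hfin (temperedPair_of_integrable (h.integrable_trunc n)) (measurable_trunc hF n)
      ((wNorm_mono (enorm_trunc_le F n)).trans_lt hA)
  · have h1 := (h.sub_trunc n).eLpNorm_pow_six_le (hF.sub (measurable_trunc hF n)) hb hb'
      ((wNorm_mono (enorm_sub_trunc_le F n)).trans_lt hA)
    exact (ENNReal.pow_le_pow_left_iff (by norm_num)).1 (h1.trans hn.le)

/-- Conjugation in time reflects and conjugates the transform: the inverse transform of the
conjugate of `H(-τ)` is the conjugate of `𝓕⁻ H`. -/
lemma SixApprox.conj {v : ℝ → ℂ} {E : ℝ → ℝ≥0∞} (h : SixApprox v E) :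
    SixApprox (fun t => star (v t)) (fun τ => E (-τ)) := by
  refine ⟨h.memLp.star, fun δ hδ => ?_⟩
  obtain ⟨H, hH, hHE, hH6, hHδ⟩ := h.approx δ hδ
  have e : 𝓕⁻ (fun τ => star (H (-τ))) = fun t => star (𝓕⁻ H t) := by
    ext t
    rw [Real.fourierInv_eq', Real.fourierInv_eq',
      ← integral_neg_eq_self (fun τ => Complex.exp (↑(2 * Real.pi * inner ℝ τ t) * Complex.I) •
        star (H (-τ)))]
    simp only [neg_neg]
    rw [show ∀ z : ℂ, star z = (starRingEnd ℂ) z from fun _ => rfl, ← integral_conj]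
    refine integral_congr_ae (Eventually.of_forall fun τ => ?_)
    simp [← Complex.exp_conj, Complex.conj_ofNat]
  refine ⟨fun τ => star (H (-τ)), (Complex.conjCLE.toContinuousLinearMap.integrable_comp hH.comp_neg), fun τ => by simpa using hHE (-τ), ?_, ?_⟩
  · rw [e]
    exact hH6.star
  · rw [e]
    refine le_trans (le_of_eq ?_) hHδ
    refine eLpNorm_congr_norm_ae (Eventually.of_forall fun t => ?_)
    rw [← star_sub, norm_star]

end Strichartz

section Multilinear

open Filter Topology
open scoped FourierTransform SchwartzMap

/-! ### Products of five functions tested against Schwartz functions -/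

lemma lintegral_prod_mul_le {f : Fin 5 → ℝ → ℂ} {ψ : ℝ → ℂ}
    (hf : ∀ i, AEStronglyMeasurable (f i)) (hψ : AEStronglyMeasurable ψ) :
    ∫⁻ t, ‖(∏ i, f i t) * ψ t‖ₑ ≤ (∏ i, eLpNorm (f i) 6) * eLpNorm ψ 6 := by
  -- Adjoining the test function gives six factors, and Hölder is applied with all exponents equal
  -- to 6.
  let g : Option (Fin 5) → ℝ → ℂ := fun o => o.elim ψ f
  have hg : ∀ o, AEStronglyMeasurable (g o) := by
    rintro (_ | i)
    · exact hψ
    · exact hf i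
  have h := ENNReal.lintegral_prod_norm_pow_le (μ := (volume : Measure ℝ)) Finset.univ
    (f := fun o t => ‖g o t‖ₑ ^ 6) (fun o _ => (hg o).enorm.pow_const 6)
    (p := fun _ => (6⁻¹ : ℝ)) (by simp) (fun _ _ => by norm_num)
  have e : ∀ x : ℝ≥0∞, (x ^ 6) ^ (6⁻¹ : ℝ) = x := by
    intro x
    rw [← ENNReal.rpow_ofNat, ← ENNReal.rpow_mul]
    norm_num
  simp only [e, lintegral_enorm_pow_six_eq, Fintype.prod_option, g, Option.elim] at h
  rw [mul_comm]
  refine le_trans (le_of_eq (lintegral_congr fun t => ?_)) h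
  rw [mul_comm, enorm_mul]
  congr 1
  simp [enorm_eq_nnnorm, nnnorm_prod]

lemma integrable_prod_mul {f : Fin 5 → ℝ → ℂ} {ψ : ℝ → ℂ} (hf : ∀ i, MemLp (f i) 6)
    (hψ : MemLp ψ 6) : Integrable (fun t => (∏ i, f i t) * ψ t) := by
  refine ⟨?_, ?_⟩
  · exact (Finset.aestronglyMeasurable_fun_prod _ fun i _ => (hf i).1).mul hψ.1
  · refine (lintegral_prod_mul_le (fun i => (hf i).1) hψ.1).trans_lt ?_
    exact ENNReal.mul_lt_top (ENNReal.prod_lt_top fun i _ => (hf i).2) hψ.2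

lemma enorm_integral_prod_fourierInv_mul_le {H : Fin 5 → ℝ → ℂ} {E : Fin 5 → ℝ → ℝ≥0∞}
    (hH : ∀ i, Integrable (H i)) (hE : ∀ i τ, ‖H i τ‖ₑ ≤ E i τ) (φ : 𝓢(ℝ, ℂ)) :
    ‖∫ t, (∏ i, 𝓕⁻ (H i) t) * 𝓕 φ t‖ₑ ≤ ∫⁻ τ, conv5 E τ * ‖φ τ‖ₑ := by
  have h1 := integrable_cconv (hH 0) (hH 1)
  have h2 := integrable_cconv h1 (hH 2)
  have h3 := integrable_cconv h2 (hH 3)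
  have h4 := integrable_cconv h3 (hH 4)
  have e : ∀ t, ∏ i, 𝓕⁻ (H i) t =
      𝓕⁻ (cconv (cconv (cconv (cconv (H 0) (H 1)) (H 2)) (H 3)) (H 4)) t := by
    intro t
    rw [fourierInv_cconv h3 (hH 4), fourierInv_cconv h2 (hH 3), fourierInv_cconv h1 (hH 2),
      fourierInv_cconv (hH 0) (hH 1), Fin.prod_univ_five]
  simp only [e]
  rw [← (temperedPair_of_integrable h4).integral_eq]
  refine (enorm_integral_le_lintegral_enorm _).trans (lintegral_mono fun τ => ?_)
  rw [enorm_mul]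
  gcongr
  refine (enorm_cconv_le _ _ τ).trans (lconvolution_mono (fun τ => ?_) (hE 4) τ)
  refine (enorm_cconv_le _ _ τ).trans (lconvolution_mono (fun τ => ?_) (hE 3) τ)
  refine (enorm_cconv_le _ _ τ).trans (lconvolution_mono (fun τ => ?_) (hE 2) τ)
  exact (enorm_cconv_le _ _ τ).trans (lconvolution_mono (hE 0) (hE 1) τ)

/-- The factors with index in `S` are replaced one at a time by approximants with integrable
transforms under the same majorant `E`. Hölder controls each replacement error, and once every
factor is such an inverse transform the bound is the convolution theorem. -/
lemma enorm_integral_prod_mul_le_aux {E : Fin 5 → ℝ → ℝ≥0∞} (φ : 𝓢(ℝ, ℂ))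
    (S : Finset (Fin 5)) : ∀ v : Fin 5 → ℝ → ℂ, (∀ i, MemLp (v i) 6) →
      (∀ i ∈ S, SixApprox (v i) (E i)) →
      (∀ i ∉ S, ∃ H : ℝ → ℂ, Integrable H ∧ (∀ τ, ‖H τ‖ₑ ≤ E i τ) ∧ v i = 𝓕⁻ H) →
      ‖∫ t, (∏ i, v i t) * 𝓕 φ t‖ₑ ≤ ∫⁻ τ, conv5 E τ * ‖φ τ‖ₑ := by
  have hψ : MemLp (𝓕 φ : 𝓢(ℝ, ℂ)) 6 := (𝓕 φ).memLp 6 volume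
  induction S using Finset.induction_on with
  | empty =>
    intro v _ _ hv
    choose H hH hHE hvH using fun i => hv i (Finset.notMem_empty i)
    simp only [hvH]
    exact enorm_integral_prod_fourierInv_mul_le hH hHE φ
  | insert j S hj ih =>
    intro v hv6 hvS hv
    set B := ∫⁻ τ, conv5 E τ * ‖φ τ‖ₑ with hB
    set K : ℝ≥0∞ := (∏ i ∈ Finset.univ \ {j}, eLpNorm (v i) 6) * eLpNorm (𝓕 φ : 𝓢(ℝ, ℂ)) 6
      with hK
    have hKtop : K ≠ ∞ :=
      (ENNReal.mul_lt_top (ENNReal.prod_lt_top fun i _ => (hv6 i).2) hψ.2).ne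
    have key : ∀ δ : ℝ≥0∞, δ ≠ 0 → ‖∫ t, (∏ i, v i t) * 𝓕 φ t‖ₑ ≤ B + δ * K := by
      intro δ hδ
      obtain ⟨H, hH, hHE, hH6, hHδ⟩ := (hvS j (Finset.mem_insert_self j S)).approx δ hδ
      set d : ℝ → ℂ := fun t => v j t - 𝓕⁻ H t with hd
      have hd6 : MemLp d 6 := (hv6 j).sub hH6
      have hupd : ∀ w : ℝ → ℂ, MemLp w 6 → ∀ i, MemLp (Function.update v j w i) 6 := by
        intro w hw i
        by_cases hij : i = j
        · subst hij; simpa using hw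
        · simpa [hij] using hv6 i
      have hprod : ∀ (w : ℝ → ℂ) t, ∏ i, Function.update v j w i t =
          w t * ∏ i ∈ Finset.univ \ {j}, v i t := by
        intro w t
        have e : ∀ i, Function.update v j w i t =
            Function.update (fun i => v i t) j (w t) i := by
          intro i
          by_cases hij : i = j
          · subst hij; simp
          · simp [hij]
        simp only [e]
        exact Finset.prod_update_of_mem (Finset.mem_univ j) _ _
      have hvj : ∀ t, ∏ i, v i t = v j t * ∏ i ∈ Finset.univ \ {j}, v i t := by
        intro t
        rw [← hprod, Function.update_eq_self]
      have hsplit : ∫ t, (∏ i, v i t) * 𝓕 φ t =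
          (∫ t, (∏ i, Function.update v j (𝓕⁻ H) i t) * 𝓕 φ t) +
            ∫ t, (∏ i, Function.update v j d i t) * 𝓕 φ t := by
        rw [← integral_add (integrable_prod_mul (hupd _ hH6) hψ)
          (integrable_prod_mul (hupd _ hd6) hψ)]
        refine integral_congr_ae (Eventually.of_forall fun t => ?_)
        simp only [hprod, hvj, hd]
        ring
      rw [hsplit]
      refine (enorm_add_le _ _).trans (add_le_add ?_ ?_)
      · refine ih _ (hupd _ hH6) (fun i hi => ?_) (fun i hi => ?_)
        · have hij : i ≠ j := fun h => hj (h ▸ hi)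
          simpa [hij] using hvS i (Finset.mem_insert_of_mem hi)
        · by_cases hij : i = j
          · subst hij
            exact ⟨H, hH, hHE, by simp⟩
          · simpa [hij] using hv i (by simp [hij, hi])
      · refine (enorm_integral_le_lintegral_enorm _).trans ?_
        refine (lintegral_prod_mul_le (fun i => (hupd _ hd6 i).1) hψ.1).trans ?_
        have e : ∀ i, eLpNorm (Function.update v j d i) 6 =
            Function.update (fun i => eLpNorm (v i) 6) j (eLpNorm d 6) i := by
          intro i
          by_cases hij : i = j
          · subst hij; simp
          · simp [hij]
        simp only [e]
        rw [Finset.prod_update_of_mem (Finset.mem_univ j), mul_assoc]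
        gcongr
    refine ENNReal.le_of_forall_pos_le_add fun ε hε _ => ?_
    -- Dividing by `K + 1` instead of `K` also covers `K = 0`.
    have hne : (ε : ℝ≥0∞) / (K + 1) ≠ 0 := by
      simp [ENNReal.div_eq_zero_iff, hε.ne', hKtop]
    refine (key _ hne).trans ?_
    gcongr
    calc (ε : ℝ≥0∞) / (K + 1) * K ≤ (ε : ℝ≥0∞) / (K + 1) * (K + 1) := by gcongr; exact le_self_add
      _ ≤ ε := (ENNReal.div_mul_cancel (by simp) (by simp [hKtop])).le

lemma enorm_integral_prod_mul_le {v : Fin 5 → ℝ → ℂ} {E : Fin 5 → ℝ → ℝ≥0∞}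
    (h : ∀ i, SixApprox (v i) (E i)) (φ : 𝓢(ℝ, ℂ)) :
    ‖∫ t, (∏ i, v i t) * 𝓕 φ t‖ₑ ≤ ∫⁻ τ, conv5 E τ * ‖φ τ‖ₑ :=
  enorm_integral_prod_mul_le_aux φ Finset.univ v (fun i => (h i).memLp) (fun i _ => h i)
    (fun i hi => absurd (Finset.mem_univ i) hi)

end Multilinear

section Riesz

open Filter Topology
open scoped FourierTransform SchwartzMap

/-! ### Representation of weighted `L²` functionals -/

lemma hasTemperateGrowth_jb_rpow (ω b : ℝ) :
    (fun τ : ℝ => ((jb (τ - ω) ^ b : ℝ) : ℂ)).HasTemperateGrowth := by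
  have h1 : (fun x : ℝ => (1 + ‖x‖ ^ 2) ^ (b / 2)).HasTemperateGrowth :=
    Function.hasTemperateGrowth_one_add_norm_sq_rpow ℝ (b / 2)
  have h2 : (fun τ : ℝ => τ - ω).HasTemperateGrowth := by fun_prop
  have h3 := h1.comp h2
  have h4 : (fun τ : ℝ => Complex.ofRealCLM ((1 + ‖τ - ω‖ ^ 2) ^ (b / 2))).HasTemperateGrowth :=
    (Complex.ofRealCLM.hasTemperateGrowth).comp h3
  convert h4 using 2 with τ
  simp only [Complex.ofRealCLM_apply, Real.norm_eq_abs, sq_abs, jb]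
  rw [Real.sqrt_eq_rpow, ← Real.rpow_mul (by positivity)]
  congr 2
  ring

/-- Multiplication of Schwartz functions by `⟨τ - ω⟩^b`. -/
def jbMul (ω b : ℝ) : 𝓢(ℝ, ℂ) →L[ℂ] 𝓢(ℝ, ℂ) :=
  SchwartzMap.smulLeftCLM ℂ (fun τ : ℝ => ((jb (τ - ω) ^ b : ℝ) : ℂ))

lemma jbMul_apply (ω b : ℝ) (φ : 𝓢(ℝ, ℂ)) (τ : ℝ) :
    jbMul ω b φ τ = ((jb (τ - ω) ^ b : ℝ) : ℂ) * φ τ := by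
  rw [jbMul, SchwartzMap.smulLeftCLM_apply_apply (hasTemperateGrowth_jb_rpow ω b), smul_eq_mul]

lemma jbMul_neg_jbMul (ω b : ℝ) (φ : 𝓢(ℝ, ℂ)) : jbMul ω (-b) (jbMul ω b φ) = φ := by
  ext τ
  rw [jbMul_apply, jbMul_apply, ← mul_assoc, ← Complex.ofReal_mul,
    ← Real.rpow_add (jb_pos _)]
  simp

lemma enorm_jbMul_apply (ω b : ℝ) (φ : 𝓢(ℝ, ℂ)) (τ : ℝ) :
    ‖jbMul ω b φ τ‖ₑ = ENNReal.ofReal (jb (τ - ω) ^ b) * ‖φ τ‖ₑ := by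
  rw [jbMul_apply, enorm_mul, ← ofReal_norm, Complex.norm_real, Real.norm_eq_abs,
    abs_of_pos (jb_rpow_pos _ _)]

lemma ofReal_jb_rpow_neg_mul (ω b τ : ℝ) :
    ENNReal.ofReal (jb (τ - ω) ^ (-b)) * ENNReal.ofReal (jb (τ - ω) ^ b) = 1 := by
  rw [← ENNReal.ofReal_mul (jb_rpow_pos _ _).le, ← Real.rpow_add (jb_pos _)]
  simp

/-- The functional `ψ ↦ ∫ N 𝓕(⟨· - ω⟩^{-b} ψ)` is bounded on Schwartz functions in the `L²` norm, by
Cauchy–Schwarz against `E`. It extends by density, the Riesz theorem represents it by some `g`, and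
multiplying the conjugate of `g` by `⟨· - ω⟩^b` undoes the weight. -/
lemma exists_temperedPair {N : ℝ → ℂ} (hN : ∀ φ : 𝓢(ℝ, ℂ), Integrable (fun t => N t * φ t))
    {E : ℝ → ℝ≥0∞} (hE : Measurable E) {b ω : ℝ}
    (hbd : ∀ φ : 𝓢(ℝ, ℂ), ‖∫ t, N t * 𝓕 φ t‖ₑ ≤ ∫⁻ τ, E τ * ‖φ τ‖ₑ)
    (hfin : ∫⁻ τ, (ENNReal.ofReal (jb (τ - ω) ^ (-b)) * E τ) ^ 2 < ∞) :
    ∃ G : ℝ → ℂ, TemperedPair N G ∧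
      wNorm (-b) ω G ≤ ∫⁻ τ, (ENNReal.ofReal (jb (τ - ω) ^ (-b)) * E τ) ^ 2 := by
  set B := ∫⁻ τ, (ENNReal.ofReal (jb (τ - ω) ^ (-b)) * E τ) ^ 2 with hB
  let f : 𝓢(ℝ, ℂ) →ₗ[ℂ] ℂ :=
    { toFun := fun ψ => ∫ t, N t * 𝓕 (jbMul ω (-b) ψ) t
      map_add' := fun ψ ψ' => by
        rw [← integral_add (hN _) (hN _)]
        refine integral_congr_ae (Eventually.of_forall fun t => ?_)
        simp only [map_add, FourierTransform.fourier_add, add_apply]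
        ring
      map_smul' := fun c ψ => by
        rw [smul_eq_mul, RingHom.id_apply, ← integral_const_mul]
        refine integral_congr_ae (Eventually.of_forall fun t => ?_)
        simp only [map_smul, FourierTransform.fourier_smul, smul_apply, smul_eq_mul]
        ring }
  let e : 𝓢(ℝ, ℂ) →ₗ[ℂ] Lp ℂ 2 (volume : Measure ℝ) :=
    (SchwartzMap.toLpCLM ℂ ℂ 2 volume).toLinearMap
  have hdense : DenseRange e := SchwartzMap.denseRange_toLpCLM (by norm_num)
  have hsq : ∀ ψ : 𝓢(ℝ, ℂ), ‖f ψ‖ₑ ^ 2 ≤ B * ‖e ψ‖ₑ ^ 2 := by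
    intro ψ
    have h1 := hbd (jbMul ω (-b) ψ)
    have h2 := lintegral_sq_le_mul (μ := (volume : Measure ℝ))
      (h := fun τ => E τ * ‖jbMul ω (-b) ψ τ‖ₑ)
      (u := fun τ => (ENNReal.ofReal (jb (τ - ω) ^ (-b)) * E τ) ^ 2)
      (v := fun τ => ‖ψ τ‖ₑ ^ 2) (by fun_prop) (by fun_prop) (by
        intro τ
        rw [enorm_jbMul_apply]
        exact le_of_eq (by ring))
    have h3 : ∫⁻ τ, ‖ψ τ‖ₑ ^ 2 = ‖e ψ‖ₑ ^ 2 := by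
      rw [lintegral_enorm_sq_eq, Lp.enorm_def]
      exact congrArg (· ^ 2) (eLpNorm_congr_ae (ψ.coeFn_toLp 2 volume)).symm
    rw [h3] at h2
    exact (pow_le_pow_left' h1 2).trans h2
  have hnorm : ∀ ψ : 𝓢(ℝ, ℂ), ‖f ψ‖ ≤ √B.toReal * ‖e ψ‖ := by
    intro ψ
    have h1 := ENNReal.toReal_mono
      (ENNReal.mul_ne_top hfin.ne (ENNReal.pow_ne_top enorm_ne_top)) (hsq ψ)
    simp only [ENNReal.toReal_pow, ENNReal.toReal_mul, toReal_enorm] at h1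
    refine le_of_sq_le_sq ?_ (by positivity)
    rw [mul_pow, Real.sq_sqrt ENNReal.toReal_nonneg]
    exact h1
  let l : StrongDual ℂ (Lp ℂ 2 (volume : Measure ℝ)) := f.extendOfNorm e
  have hl : ∀ ψ, l (e ψ) = f ψ := LinearMap.extendOfNorm_eq hdense ⟨_, hnorm⟩
  have hlnorm : ‖l‖ ≤ √B.toReal :=
    l.opNorm_le_bound (by positivity) (LinearMap.norm_extendOfNorm_apply_le hdense _ hnorm)
  let g : Lp ℂ 2 (volume : Measure ℝ) := (InnerProductSpace.toDual ℂ _).symm l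
  have hg : ∀ h, inner ℂ g h = l h := fun h => InnerProductSpace.toDual_symm_apply
  have hgnorm : ‖g‖ ≤ √B.toReal := by
    rw [show ‖g‖ = ‖l‖ from LinearIsometryEquiv.norm_map _ _]
    exact hlnorm
  have hpt : ∀ φ : 𝓢(ℝ, ℂ), (fun τ => inner ℂ (g τ) (e (jbMul ω b φ) τ)) =ᵐ[volume]
      fun τ => (((jb (τ - ω) ^ b : ℝ) : ℂ) * (starRingEnd ℂ) (g τ)) * φ τ := by
    intro φ
    filter_upwards [(jbMul ω b φ).coeFn_toLp 2 volume] with τ hτ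
    have : e (jbMul ω b φ) τ = ((jb (τ - ω) ^ b : ℝ) : ℂ) * φ τ := by
      rw [← jbMul_apply]
      exact hτ
    rw [this, RCLike.inner_apply]
    ring
  refine ⟨fun τ => ((jb (τ - ω) ^ b : ℝ) : ℂ) * (starRingEnd ℂ) (g τ),
    ⟨hN, fun φ => ?_, fun φ => ?_⟩, ?_⟩
  · exact (L2.integrable_inner g (e (jbMul ω b φ))).congr (hpt φ)
  · rw [← integral_congr_ae (hpt φ), ← L2.inner_def, hg, hl]
    change ∫ t, N t * 𝓕 (jbMul ω (-b) (jbMul ω b φ)) t = _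
    rw [jbMul_neg_jbMul]
  · have e1 : wNorm (-b) ω (fun τ => ((jb (τ - ω) ^ b : ℝ) : ℂ) * (starRingEnd ℂ) (g τ)) =
        ‖g‖ₑ ^ 2 := by
      rw [Lp.enorm_def, ← lintegral_enorm_sq_eq]
      refine lintegral_congr fun τ => ?_
      rw [enorm_mul, RCLike.enorm_conj, ← ofReal_norm ((jb (τ - ω) ^ b : ℝ) : ℂ),
        Complex.norm_real, Real.norm_eq_abs, abs_of_pos (jb_rpow_pos _ _), ← mul_assoc,
        ofReal_jb_rpow_neg_mul, one_mul]
    rw [e1, ← ENNReal.toReal_le_toReal (ENNReal.pow_ne_top enorm_ne_top) hfin.ne,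
      ENNReal.toReal_pow, toReal_enorm]
    calc ‖g‖ ^ 2 ≤ √B.toReal ^ 2 := by gcongr
      _ = B.toReal := Real.sq_sqrt ENNReal.toReal_nonneg

end Riesz

section QuinticSums

open Filter Topology
open scoped FourierTransform SchwartzMap

/-! ### Sums of quintic terms at a fixed output frequency -/

/-- The factors of `quintic`. -/
def quinticFactor (v : ℤ → ℝ → ℂ) (κ : Fin 5 → ℤ) : Fin 5 → ℝ → ℂ :=
  ![v (κ 0), fun t => star (v (κ 1) t), v (κ 2), fun t => star (v (κ 3) t), v (κ 4)]

/-- The moduli of the Fourier transforms of the factors of `quintic`. -/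
def quinticFourier (F : ℤ → ℝ → ℂ) (κ : Fin 5 → ℤ) : Fin 5 → ℝ → ℝ≥0∞ :=
  ![fun τ => ‖F (κ 0) τ‖ₑ, fun τ => ‖F (κ 1) (-τ)‖ₑ, fun τ => ‖F (κ 2) τ‖ₑ,
    fun τ => ‖F (κ 3) (-τ)‖ₑ, fun τ => ‖F (κ 4) τ‖ₑ]

lemma quintic_eq_prod (v : ℤ → ℝ → ℂ) (κ : Fin 5 → ℤ) (t : ℝ) :
    quintic (fun n => v n t) κ = ∏ i, quinticFactor v κ i t := by
  rw [Fin.prod_univ_five]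
  rfl

lemma forall_fin_five {P : Fin 5 → Prop} (h0 : P 0) (h1 : P 1) (h2 : P 2) (h3 : P 3)
    (h4 : P 4) (i : Fin 5) : P i := by
  fin_cases i <;> assumption

lemma sixApprox_quinticFactor {v F : ℤ → ℝ → ℂ}
    (h : ∀ k, SixApprox (v k) (fun τ => ‖F k τ‖ₑ)) (κ : Fin 5 → ℤ) (i : Fin 5) :
    SixApprox (quinticFactor v κ i) (quinticFourier F κ i) :=
  forall_fin_five (P := fun i => SixApprox (quinticFactor v κ i) (quinticFourier F κ i))
    (h (κ 0)) (h (κ 1)).conj (h (κ 2)) (h (κ 3)).conj (h (κ 4)) i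

lemma eLpNorm_quinticFactor (v : ℤ → ℝ → ℂ) (κ : Fin 5 → ℤ) (i : Fin 5) :
    eLpNorm (quinticFactor v κ i) 6 = eLpNorm (v (κ i)) 6 := by
  refine eLpNorm_congr_norm_ae (Eventually.of_forall fun t => ?_)
  fin_cases i <;> simp [quinticFactor]

lemma measurable_quinticFourier {F : ℤ → ℝ → ℂ} (hF : ∀ k, Measurable (F k)) (κ : Fin 5 → ℤ)
    (i : Fin 5) : Measurable (quinticFourier F κ i) :=
  forall_fin_five (P := fun i => Measurable (quinticFourier F κ i)) (hF _).enorm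
    ((hF _).comp measurable_neg).enorm (hF _).enorm ((hF _).comp measurable_neg).enorm
    (hF _).enorm i

lemma WeightBound.comp_neg {f : ℝ → ℝ≥0∞} {ω γ : ℝ} {A : ℝ≥0∞} (h : WeightBound f ω γ A) :
    WeightBound (fun τ => f (-τ)) (-ω) γ A := by
  obtain ⟨P, hPm, hPA, hP⟩ := h
  refine ⟨fun τ => P (-τ), by fun_prop, ?_, fun τ => ?_⟩
  · rwa [lintegral_neg_eq_self P]
  · refine (hP (-τ)).trans (le_of_eq ?_)
    rw [← jb_neg (-τ - ω)]
    ring_nf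

lemma weightBound_conv5_quinticFourier {α b : ℝ} {F : ℤ → ℝ → ℂ} (hF : ∀ k, Measurable (F k))
    (hb : 4 / 9 ≤ b) (hb' : b ≤ 1 / 2) (κ : Fin 5 → ℤ) :
    WeightBound (conv5 (quinticFourier F κ)) (phase α κ) (1 - 9 * (1 - 2 * b))
      ((4 * jbInt (1 + (1 - 2 * b))) ^ 4 * ∏ i, wNorm b (disp α (κ i)) (F (κ i))) := by
  have h : ∀ k, WeightBound (fun τ => ‖F k τ‖ₑ) (disp α k) (1 - (1 - 2 * b))
      (wNorm b (disp α k) (F k)) := by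
    intro k
    rw [show 1 - (1 - 2 * b) = 2 * b by ring]
    exact weightBound_of_measurable (hF k).enorm _ _
  have h5 := WeightBound.conv5 (f := quinticFourier F κ)
    (ω := ![disp α (κ 0), -disp α (κ 1), disp α (κ 2), -disp α (κ 3), disp α (κ 4)])
    (A := fun i => wNorm b (disp α (κ i)) (F (κ i))) (ε := 1 - 2 * b) (by linarith)
    (by linarith) (forall_fin_five (h (κ 0)) (h (κ 1)).comp_neg (h (κ 2)) (h (κ 3)).comp_neg
      (h (κ 4)))
  convert h5 using 1
  rw [Fin.sum_univ_five, phase]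
  change _ = disp α (κ 0) + -disp α (κ 1) + disp α (κ 2) + -disp α (κ 3) + disp α (κ 4)
  ring

variable {S : Set (Fin 5 → ℤ)} {D : (Fin 5 → ℤ) → ℝ} {v F : ℤ → ℝ → ℂ}

/-- The majorant of the Fourier transform of a sum of quintic terms. -/
def quinticMajorant (S : Set (Fin 5 → ℤ)) (D : (Fin 5 → ℤ) → ℝ) (F : ℤ → ℝ → ℂ) (τ : ℝ) :
    ℝ≥0∞ :=
  ∑' κ : S, ENNReal.ofReal |D κ|⁻¹ * conv5 (quinticFourier F κ) τ

lemma measurable_quinticMajorant (hF : ∀ k, Measurable (F k)) :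
    Measurable (quinticMajorant S D F) := by
  refine Measurable.tsum fun κ => ?_
  have := measurable_conv5 (measurable_quinticFourier hF κ)
  fun_prop

lemma enorm_div_ofReal (z : ℂ) (d : ℝ) :
    ‖z / (d : ℂ)‖ₑ = ENNReal.ofReal |d|⁻¹ * ‖z‖ₑ := by
  rw [div_eq_inv_mul, enorm_mul, ← ofReal_norm (d : ℂ)⁻¹, norm_inv, Complex.norm_real,
    Real.norm_eq_abs]

lemma aestronglyMeasurable_quintic (hv : ∀ k, MemLp (v k) 6) (κ : Fin 5 → ℤ) :
    AEStronglyMeasurable (fun t => quintic (fun n => v n t) κ / (D κ : ℂ)) := by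
  have h := fun k => (hv k).1
  unfold quintic
  simp only [div_eq_mul_inv]
  exact ((((((h _).mul (h _).star).mul (h _)).mul (h _).star).mul (h _))).mul_const _

lemma tsum_lintegral_quintic_lt_top (hv : ∀ k, MemLp (v k) 6)
    (hsum : ∑' κ : S, ENNReal.ofReal |D κ|⁻¹ * ∏ i, eLpNorm (v ((κ : Fin 5 → ℤ) i)) 6 < ∞)
    {ψ : ℝ → ℂ} (hψ : MemLp ψ 6) :
    ∑' κ : S, ∫⁻ t, ‖quintic (fun n => v n t) κ / (D κ : ℂ) * ψ t‖ₑ < ∞ := by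
  refine lt_of_le_of_lt ?_ (ENNReal.mul_lt_top hsum hψ.2)
  rw [← ENNReal.tsum_mul_right]
  refine ENNReal.tsum_le_tsum fun κ => ?_
  have hm : ∀ i, AEStronglyMeasurable (quinticFactor v κ i) := by
    have h := fun k => (hv k).1
    exact forall_fin_five (h _) (h _).star (h _) (h _).star (h _)
  have h1 := lintegral_prod_mul_le hm hψ.1
  simp only [eLpNorm_quinticFactor] at h1
  rw [mul_assoc]
  refine le_trans (le_of_eq ?_) (mul_le_mul_right h1 _)
  rw [← lintegral_const_mul' _ _ ENNReal.ofReal_ne_top]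
  refine lintegral_congr fun t => ?_
  rw [enorm_mul, enorm_div_ofReal, quintic_eq_prod, enorm_mul, mul_assoc]

/-- Hölder bounds the series in `L¹` only after multiplication by a function in `L⁶`. Schwartz
cutoffs equal to one on growing balls provide it, and countably many of them cover the line. -/
lemma ae_summable_quintic (hv : ∀ k, MemLp (v k) 6)
    (hsum : ∑' κ : S, ENNReal.ofReal |D κ|⁻¹ * ∏ i, eLpNorm (v ((κ : Fin 5 → ℤ) i)) 6 < ∞) :
    ∀ᵐ t, Summable fun κ : S => quintic (fun n => v n t) κ / (D κ : ℂ) := by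
  choose φ hφ using exists_schwartz_eq_one
  have hae : ∀ n : ℕ, ∀ᵐ t, ∑' κ : S, ‖quintic (fun n => v n t) κ / (D κ : ℂ) * φ n t‖ₑ < ∞ := by
    intro n
    have hm : ∀ κ : S, AEMeasurable
        (fun t => ‖quintic (fun n => v n t) κ / (D κ : ℂ) * φ n t‖ₑ) := fun κ =>
      ((aestronglyMeasurable_quintic hv κ).mul (φ n).continuous.aestronglyMeasurable).enorm
    refine ae_lt_top' (AEMeasurable.tsum hm) ?_
    rw [lintegral_tsum hm]
    exact (tsum_lintegral_quintic_lt_top hv hsum ((φ n).memLp 6 volume)).ne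
  filter_upwards [ae_all_iff.2 hae] with t ht
  obtain ⟨n, hn⟩ := exists_nat_ge |t|
  have h1 := ht n
  simp only [hφ n t (by linarith), mul_one] at h1
  exact Summable.of_enorm h1.ne

lemma integrable_tsum_quintic_mul (hv : ∀ k, MemLp (v k) 6)
    (hsum : ∑' κ : S, ENNReal.ofReal |D κ|⁻¹ * ∏ i, eLpNorm (v ((κ : Fin 5 → ℤ) i)) 6 < ∞)
    (φ : 𝓢(ℝ, ℂ)) :
    Integrable fun t => (∑' κ : S, quintic (fun n => v n t) κ / (D κ : ℂ)) * φ t := by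
  have hm : ∀ κ : S, AEMeasurable
      (fun t => ‖quintic (fun n => v n t) κ / (D κ : ℂ) * φ t‖ₑ) := fun κ =>
    ((aestronglyMeasurable_quintic hv κ).mul φ.continuous.aestronglyMeasurable).enorm
  refine ⟨?_, ?_⟩
  · refine AEStronglyMeasurable.mul ?_ φ.continuous.aestronglyMeasurable
    exact (AEMeasurable.tsum fun κ : S =>
      (aestronglyMeasurable_quintic hv κ).aemeasurable).aestronglyMeasurable
  · refine lt_of_le_of_lt (lintegral_mono fun t => ?_)
      ((lintegral_tsum hm).trans_lt
        (tsum_lintegral_quintic_lt_top hv hsum (φ.memLp 6 volume)))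
    dsimp only
    rw [← tsum_mul_right]
    exact enorm_tsum_le_tsum_enorm

lemma enorm_integral_tsum_quintic_mul_le (hF : ∀ k, Measurable (F k))
    (h : ∀ k, SixApprox (v k) (fun τ => ‖F k τ‖ₑ))
    (hsum : ∑' κ : S, ENNReal.ofReal |D κ|⁻¹ * ∏ i, eLpNorm (v ((κ : Fin 5 → ℤ) i)) 6 < ∞)
    (φ : 𝓢(ℝ, ℂ)) :
    ‖∫ t, (∑' κ : S, quintic (fun n => v n t) κ / (D κ : ℂ)) * 𝓕 φ t‖ₑ ≤
      ∫⁻ τ, quinticMajorant S D F τ * ‖φ τ‖ₑ := by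
  have hv := fun k => (h k).memLp
  simp only [← tsum_mul_right]
  rw [integral_tsum (f := fun (κ : S) t => quintic (fun n => v n t) κ / (D κ : ℂ) * 𝓕 φ t)
    (fun κ => (aestronglyMeasurable_quintic hv κ).mul
      (𝓕 φ).continuous.aestronglyMeasurable)
    (tsum_lintegral_quintic_lt_top hv hsum ((𝓕 φ).memLp 6 volume)).ne]
  refine enorm_tsum_le_tsum_enorm.trans ?_
  have hm := fun κ : Fin 5 → ℤ => measurable_conv5 (measurable_quinticFourier hF κ)
  have e : ∫⁻ τ, quinticMajorant S D F τ * ‖φ τ‖ₑ = ∑' κ : S, ENNReal.ofReal |D κ|⁻¹ *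
      ∫⁻ τ, conv5 (quinticFourier F κ) τ * ‖φ τ‖ₑ := by
    have e1 : ∀ κ : S, ENNReal.ofReal |D κ|⁻¹ * ∫⁻ τ, conv5 (quinticFourier F κ) τ * ‖φ τ‖ₑ =
        ∫⁻ τ, ENNReal.ofReal |D κ|⁻¹ * conv5 (quinticFourier F κ) τ * ‖φ τ‖ₑ := by
      intro κ
      rw [← lintegral_const_mul' _ _ ENNReal.ofReal_ne_top]
      simp only [mul_assoc]
    simp only [e1]
    rw [← lintegral_tsum (fun κ => by have := hm κ; fun_prop)]
    simp only [quinticMajorant, ENNReal.tsum_mul_right]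
  rw [e]
  refine ENNReal.tsum_le_tsum fun κ => ?_
  have e2 : ∫ t, quintic (fun n => v n t) κ / (D κ : ℂ) * 𝓕 φ t =
      (∫ t, (∏ i, quinticFactor v κ i t) * 𝓕 φ t) / (D κ : ℂ) := by
    rw [← integral_div]
    refine integral_congr_ae (Eventually.of_forall fun t => ?_)
    simp only [quintic_eq_prod]
    ring
  rw [e2, enorm_div_ofReal]
  gcongr
  exact enorm_integral_prod_mul_le (sixApprox_quinticFactor h κ) φ

end QuinticSums

section QuinticEstimate

open Filter Topology

/-! ### The weighted bound for quintic sums -/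

lemma jb_rpow_mul_jb_rpow_le {x z p r : ℝ} (hr : 0 ≤ r) (hr1 : r ≤ 1) (hrp : r ≤ p) :
    jb x ^ (-p) * jb z ^ (-r) ≤ 4 * jb (x + z) ^ (-r) := by
  have h := jb_rpow_mul_le (x := x) (z := z) hr hr1 hrp le_rfl
  have h1 : ∀ y : ℝ, jb y ^ (-(p + r - r)) ≤ 1 := fun y =>
    Real.rpow_le_one_of_one_le_of_nonpos (one_le_jb y) (by linarith)
  have h2 := jb_rpow_pos (x + z) (-r)
  refine h.trans ?_
  nlinarith [h1 x, h1 z, h2]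

/-- The constant in the bound for convolutions of five weighted functions. -/
def fiveConst (b : ℝ) : ℝ≥0∞ := (4 * jbInt (1 + (1 - 2 * b))) ^ 4

lemma fiveConst_lt_top {b : ℝ} (hb : b < 1 / 2) : fiveConst b < ∞ :=
  ENNReal.pow_lt_top (ENNReal.mul_lt_top (by norm_num) (jbInt_lt_top (by linarith)))

/-- Cauchy–Schwarz over the frequencies at fixed `τ`, with `∏⟨k_i⟩^{∓2s}` split between the two
factors. One factor becomes independent of `τ`, and the `τ` integral falls only on the functions `P
κ`. -/
lemma mul_lintegral_quinticMajorant_sq_le {α s a b : ℝ} {F : ℤ → ℝ → ℂ}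
    (hF : ∀ k, Measurable (F k)) (hb : 4 / 9 ≤ b) (hb' : b ≤ 1 / 2) (S : Set (Fin 5 → ℤ))
    (D : ℤ → (Fin 5 → ℤ) → ℝ) (k : ℤ) :
    ENNReal.ofReal (jb k ^ (2 * (s + a))) *
        ∫⁻ τ, (ENNReal.ofReal (jb (τ - disp α k) ^ (-b)) * quinticMajorant S (D k) F τ) ^ 2 ≤
      4 * (∑' κ : S, ENNReal.ofReal (weightTerm α s a (1 - 9 * (1 - 2 * b)) D k κ)) *
        (fiveConst b * ∑' κ : S, ∏ i, (ENNReal.ofReal (jb ((κ : Fin 5 → ℤ) i) ^ (2 * s)) *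
          wNorm b (disp α ((κ : Fin 5 → ℤ) i)) (F ((κ : Fin 5 → ℤ) i)))) := by
  set γ := 1 - 9 * (1 - 2 * b) with hγ
  choose P hPm hPA hP using weightBound_conv5_quinticFourier (α := α) hF hb hb'
  set u : (Fin 5 → ℤ) → ℝ := fun κ => (D k κ)⁻¹ ^ 2 * (∏ i, jb (κ i) ^ (-(2 * s))) *
    jb (disp α k - phase α κ) ^ (-γ) with hu
  have hprod : ∀ (κ : Fin 5 → ℤ) (r : ℝ), 0 < ∏ i, jb (κ i) ^ r := fun κ r =>
    Finset.prod_pos fun i _ => jb_rpow_pos _ _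
  have hu0 : ∀ κ, 0 ≤ u κ := fun κ => by
    have := hprod κ (-(2 * s))
    have := jb_rpow_pos (disp α k - phase α κ) (-γ)
    positivity
  have hpt : ∀ τ, (ENNReal.ofReal (jb (τ - disp α k) ^ (-b)) * quinticMajorant S (D k) F τ) ^ 2 ≤
      (∑' κ : S, 4 * ENNReal.ofReal (u κ)) *
        ∑' κ : S, ENNReal.ofReal (∏ i, jb ((κ : Fin 5 → ℤ) i) ^ (2 * s)) * P κ τ := by
    intro τ
    rw [quinticMajorant, ← ENNReal.tsum_mul_left]
    refine tsum_sq_le_mul fun κ => ?_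
    have p1 := jb_rpow_pos (τ - disp α k) (-b)
    have p2 := jb_rpow_pos (τ - phase α κ) (-γ)
    have p3 := jb_rpow_pos (disp α k - phase α κ) (-γ)
    -- The output weight and the convolution weight combine into a weight in `|k|^{2α} - phase` that
    -- no longer contains `τ`; this needs `γ ≤ 2b`, which holds since `b ≤ 1/2`.
    have hx : (jb (τ - disp α k) ^ (-b)) ^ 2 * jb (τ - phase α κ) ^ (-γ) ≤
        4 * jb (disp α k - phase α κ) ^ (-γ) := by
      have h := jb_rpow_mul_jb_rpow_le (x := disp α k - τ) (z := τ - phase α κ) (p := 2 * b)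
        (r := γ) (by linarith) (by linarith) (by linarith)
      rw [sub_add_sub_cancel] at h
      rw [← jb_neg (τ - disp α k), neg_sub, ← Real.rpow_natCast, ← Real.rpow_mul (jb_pos _).le]
      convert h using 3
      push_cast
      ring
    have hcancel : (∏ i, jb ((κ : Fin 5 → ℤ) i) ^ (-(2 * s))) *
        ∏ i, jb ((κ : Fin 5 → ℤ) i) ^ (2 * s) = 1 := by
      rw [← Finset.prod_mul_distrib]
      refine Finset.prod_eq_one fun i _ => ?_
      rw [← Real.rpow_add (jb_pos _)]
      simp
    calc (ENNReal.ofReal (jb (τ - disp α k) ^ (-b)) *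
          (ENNReal.ofReal |D k κ|⁻¹ * conv5 (quinticFourier F κ) τ)) ^ 2
        = ENNReal.ofReal (jb (τ - disp α k) ^ (-b)) ^ 2 * ENNReal.ofReal |D k κ|⁻¹ ^ 2 *
          conv5 (quinticFourier F κ) τ ^ 2 := by ring
      _ ≤ ENNReal.ofReal (jb (τ - disp α k) ^ (-b)) ^ 2 * ENNReal.ofReal |D k κ|⁻¹ ^ 2 *
          (ENNReal.ofReal (jb (τ - phase α κ) ^ (-γ)) * P κ τ) := by
          gcongr
          exact hP κ τ
      _ = ENNReal.ofReal ((jb (τ - disp α k) ^ (-b)) ^ 2 * jb (τ - phase α κ) ^ (-γ) *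
          (D k κ)⁻¹ ^ 2) * P κ τ := by
          rw [ENNReal.ofReal_mul (by positivity), ENNReal.ofReal_mul (by positivity),
            ENNReal.ofReal_pow p1.le, ← abs_inv,
            ← ENNReal.ofReal_pow (abs_nonneg _), sq_abs]
          ring
      _ ≤ ENNReal.ofReal (4 * jb (disp α k - phase α κ) ^ (-γ) * (D k κ)⁻¹ ^ 2) * P κ τ := by
          gcongr
      _ = ENNReal.ofReal (4 * u κ * ∏ i, jb ((κ : Fin 5 → ℤ) i) ^ (2 * s)) * P κ τ := by
          congr 2
          simp only [hu]
          linear_combination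
            (-(4 * jb (disp α k - phase α κ) ^ (-γ) * (D k κ)⁻¹ ^ 2)) * hcancel
      _ = 4 * ENNReal.ofReal (u κ) *
          (ENNReal.ofReal (∏ i, jb ((κ : Fin 5 → ℤ) i) ^ (2 * s)) * P κ τ) := by
          rw [ENNReal.ofReal_mul (by have := hu0 κ; positivity), ENNReal.ofReal_mul (by norm_num),
            ENNReal.ofReal_ofNat, mul_assoc]
  have hint : ∫⁻ τ, ∑' κ : S, ENNReal.ofReal (∏ i, jb ((κ : Fin 5 → ℤ) i) ^ (2 * s)) * P κ τ ≤
      fiveConst b * ∑' κ : S, ∏ i, (ENNReal.ofReal (jb ((κ : Fin 5 → ℤ) i) ^ (2 * s)) *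
          wNorm b (disp α ((κ : Fin 5 → ℤ) i)) (F ((κ : Fin 5 → ℤ) i))) := by
    rw [lintegral_tsum (fun κ => by have := hPm κ; fun_prop), ← ENNReal.tsum_mul_left]
    refine ENNReal.tsum_le_tsum fun κ => ?_
    rw [lintegral_const_mul _ (hPm κ), Finset.prod_mul_distrib,
      ← ENNReal.ofReal_prod_of_nonneg (fun i _ => (jb_rpow_pos _ _).le), mul_left_comm]
    gcongr
    exact hPA κ
  have hle := lintegral_mono hpt (μ := volume)
  have hm : Measurable fun τ => ∑' κ : S,
      ENNReal.ofReal (∏ i, jb ((κ : Fin 5 → ℤ) i) ^ (2 * s)) * P κ τ :=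
    Measurable.tsum fun κ => by have := hPm κ; fun_prop
  rw [lintegral_const_mul _ hm] at hle
  refine (mul_le_mul_right (hle.trans (mul_le_mul_right hint _)) _).trans (le_of_eq ?_)
  have e : ENNReal.ofReal (jb k ^ (2 * (s + a))) * ∑' κ : S, ENNReal.ofReal (u κ) =
      ∑' κ : S, ENNReal.ofReal (weightTerm α s a γ D k κ) := by
    rw [← ENNReal.tsum_mul_left]
    refine tsum_congr fun κ => ?_
    rw [← ENNReal.ofReal_mul (jb_rpow_pos _ _).le, weightTerm, hu]
    congr 1
    ring
  rw [ENNReal.tsum_mul_left, ← e]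
  ring

lemma tsum_fin_pi_prod (a : ℤ → ℝ≥0∞) (n : ℕ) :
    ∑' κ : Fin n → ℤ, ∏ i, a (κ i) = (∑' k, a k) ^ n := by
  induction n with
  | zero => simp
  | succ n ih =>
    rw [← (Fin.consEquiv (fun _ : Fin (n + 1) => ℤ)).tsum_eq, ENNReal.tsum_prod']
    simp only [Fin.consEquiv_apply, Fin.prod_univ_succ, Fin.cons_zero, Fin.cons_succ,
      ENNReal.tsum_mul_left, ih, ENNReal.tsum_mul_right]
    ring

/-- The linear constraint recovers `k` from the five frequencies, so the sets `S k` are disjoint. -/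
lemma tsum_tsum_freq_le {S : ℤ → Set (Fin 5 → ℤ)}
    (hS : ∀ k, ∀ κ ∈ S k, k - κ 0 + κ 1 - κ 2 + κ 3 - κ 4 = 0) (f : (Fin 5 → ℤ) → ℝ≥0∞) :
    ∑' k, ∑' κ : S k, f κ ≤ ∑' κ, f κ := by
  rw [← ENNReal.tsum_sigma' (fun p : (k : ℤ) × S k => f p.2)]
  refine ENNReal.tsum_comp_le_tsum_of_injective
    (f := fun p : (k : ℤ) × S k => (p.2 : Fin 5 → ℤ)) ?_ f
  rintro ⟨k, κ, hκ⟩ ⟨k', κ', hκ'⟩ h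
  simp only at h
  subst h
  have h1 := hS k κ hκ
  have h2 := hS k' κ hκ'
  obtain rfl : k = k' := by linarith
  rfl

lemma eLpNorm_six_sq_le {v F : ℝ → ℂ} (h : TemperedPair v F) (hF : Measurable F)
    {b ω : ℝ} (hb : 2 / 5 ≤ b) (hb' : b < 1 / 2) (hA : wNorm b ω F < ∞) :
    eLpNorm v 6 ^ 2 ≤ sixConst b ^ (3⁻¹ : ℝ) * wNorm b ω F := by
  rw [← ENNReal.pow_le_pow_left_iff (n := 3) (by norm_num), mul_pow, ← pow_mul]
  refine (h.eLpNorm_pow_six_le hF hb hb' hA).trans (le_of_eq ?_)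
  congr 1
  rw [← ENNReal.rpow_ofNat, ← ENNReal.rpow_mul]
  norm_num

/-- The hypothesis `hw` gives the norm bound and `hsum` the absolute convergence. The latter is
applied to `c k = ‖v k‖₆`, whose weighted `ℓ²` sum is controlled by `eLpNorm_six_sq_le`. -/
theorem exists_temperedPair_quintic {α s a b : ℝ} {S : ℤ → Set (Fin 5 → ℤ)}
    {D : ℤ → (Fin 5 → ℤ) → ℝ} {C : ℝ≥0∞} (hC : C < ∞) (hb : 4 / 9 ≤ b) (hb' : b < 1 / 2)
    (hS : ∀ k, ∀ κ ∈ S k, k - κ 0 + κ 1 - κ 2 + κ 3 - κ 4 = 0)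
    (hw : ∀ k, ∑' κ : S k, ENNReal.ofReal (weightTerm α s a (1 - 9 * (1 - 2 * b)) D k κ) ≤ C)
    (hsum : ∀ c : ℤ → ℝ≥0, ∑' k : ℤ, ENNReal.ofReal (jb k ^ (2 * s) * (c k : ℝ) ^ 2) < ∞ →
      ∀ k, ∑' κ : S k, ENNReal.ofReal (|D k κ|⁻¹ * ∏ i, (c ((κ : Fin 5 → ℤ) i) : ℝ)) < ∞)
    {v F : ℤ → ℝ → ℂ} (hp : ∀ k, TemperedPair (v k) (F k)) (hF : ∀ k, Measurable (F k))
    (hM : ∑' k : ℤ, ENNReal.ofReal (jb k ^ (2 * s)) * wNorm b (disp α k) (F k) < ∞) :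
    (∀ k, ∀ᵐ t, Summable fun κ : S k => quintic (fun n => v n t) κ / (D k κ : ℂ)) ∧
    ∃ G : ℤ → ℝ → ℂ,
      (∀ k, TemperedPair (fun t => ∑' κ : S k, quintic (fun n => v n t) κ / (D k κ : ℂ)) (G k)) ∧
      ∑' k : ℤ, ENNReal.ofReal (jb k ^ (2 * (s + a))) * wNorm (-b) (disp α k) (G k) ≤
        4 * C * fiveConst b *
          (∑' k : ℤ, ENNReal.ofReal (jb k ^ (2 * s)) * wNorm b (disp α k) (F k)) ^ 5 := by
  set A : ℤ → ℝ≥0∞ := fun k => ENNReal.ofReal (jb k ^ (2 * s)) * wNorm b (disp α k) (F k) with hA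
  have hjb : ∀ (k : ℤ) (r : ℝ), ENNReal.ofReal (jb k ^ r) ≠ 0 := fun k r =>
    (ENNReal.ofReal_pos.2 (jb_rpow_pos _ _)).ne'
  have hfinA : ∀ k, wNorm b (disp α k) (F k) < ∞ := by
    intro k
    have h1 : A k < ∞ := (ENNReal.le_tsum k).trans_lt hM
    exact ENNReal.lt_top_of_mul_ne_top_right h1.ne (hjb _ _)
  have h6 : ∀ k, SixApprox (v k) (fun τ => ‖F k τ‖ₑ) := fun k =>
    (hp k).sixApprox (hF k) (by linarith) hb' (hfinA k)
  have hv := fun k => (h6 k).memLp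
  set c : ℤ → ℝ≥0 := fun k => (eLpNorm (v k) 6).toNNReal with hc
  have hcv : ∀ k, ENNReal.ofReal (c k) = eLpNorm (v k) 6 := fun k => by
    rw [ENNReal.ofReal_coe_nnreal, hc, ENNReal.coe_toNNReal (hv k).2.ne]
  have hcs : ∑' k : ℤ, ENNReal.ofReal (jb k ^ (2 * s) * (c k : ℝ) ^ 2) < ∞ := by
    refine lt_of_le_of_lt (ENNReal.tsum_le_tsum
      (g := fun k => sixConst b ^ (3⁻¹ : ℝ) * A k) fun k => ?_) ?_
    · rw [ENNReal.ofReal_mul (jb_rpow_pos _ _).le, ENNReal.ofReal_pow NNReal.zero_le_coe, hcv,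
        hA, mul_left_comm]
      gcongr
      exact eLpNorm_six_sq_le (hp k) (hF k) (by linarith) hb' (hfinA k)
    · rw [ENNReal.tsum_mul_left]
      exact ENNReal.mul_lt_top
        (ENNReal.rpow_lt_top_of_nonneg (by norm_num) (sixConst_lt_top hb').ne) hM
  have hsum' : ∀ k, ∑' κ : S k, ENNReal.ofReal |D k κ|⁻¹ *
      ∏ i, eLpNorm (v ((κ : Fin 5 → ℤ) i)) 6 < ∞ := by
    intro k
    refine lt_of_le_of_lt (le_of_eq (tsum_congr fun κ => ?_)) (hsum c hcs k)
    rw [ENNReal.ofReal_mul (by positivity),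
      ENNReal.ofReal_prod_of_nonneg (fun i _ => NNReal.zero_le_coe)]
    simp only [hcv]
  refine ⟨fun k => ae_summable_quintic hv (hsum' k), ?_⟩
  set Q : ℤ → ℝ≥0∞ := fun k =>
    ∫⁻ τ, (ENNReal.ofReal (jb (τ - disp α k) ^ (-b)) * quinticMajorant (S k) (D k) F τ) ^ 2
  have hQ : ∀ k : ℤ, ENNReal.ofReal (jb k ^ (2 * (s + a))) * Q k ≤
      4 * C * fiveConst b * ∑' κ : S k, ∏ i, A ((κ : Fin 5 → ℤ) i) := by
    intro k
    refine (mul_lintegral_quinticMajorant_sq_le hF hb hb'.le (S k) D k).trans ?_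
    rw [mul_assoc (4 * C)]
    gcongr
    exact hw k
  have htot : ∑' k : ℤ, ∑' κ : S k, ∏ i, A ((κ : Fin 5 → ℤ) i) ≤ (∑' k, A k) ^ 5 := by
    rw [← tsum_fin_pi_prod]
    exact tsum_tsum_freq_le hS (fun κ => ∏ i, A (κ i))
  have hK : 4 * C * fiveConst b < ∞ :=
    ENNReal.mul_lt_top (ENNReal.mul_lt_top (by norm_num) hC) (fiveConst_lt_top hb')
  have hQfin : ∀ k, Q k < ∞ := by
    intro k
    have h1 : ENNReal.ofReal (jb k ^ (2 * (s + a))) * Q k < ∞ :=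
      (hQ k).trans_lt (ENNReal.mul_lt_top hK
        (((ENNReal.le_tsum k).trans htot).trans_lt (ENNReal.pow_lt_top hM)))
    exact ENNReal.lt_top_of_mul_ne_top_right h1.ne (hjb _ _)
  choose G hG hGQ using fun k => exists_temperedPair
    (integrable_tsum_quintic_mul hv (hsum' k)) (measurable_quinticMajorant hF)
    (enorm_integral_tsum_quintic_mul_le hF h6 (hsum' k)) (hQfin k)
  refine ⟨G, hG, ?_⟩
  calc _ ≤ ∑' k : ℤ, 4 * C * fiveConst b * ∑' κ : S k, ∏ i, A ((κ : Fin 5 → ℤ) i) :=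
        ENNReal.tsum_le_tsum fun k => (mul_le_mul_right (hGQ k) _).trans (hQ k)
    _ ≤ _ := by
        rw [ENNReal.tsum_mul_left]
        gcongr

end QuinticEstimate

section Scaling

open Filter Topology
open scoped FourierTransform SchwartzMap

/-! ### Change of normalization of the Fourier transform -/

lemma exists_schwartz_comp_mul {r : ℝ} (hr : r ≠ 0) (φ : 𝓢(ℝ, ℂ)) :
    ∃ ψ : 𝓢(ℝ, ℂ), ∀ x, ψ x = φ (r * x) := by
  refine ⟨SchwartzMap.compCLMOfContinuousLinearEquiv ℂ
    (ContinuousLinearEquiv.unitsEquivAut ℝ (Units.mk0 r hr)) φ, fun x => ?_⟩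
  simp [mul_comm]

lemma integral_mul_exp_eq_fourier (φ : 𝓢(ℝ, ℂ)) (x : ℝ) :
    ∫ τ : ℝ, φ τ * Complex.exp (-(Complex.I * (τ : ℂ) * ((2 * Real.pi * x : ℝ) : ℂ))) =
      𝓕 φ x := by
  rw [SchwartzMap.fourier_coe, Real.fourier_eq']
  refine integral_congr_ae (Eventually.of_forall fun τ => ?_)
  simp only [smul_eq_mul, RCLike.inner_apply, conj_trivial]
  rw [mul_comm]
  congr 2
  push_cast
  ring

/-- The substitution `t = 2πx` passes from the kernel `e^{-iτt}` to `e^{-2πiτx}` and leaves `F`,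
hence all weights in `τ`, unchanged. -/
lemma IsTimeFourier.temperedPair {f F : ℝ → ℂ} (h : IsTimeFourier f F) :
    TemperedPair (fun x => ((2 * Real.pi : ℝ) : ℂ) * f (2 * Real.pi * x)) F := by
  have hpi : (2 * Real.pi : ℝ) ≠ 0 := Real.two_pi_pos.ne'
  refine ⟨fun φ => ?_, h.2.1, fun φ => ?_⟩
  · obtain ⟨ψ, hψ⟩ := exists_schwartz_comp_mul (inv_ne_zero hpi) φ
    have h1 := ((h.1 ψ).comp_mul_left' hpi).const_mul ((2 * Real.pi : ℝ) : ℂ)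
    refine h1.congr (Eventually.of_forall fun x => ?_)
    simp only [hψ, inv_mul_cancel_left₀ hpi]
    ring
  · have h1 := Measure.integral_comp_mul_left (fun t : ℝ => f t *
      ∫ τ : ℝ, φ τ * Complex.exp (-(Complex.I * (τ : ℂ) * (t : ℂ)))) (2 * Real.pi)
    simp only [integral_mul_exp_eq_fourier] at h1
    rw [h.2.2 φ]
    simp only [mul_assoc ((2 * Real.pi : ℝ) : ℂ)]
    rw [integral_const_mul, h1, abs_of_pos (by positivity), Complex.real_smul, ← mul_assoc,
      ← Complex.ofReal_mul, mul_inv_cancel₀ hpi]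
    simp

lemma TemperedPair.isTimeFourier {v G : ℝ → ℂ} (h : TemperedPair v G) (c : ℂ) :
    IsTimeFourier (fun t => c * (((2 * Real.pi)⁻¹ : ℝ) * v ((2 * Real.pi)⁻¹ * t)))
      (fun τ => c * G τ) := by
  have hpi : (2 * Real.pi : ℝ) ≠ 0 := Real.two_pi_pos.ne'
  refine ⟨fun φ => ?_, fun φ => ?_, fun φ => ?_⟩
  · obtain ⟨ψ, hψ⟩ := exists_schwartz_comp_mul hpi φ
    have h1 := ((h.integrable_left ψ).comp_mul_left' (inv_ne_zero hpi)).const_mul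
      (c * ((2 * Real.pi)⁻¹ : ℝ))
    refine h1.congr (Eventually.of_forall fun x => ?_)
    simp only [hψ, mul_inv_cancel_left₀ hpi]
    ring
  · simpa only [mul_assoc] using (h.integrable_right φ).const_mul c
  · have h1 := Measure.integral_comp_mul_left (fun x : ℝ => v x * 𝓕 φ x) (2 * Real.pi)⁻¹
    simp only [← integral_mul_exp_eq_fourier φ, mul_inv_cancel_left₀ hpi] at h1
    simp only [mul_assoc c]
    rw [integral_const_mul, integral_const_mul, h.integral_eq]
    simp only [mul_assoc (((2 * Real.pi)⁻¹ : ℝ) : ℂ)]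
    rw [integral_const_mul, h1, inv_inv, abs_of_pos Real.two_pi_pos, Complex.real_smul,
      ← mul_assoc (((2 * Real.pi)⁻¹ : ℝ) : ℂ), ← Complex.ofReal_mul, inv_mul_cancel₀ hpi,
      Complex.ofReal_one, one_mul]
    simp only [integral_mul_exp_eq_fourier φ]

lemma weightedL2_eq (α s b : ℝ) (F : ℤ → ℝ → ℂ) :
    weightedL2 α s b F =
      (∑' k : ℤ, ENNReal.ofReal (jb k ^ (2 * s)) * wNorm b (disp α k) (F k)) ^ (1 / 2 : ℝ) := by
  unfold weightedL2
  congr 1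
  refine tsum_congr fun k => ?_
  rw [wNorm, ← lintegral_const_mul' _ _ ENNReal.ofReal_ne_top]
  refine lintegral_congr fun τ => ?_
  rw [ENNReal.ofReal_mul (jb_rpow_pos _ _).le, mul_comm 2 s, Real.rpow_mul (jb_pos _).le,
    Real.rpow_two, ENNReal.ofReal_pow (jb_rpow_pos _ _).le]
  ring

lemma wNorm_congr_ae {b ω : ℝ} {F G : ℝ → ℂ} (h : F =ᵐ[volume] G) :
    wNorm b ω F = wNorm b ω G := by
  refine lintegral_congr_ae ?_
  filter_upwards [h] with τ hτ
  rw [hτ]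

lemma quintic_mul_left (r : ℝ) (a : ℤ → ℂ) (κ : Fin 5 → ℤ) :
    quintic (fun n => (r : ℂ) * a n) κ = (r : ℂ) ^ 5 * quintic a κ := by
  simp only [quintic, star_mul', Complex.star_def, Complex.conj_ofReal]
  ring

theorem xNorm_quintic_le {α s a b : ℝ} {S : ℤ → Set (Fin 5 → ℤ)}
    {D : ℤ → (Fin 5 → ℤ) → ℝ} {C : ℝ≥0∞} (hC : C < ∞) (hb : 4 / 9 ≤ b) (hb' : b < 1 / 2)
    (hS : ∀ k, ∀ κ ∈ S k, k - κ 0 + κ 1 - κ 2 + κ 3 - κ 4 = 0)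
    (hw : ∀ k, ∑' κ : S k, ENNReal.ofReal (weightTerm α s a (1 - 9 * (1 - 2 * b)) D k κ) ≤ C)
    (hsum : ∀ c : ℤ → ℝ≥0, ∑' k : ℤ, ENNReal.ofReal (jb k ^ (2 * s) * (c k : ℝ) ^ 2) < ∞ →
      ∀ k, ∑' κ : S k, ENNReal.ofReal (|D k κ|⁻¹ * ∏ i, (c ((κ : Fin 5 → ℤ) i) : ℝ)) < ∞)
    {f F : ℤ → ℝ → ℂ} (hf : ∀ k, IsTimeFourier (f k) (F k)) (hF : weightedL2 α s b F < ∞)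
    {z : ℂ} (hz : ‖z‖ ≤ 2) :
    (∀ᵐ t, ∀ k, Summable fun κ : S k => quintic (fun n => f n t) κ / (D k κ : ℂ)) ∧
    xNorm α (s + a) (-b)
        (fun k t => z * ∑' κ : S k, quintic (fun n => f n t) κ / (D k κ : ℂ)) ≤
      (4 * C * fiveConst b) ^ (1 / 2 : ℝ) * weightedL2 α s b F ^ 5 := by
  set p : ℝ := 2 * Real.pi with hp
  have hp0 : 0 < p := Real.two_pi_pos
  have hpC : (p : ℂ) ≠ 0 := Complex.ofReal_ne_zero.2 hp0.ne'
  set v : ℤ → ℝ → ℂ := fun k x => (p : ℂ) * f k (p * x) with hv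
  have hpair : ∀ k, TemperedPair (v k) (F k) := fun k => (hf k).temperedPair
  -- A measurable representative; the weighted norms do not see the change on a null set.
  set F' : ℤ → ℝ → ℂ := fun k => (hpair k).aestronglyMeasurable_right.mk with hF'
  have hFF' : ∀ k, F k =ᵐ[volume] F' k := fun k =>
    (hpair k).aestronglyMeasurable_right.ae_eq_mk
  have hFm : ∀ k, Measurable (F' k) := fun k =>
    (hpair k).aestronglyMeasurable_right.stronglyMeasurable_mk.measurable
  set M := ∑' k : ℤ, ENNReal.ofReal (jb k ^ (2 * s)) * wNorm b (disp α k) (F' k) with hM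
  have hFM : weightedL2 α s b F = M ^ (1 / 2 : ℝ) := by
    rw [weightedL2_eq]
    congr 1
    exact tsum_congr fun k => by rw [wNorm_congr_ae (hFF' k)]
  have hMfin : M < ∞ := by
    rw [hFM] at hF
    exact (ENNReal.rpow_lt_top_iff_of_pos (by norm_num)).1 hF
  obtain ⟨hsumm, G, hG, hGle⟩ := exists_temperedPair_quintic hC hb hb' hS hw hsum
    (fun k => (hpair k).congr_right (hFF' k)) hFm hMfin
  have hquint : ∀ (t : ℝ) (κ : Fin 5 → ℤ), quintic (fun n => v n (p⁻¹ * t)) κ =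
      (p : ℂ) ^ 5 * quintic (fun n => f n t) κ := by
    intro t κ
    rw [← quintic_mul_left]
    simp only [hv, mul_inv_cancel_left₀ hp0.ne']
  refine ⟨?_, ?_⟩
  · have h1 := (Measure.quasiMeasurePreserving_smul (volume : Measure ℝ)
      (inv_ne_zero hp0.ne')).ae (ae_all_iff.2 hsumm)
    filter_upwards [h1] with t ht k
    have h2 := (ht k).mul_left ((p : ℂ) ^ 5)⁻¹
    refine h2.congr fun κ => ?_
    rw [smul_eq_mul, hquint, mul_div_assoc, inv_mul_cancel_left₀ (pow_ne_zero 5 hpC)]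
  -- Rescaling the modes yields `p⁵` in the quintic term and undoing it yields `p⁻¹`, so a factor
  -- `p⁴` has to be divided out. Since `|z| ≤ 2 ≤ p⁴`, the resulting constant has modulus at most 1.
  · set c : ℂ := z * ((p : ℂ) ^ 4)⁻¹ with hc
    have hc1 : ‖c‖ ≤ 1 := by
      have h2 : (2 : ℝ) ≤ p := by
        rw [hp]
        linarith [Real.pi_gt_three]
      have h3 : (2 : ℝ) ≤ p ^ 4 := h2.trans (le_self_pow₀ (by linarith) (by norm_num))
      rw [hc, norm_mul, norm_inv, norm_pow, Complex.norm_real, Real.norm_eq_abs,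
        abs_of_pos hp0, ← div_eq_mul_inv, div_le_one (by positivity)]
      exact hz.trans h3
    have hTF : ∀ k, IsTimeFourier
        (fun t => z * ∑' κ : S k, quintic (fun n => f n t) κ / (D k κ : ℂ))
        (fun τ => c * G k τ) := by
      intro k
      have h1 := (hG k).isTimeFourier c
      convert h1 using 2 with t
      simp only [← hp, hquint, mul_div_assoc, tsum_mul_left, hc]
      push_cast
      field_simp
    refine (iInf₂_le (fun k τ => c * G k τ) hTF).trans ?_
    rw [weightedL2_eq, hFM]
    have h2 : ∑' k : ℤ, ENNReal.ofReal (jb k ^ (2 * (s + a))) *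
        wNorm (-b) (disp α k) (fun τ => c * G k τ) ≤ 4 * C * fiveConst b * M ^ 5 := by
      refine le_trans (ENNReal.tsum_le_tsum fun k => ?_) hGle
      refine mul_le_mul_right (wNorm_mono fun τ => ?_) _
      rw [enorm_mul]
      refine mul_le_of_le_one_left' ?_
      rw [← ofReal_norm]
      exact ENNReal.ofReal_le_one.2 hc1
    refine (ENNReal.rpow_le_rpow h2 (by norm_num)).trans (le_of_eq ?_)
    rw [ENNReal.mul_rpow_of_nonneg _ _ (by norm_num), ← ENNReal.rpow_natCast,
      ← ENNReal.rpow_natCast, ← ENNReal.rpow_mul, ← ENNReal.rpow_mul, mul_comm (1 / 2 : ℝ)]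

/-- The estimate is available for each admissible transform `F`. Dividing by `K` and taking a fifth
root isolates the weighted norm of `F`, so the infimum can be taken without uniqueness of the
transform; this is why `K` must be neither zero nor infinite. -/
lemma xNorm_le_mul_pow_of_forall {α s b s' b' : ℝ} {N f : ℤ → ℝ → ℂ} {K : ℝ≥0∞} (hK : K ≠ 0)
    (hK' : K ≠ ∞)
    (h : ∀ F : ℤ → ℝ → ℂ, (∀ k, IsTimeFourier (f k) (F k)) → weightedL2 α s b F < ∞ →
      xNorm α s' b' N ≤ K * weightedL2 α s b F ^ 5) :
    xNorm α s' b' N ≤ K * xNorm α s b f ^ 5 := by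
  have h1 : (K⁻¹ * xNorm α s' b' N) ^ (5⁻¹ : ℝ) ≤ xNorm α s b f := by
    refine le_iInf₂ fun F hF => ?_
    rcases eq_or_ne (weightedL2 α s b F) ∞ with htop | htop
    · rw [htop]
      exact le_top
    · rw [ENNReal.rpow_inv_le_iff (by norm_num), ENNReal.rpow_ofNat,
        ENNReal.inv_mul_le_iff hK hK']
      exact h F hF htop.lt_top
  rwa [ENNReal.rpow_inv_le_iff (by norm_num), ENNReal.rpow_ofNat,
    ENNReal.inv_mul_le_iff hK hK'] at h1

end Scaling

end FracNLS

end

/-! ### Choice of the exponents and conclusion -/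

open FracNLS

theorem mainTheorem6 (α c s a : ℝ) (hα : 1 / 2 < α) (hα' : α ≤ 1) (hc : 0 < c)
    (hs : 3 / 4 - α / 2 < s) (hs' : s ≤ 1 / 2)
    (ha : a ≤ min (2 * α - 1) (2 * s + α - 1))
    (ha' : min (2 * α - 1) (2 * s + α - 1) = 2 * s + α - 1 → a < 2 * s + α - 1) :
    ∃ b₀ : ℝ, b₀ < 1 / 2 ∧ ∀ b : ℝ, b₀ < b → b < 1 / 2 →
      ∃ C : ℝ≥0, ∀ u : ℝ → FracNLS.Torus → ℂ, FracNLS.MemX α s b u →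
        (∀ᵐ t : ℝ, ∀ k : ℤ,
          Summable (fun κ : FracNLS.freq1 α c k =>
            FracNLS.nr1Term α (fun n => FracNLS.modes u n t) k κ) ∧
          Summable (fun κ : FracNLS.freq2 α c k =>
            FracNLS.nr2Term α (fun n => FracNLS.modes u n t) k κ)) ∧
        FracNLS.xNorm α (s + a) (-b) (FracNLS.NR1 α c u) ≤
          C * FracNLS.xNorm α s b (FracNLS.modes u) ^ 5 ∧
        FracNLS.xNorm α (s + a) (-b) (FracNLS.NR2 α c u) ≤
          C * FracNLS.xNorm α s b (FracNLS.modes u) ^ 5 := by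
  have ha1 : a ≤ 2 * α - 1 := ha.trans (min_le_left _ _)
  have ha2 : a < 2 * s + α - 1 := by
    rcases (ha.trans (min_le_right _ _)).lt_or_eq with h | h
    · exact h
    · exact ha' (le_antisymm (min_le_right _ _) (h ▸ ha))
  -- Half the excess of `4s` over `1 + (2 - 2α)`, positive by the lower bound on `s`.
  set η := (4 * s - 3 + 2 * α) / 2 with hη
  have hη0 : 0 < η := by linarith
  -- With `ε = 9(1-2b)`, the bound `1/36` ensures `ε ≤ 1/2` (and `b ≥ 4/9`), and `η/144` ensures `8ε
  -- ≤ η`.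
  refine ⟨1 / 2 - min (1 / 36) (η / 144), by
    have : 0 < min (1 / 36 : ℝ) (η / 144) := lt_min (by norm_num) (by positivity)
    linarith, fun b hb hb' => ?_⟩
  have hb1 : 1 / 2 - 1 / 36 < b := lt_of_le_of_lt (by linarith [min_le_left (1 / 36) (η / 144)]) hb
  have hb2 : 1 / 2 - η / 144 < b :=
    lt_of_le_of_lt (by linarith [min_le_right (1 / 36) (η / 144)]) hb
  obtain ⟨C₁, hC₁⟩ := exists_tsum_innerTerm_le (α := α) (s := s) (η := η)
    (ε := 9 * (1 - 2 * b)) hα hα' (by linarith) (by linarith) (by linarith) (by linarith)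
    (by linarith)
  obtain ⟨C₂, hC₂⟩ := exists_tsum_outerTerm_le (c := c) hα hα' hc (by linarith) hs' ha1 ha2
  set K : ℝ≥0∞ := (4 * ((C₁ : ℝ≥0∞) * C₂) * fiveConst b) ^ (1 / 2 : ℝ) with hK
  have hCtop : (C₁ : ℝ≥0∞) * C₂ < ∞ := ENNReal.mul_lt_top ENNReal.coe_lt_top ENNReal.coe_lt_top
  have hKtop : K ≠ ∞ := ENNReal.rpow_ne_top_of_nonneg (by norm_num)
    (ENNReal.mul_lt_top (ENNReal.mul_lt_top (by norm_num) hCtop) (fiveConst_lt_top hb')).ne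
  -- Adding 1 makes the constant nonzero, as `xNorm_le_mul_pow_of_forall` requires.
  refine ⟨(K + 1).toNNReal, fun u hu => ?_⟩
  rw [ENNReal.coe_toNNReal (by simp [hKtop])]
  have h1 := fun {F : ℤ → ℝ → ℂ} (hF : ∀ k, IsTimeFourier (modes u k) (F k)) hF' =>
    xNorm_quintic_le (S := freq1 α c) hCtop (by linarith) hb' (fun k κ hκ => hκ.1)
      (tsum_weightTerm_freq1_le hC₁ hC₂)
      (tsum_freq1_lt_top hα hα' hc (by linarith) (by linarith)) hF hF' (z := 2) (by simp)
  have h2 := fun {F : ℤ → ℝ → ℂ} (hF : ∀ k, IsTimeFourier (modes u k) (F k)) hF' =>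
    xNorm_quintic_le (S := freq2 α c) hCtop (by linarith) hb' (fun k κ hκ => hκ.1)
      (tsum_weightTerm_freq2_le hC₁ hC₂)
      (tsum_freq2_lt_top hα hα' hc (by linarith) (by linarith)) hF hF' (z := -1) (by simp)
  have hK1 : K + 1 ≠ 0 := by simp
  have hK1' : K + 1 ≠ ∞ := by simp [hKtop]
  refine ⟨?_, ?_, ?_⟩
  · have hlt := hu.2
    simp only [xNorm, iInf_lt_iff] at hlt
    obtain ⟨F, hF, hF'⟩ := hlt
    filter_upwards [(h1 hF hF').1, (h2 hF hF').1] with t ht1 ht2 k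
    exact ⟨ht1 k, ht2 k⟩
  · refine xNorm_le_mul_pow_of_forall hK1 hK1' fun F hF hF' => ?_
    exact (h1 hF hF').2.trans (mul_le_mul_left le_self_add _)
  · refine xNorm_le_mul_pow_of_forall hK1 hK1' fun F hF hF' => ?_
    have h3 := (h2 hF hF').2.trans (mul_le_mul_left (le_self_add (b := 1)) _)
    refine le_trans (le_of_eq ?_) h3
    congr 1
    ext k t
    rw [neg_one_mul]
    rfl
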